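/- Let $K\subset\mathbb R^3$ be a nondegenerate tetrahedron with vertices $x_0,\dots,x_3$ and barycentric coordinates $\lambda_0,\dots,\lambda_3$. For $0\le i\le 3$ let $n_i$ be a unit normal vector of the face opposite $x_i$, and for $j<l$ let $t_{j,l}$ be a unit tangent vector of the edge joining $x_j$ and $x_l$ (the signs are arbitrary). Let $P_m(K)$ be the space of real polynomials of degree at most $m$ and $P_m(K;\mathbb S)$ the space of polynomials of degree at most $m$ with values in the symmetric $3\times3$ matrices. Put $$P_m^{(0)}(K)=\{p\in P_m(K): p(x_a)=0,\ 0\le a\le 3\},\qquad P_m^{j,l,0}(K)=\{p\in P_m(K): p(x_j)=p(x_l)=0\},$$ $$B_{K,k}^{\mathrm{curl};\mathbb S}=\sum_{i=0}^3\lambda_j\lambda_l\lambda_m\,P_{k-3}^{(0)}(K)\,n_in_i^T+\lambda_0\lambda_1\lambda_2\lambda_3\,P_{k-4}(K;\mathbb S),\qquad\{i,j,l,m\}=\{0,1,2,3\},$$ $$B_{K,k-1}^{\mathrm{div};\mathbb T}=\sum_{i=0}^3\ \sum_{\substack{0\le j<l\le3\\ j,l\ne i}}\lambda_j\lambda_l\,P_{k-3}^{j,l,0}(K)\,n_it_{j,l}^T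 .$$ Let $RT=\{a+bx: a\in\mathbb R^3,\ b\in\mathbb R\}$ and let $$P_{k-2}^{(0)}(K;\mathbb R^3)/RT=\Big\{q\in P_{k-2}^{(0)}(K)^3:\ \int_K q\cdot w\,dx=0\ \text{ for all } w\in RT\Big\}.$$ The operators $\mathrm{curl}$ and $\mathrm{div}$ act on matrix-valued functions row by row. Suppose that $k\ge7$. Then the sequence $$0\to(\lambda_0\lambda_1\lambda_2\lambda_3)^2P_{k-6}(K)\xrightarrow{\ \mathrm{hess}\ }B_{K,k}^{\mathrm{curl};\mathbb S}\xrightarrow{\ \mathrm{curl}\ }B_{K,k-1}^{\mathrm{div};\mathbb T}\xrightarrow{\ \mathrm{div}\ }P_{k-2}^{(0)}(K;\mathbb R^3)/RT\to0$$ is a well-defined complex (each operator maps each space into the next) and is exact: $\mathrm{hess}$ is injective on the first space, the kernel of $\mathrm{curl}$ is the range of $\mathrm{hess}$, the kernel of $\mathrm{div}$ is the range of $\mathrm{curl}$, and $\mathrm{div}$ is surjective onto the last space. -/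

import Mathlib

open MeasureTheory

noncomputable section

namespace BubbleComplex

/-- Euclidean space `ℝ³`. -/
abbrev E3 : Type := EuclideanSpace ℝ (Fin 3)

/-- Real polynomials in the three Cartesian coordinates. -/
abbrev Poly : Type := MvPolynomial (Fin 3) ℝ

/-- `ℝ³`-valued polynomials. -/
abbrev VecPoly : Type := Fin 3 → Poly

/-- `ℝ^{3 × 3}`-valued polynomials. -/
abbrev MatPoly : Type := Matrix (Fin 3) (Fin 3) Poly

/-- A nondegenerate tetrahedron, given by its four affinely independent vertices
`K 0, K 1, K 2, K 3`; its barycentric coordinates are `K.coord i`. -/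
abbrev Tetrahedron : Type := AffineBasis (Fin 4) ℝ E3

/-- The value of a polynomial at a point of `ℝ³`. -/
def evalAt (x : E3) (p : Poly) : ℝ := MvPolynomial.eval (fun j => x j) p

/-- The tetrahedron as a (closed) set of points. -/
def body (K : Tetrahedron) : Set E3 := convexHull ℝ (Set.range K)

/-- The barycentric coordinate `λ_i` of the tetrahedron, written as a polynomial of degree one. -/
def lam (K : Tetrahedron) (i : Fin 4) : Poly :=
  MvPolynomial.C (K.coord i 0) +
    ∑ j : Fin 3, MvPolynomial.C (K.coord i (EuclideanSpace.single j 1) - K.coord i 0) *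
      MvPolynomial.X j

/-- `lam K i` is the polynomial whose values are the barycentric coordinate `λ_i`. -/
theorem evalAt_lam (K : Tetrahedron) (i : Fin 4) (x : E3) :
    evalAt x (lam K i) = K.coord i x := by
  have key : ∀ v : E3, K.coord i v = (K.coord i).linear v + K.coord i 0 := fun v => by
    have h := (K.coord i).map_vadd 0 v
    simpa using h
  have hx : x = ∑ j : Fin 3, x j • (EuclideanSpace.single j (1 : ℝ) : E3) := by
    ext a
    simp [Pi.single_apply]
  have hlin : (K.coord i).linear x
      = ∑ j : Fin 3, x j * (K.coord i).linear (EuclideanSpace.single j (1 : ℝ)) := by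
    conv_lhs => rw [hx]
    simp only [map_sum, map_smul, smul_eq_mul]
  rw [key x, hlin, evalAt, lam, add_comm]
  simp only [map_add, map_sum, map_mul, MvPolynomial.eval_C, MvPolynomial.eval_X]
  congr 1
  refine Finset.sum_congr rfl fun j _ => ?_
  rw [key (EuclideanSpace.single j 1)]
  ring

/-- `P_m(K)`: polynomials of (total) degree at most `m`. -/
def polyDeg (m : ℕ) : Submodule ℝ Poly := MvPolynomial.restrictTotalDegree (Fin 3) ℝ m

/-- The polynomials in `P_m(K)` that vanish at the vertices `K a`, `a ∈ S`. -/
def polyVanish (K : Tetrahedron) (m : ℕ) (S : Set (Fin 4)) : Submodule ℝ Poly where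
  carrier := {p | p ∈ polyDeg m ∧ ∀ a ∈ S, evalAt (K a) p = 0}
  zero_mem' := ⟨Submodule.zero_mem _, fun a _ => by simp [evalAt]⟩
  add_mem' := by
    rintro p q ⟨hp, hp'⟩ ⟨hq, hq'⟩
    refine ⟨Submodule.add_mem _ hp hq, fun a ha => ?_⟩
    have h1 := hp' a ha
    have h2 := hq' a ha
    simp only [evalAt] at h1 h2 ⊢
    rw [map_add, h1, h2, add_zero]
  smul_mem' := by
    rintro c p ⟨hp, hp'⟩
    refine ⟨Submodule.smul_mem _ c hp, fun a ha => ?_⟩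
    have h1 := hp' a ha
    simp only [evalAt] at h1 ⊢
    rw [MvPolynomial.smul_eval, h1, mul_zero]

/-- `P_m^{(0)}(K)`: the polynomials in `P_m(K)` that vanish at all four vertices. -/
def polyZero (K : Tetrahedron) (m : ℕ) : Submodule ℝ Poly := polyVanish K m Set.univ

/-- `P_m(K; 𝕊)`: symmetric-matrix-valued polynomials of degree at most `m`. -/
def symPoly (m : ℕ) : Submodule ℝ MatPoly where
  carrier := {τ | τ.IsSymm ∧ ∀ a b, τ a b ∈ polyDeg m}
  zero_mem' := ⟨Matrix.isSymm_zero, fun _ _ => Submodule.zero_mem _⟩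
  add_mem' := fun h h' => ⟨h.1.add h'.1, fun a b => Submodule.add_mem _ (h.2 a b) (h'.2 a b)⟩
  smul_mem' := fun c _ h => ⟨h.1.smul c, fun a b => Submodule.smul_mem _ c (h.2 a b)⟩

/-! ### The differential operators -/

/-- The Hessian of a scalar polynomial. -/
def hess : Poly →ₗ[ℝ] MatPoly where
  toFun u := Matrix.of fun a b => MvPolynomial.pderiv a (MvPolynomial.pderiv b u)
  map_add' u v := by ext1 a b; simp
  map_smul' c u := by ext1 a b; simp

/-- The curl acting row by row; component `b` (cyclically modulo 3) of the curl of a row `v` is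
`∂_{b+1} v_{b+2} - ∂_{b+2} v_{b+1}`. -/
def curl : MatPoly →ₗ[ℝ] MatPoly where
  toFun σ := Matrix.of fun a b =>
    MvPolynomial.pderiv (b + 1) (σ a (b + 2)) - MvPolynomial.pderiv (b + 2) (σ a (b + 1))
  map_add' σ τ := by ext1 a b; simp; ring
  map_smul' c σ := by ext1 a b; simp [smul_sub]

/-- The divergence acting row by row. -/
def div : MatPoly →ₗ[ℝ] VecPoly where
  toFun v := fun a => ∑ b : Fin 3, MvPolynomial.pderiv b (v a b)
  map_add' v w := by ext1 a; simp [Finset.sum_add_distrib]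
  map_smul' c v := by ext1 a; simp [Finset.smul_sum]

/-! ### Normals, tangents and constant matrices -/

/-- `n` is a unit normal vector of the face of `K` opposite to the vertex `K i`. -/
def IsUnitFaceNormal (K : Tetrahedron) (i : Fin 4) (n : E3) : Prop :=
  ‖n‖ = 1 ∧ ∀ j l : Fin 4, j ≠ i → l ≠ i → inner ℝ (K l - K j) n = 0

/-- `t` is a unit tangent vector of the edge of `K` connecting `K j` and `K l`. -/
def IsUnitEdgeTangent (K : Tetrahedron) (j l : Fin 4) (t : E3) : Prop :=
  ‖t‖ = 1 ∧ ∃ c : ℝ, t = c • (K l - K j)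

/-- The constant matrix `u vᵀ`, as a matrix-valued polynomial. -/
def outer (u v : E3) : MatPoly := Matrix.of fun a b => MvPolynomial.C (u a * v b)

/-! ### The spaces of the bubble complex -/

/-- The face bubble `λ_j λ_l λ_m`, where `{i, j, l, m} = {0, 1, 2, 3}`. -/
def faceBubble (K : Tetrahedron) (i : Fin 4) : Poly := ∏ j ∈ Finset.univ.erase i, lam K j

/-- The element bubble `λ_0 λ_1 λ_2 λ_3`. -/
def eleBubble (K : Tetrahedron) : Poly := ∏ j : Fin 4, lam K j

/-- `(λ_0 λ_1 λ_2 λ_3)² P_{k-6}(K)`. -/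
def bubbleH2 (K : Tetrahedron) (k : ℕ) : Submodule ℝ Poly :=
  (polyDeg (k - 6)).map (LinearMap.mulLeft ℝ (eleBubble K ^ 2))

/-- `∑_i λ_j λ_l λ_m P_{k-3}^{(0)}(K) n_i n_iᵀ + λ_0 λ_1 λ_2 λ_3 P_{k-4}(K; 𝕊)`. -/
def bubbleCurlS (K : Tetrahedron) (n : Fin 4 → E3) (k : ℕ) : Submodule ℝ MatPoly :=
  Submodule.span ℝ
      {σ | ∃ i : Fin 4, ∃ p ∈ polyZero K (k - 3),
        σ = (faceBubble K i * p) • outer (n i) (n i)} ⊔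
    Submodule.span ℝ {σ | ∃ τ ∈ symPoly (k - 4), σ = eleBubble K • τ}

/-- `∑_i ∑_{j < l; j, l ≠ i} λ_j λ_l P_{m-2}^{j,l,0}(K) n_i t_{j,l}ᵀ`, the bubble space of
degree `m`. -/
def bubbleDivT (K : Tetrahedron) (n : Fin 4 → E3) (t : Fin 4 → Fin 4 → E3) (m : ℕ) :
    Submodule ℝ MatPoly :=
  Submodule.span ℝ
    {v | ∃ i j l : Fin 4, j < l ∧ j ≠ i ∧ l ≠ i ∧ ∃ p ∈ polyVanish K (m - 2) {j, l},
      v = (lam K j * lam K l * p) • outer (n i) (t j l)}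

/-- The lowest order Raviart--Thomas space `{a + b x : a ∈ ℝ³, b ∈ ℝ}`. -/
def RT : Set VecPoly :=
  {w | ∃ (a : E3) (b : ℝ), w = fun j => MvPolynomial.C (a j) + MvPolynomial.C b * MvPolynomial.X j}

/-- The `L²(K; ℝ³)` inner product of two vector-valued polynomials. -/
def l2Inner (K : Tetrahedron) (q w : VecPoly) : ℝ :=
  ∫ x in body K, ∑ a : Fin 3, evalAt x (q a) * evalAt x (w a)

theorem integrableOn_l2 (K : Tetrahedron) (q w : VecPoly) :
    IntegrableOn (fun x => ∑ a : Fin 3, evalAt x (q a) * evalAt x (w a)) (body K) := by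
  have hev : ∀ p : Poly, Continuous fun x : E3 => evalAt x p := fun p =>
    (MvPolynomial.continuous_eval p).comp (continuous_pi fun j => by fun_prop)
  have hK : IsCompact (body K) := (Set.finite_range _).isCompact_convexHull ℝ
  exact (continuous_finsetSum _ fun a _ =>
    (hev (q a)).mul (hev (w a))).continuousOn.integrableOn_compact hK

/-- `P_m^{(0)}(K; ℝ³) / RT(K)`: the `ℝ³`-valued polynomials of degree at most `m` that vanish at
the vertices of `K` and are `L²(K)`-orthogonal to `RT(K)`. -/
def polyZeroModRT (K : Tetrahedron) (m : ℕ) : Submodule ℝ VecPoly where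
  carrier := {q | (∀ a, q a ∈ polyZero K m) ∧ ∀ w ∈ RT, l2Inner K q w = 0}
  zero_mem' := ⟨fun _ => Submodule.zero_mem _, fun w _ => by simp [l2Inner, evalAt]⟩
  add_mem' := by
    rintro p q ⟨hp, hp'⟩ ⟨hq, hq'⟩
    refine ⟨fun a => Submodule.add_mem _ (hp a) (hq a), fun w hw => ?_⟩
    have h := integral_add (integrableOn_l2 K p w) (integrableOn_l2 K q w)
    have h1 := hp' w hw
    have h2 := hq' w hw
    simp only [l2Inner] at h1 h2 ⊢
    rw [h1, h2, add_zero] at h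
    rw [← h]
    simp only [evalAt, Pi.add_apply, map_add, add_mul, Finset.sum_add_distrib]
  smul_mem' := by
    rintro c p ⟨hp, hp'⟩
    refine ⟨fun a => Submodule.smul_mem _ c (hp a), fun w hw => ?_⟩
    have h := hp' w hw
    simp only [l2Inner] at h ⊢
    simp only [evalAt, Pi.smul_apply, MvPolynomial.smul_eval, mul_assoc, ← Finset.mul_sum]
      at h ⊢
    rw [integral_const_mul, h, mul_zero]

end BubbleComplex

end

noncomputable section

namespace BubbleComplex

open MvPolynomial

/-! In divided powers `dp` of the barycentric coordinates, differentiation merely shifts Bernstein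
coefficients (`pderiv_bern`). Since n_i is a multiple of ∇λ_i and t_{j,l} one of x_l - x_j, matrix
fields can be expanded in the redundant frames ∇λ_i x_jᵀ and ∇λ_i ∇λ_jᵀ (`theta`, `xi`). In these
frames the two middle spaces are exactly the images of the coefficient arrays `divCoef` and
`curlCoef`, which are cut out by support conditions, by zero row sums and by symmetry respectively.
Exactness becomes a question about functions on a tetrahedral lattice of multi-indices with its
corners removed; the redundancy of the frames is governed by ∑ ∇λ_i = 0.

Surjectivity of div (`exists_divc_eq`): row i of the coefficient divergence can move a unit mass
between neighbours with the same i-th entry. Modulo these moves, and modulo arrays with equal rows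
(which represent the zero field), the class of a unit mass in row i depends only on its i-th entry,
and since the four classes at one point sum to zero they are affine with a common slope
(`affine_of_layer`). The only obstructions left are the row masses and one first moment. As all `dp`
of a given order have the same integral (`integ_dp`), these are precisely the conditions of
orthogonality to RT (`orthogonal_RT_iff`).

Kernel of div (`exists_curlc_eq`): if the field has no divergence, the rows of the coefficient
divergence share one value s. It annihilates every function of a single entry, so it is a
combination of discrete rectangles (`sum_of_rectangles`), and each rectangle comes from the curl of
an off-diagonal bubble at an interior index. After subtracting these, every row is divergence-free
on each triangle γ_i = const and has a stream function (`exists_stream`); the four stream functions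
are the diagonal of the preimage.

Kernel of curl (`exists_bubbleH2_hess_eq`): the Poincaré lemma, used twice, gives a potential. The
support of the symmetric array forces second differences of the potential's coefficients to vanish
along each face; after subtracting an affine function the two lattice layers next to each face
vanish, which is divisibility by (λ_0 λ_1 λ_2 λ_3)². The same connectedness argument gives
injectivity of hess. -/

/-! ### Barycentric gradients, face normals and edge tangents -/

/-- The gradient of the barycentric coordinate `λ_i`. -/
def gv (K : Tetrahedron) (i : Fin 4) (b : Fin 3) : ℝ :=
  K.coord i (EuclideanSpace.single b 1) - K.coord i 0

theorem coord_eq (K : Tetrahedron) (i : Fin 4) (x : E3) :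
    K.coord i x = K.coord i 0 + ∑ b, gv K i b * x b := by
  rw [← evalAt_lam, evalAt, lam]
  simp [gv]

theorem sum_gv_mul_vertex (K : Tetrahedron) (i j : Fin 4) :
    ∑ b, gv K i b * K j b = (if i = j then 1 else 0) - K.coord i 0 := by
  have h := coord_eq K i (K j)
  rw [AffineBasis.coord_apply] at h
  linarith

theorem sum_gv (K : Tetrahedron) (b : Fin 3) : ∑ i, gv K i b = 0 := by
  simp only [gv, Finset.sum_sub_distrib, AffineBasis.sum_coord_apply_eq_one, sub_self]

theorem sum_coord_mul_vertex (K : Tetrahedron) (x : E3) (b : Fin 3) :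
    ∑ i, K.coord i x * K i b = x b := by
  conv_rhs => rw [← AffineBasis.linear_combination_coord_eq_self K x]
  simp only [WithLp.ofLp_sum, WithLp.ofLp_smul, Finset.sum_apply, Pi.smul_apply, smul_eq_mul]

theorem sum_gv_mul_vertex_eq_delta (K : Tetrahedron) (a b : Fin 3) :
    ∑ i, gv K i a * K i b = if a = b then 1 else 0 := by
  simp only [gv, sub_mul, Finset.sum_sub_distrib, sum_coord_mul_vertex]
  simp [eq_comm]

theorem gv_dot_edge (K : Tetrahedron) (i j l : Fin 4) :
    ∑ b, gv K i b * (K j b - K l b) = (if i = j then 1 else 0) - (if i = l then 1 else 0) := by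
  simp only [mul_sub, Finset.sum_sub_distrib, sum_gv_mul_vertex]
  ring

/-- Expansion of a vector in the (redundant) family of the vertices. -/
theorem vec_eq_sum_vertex (K : Tetrahedron) {M : Type*} [AddCommGroup M] [Module ℝ M]
    (y : Fin 3 → M) (b : Fin 3) : y b = ∑ i, K i b • ∑ a, gv K i a • y a := by
  simp only [Finset.smul_sum, smul_smul]
  rw [Finset.sum_comm]
  have : ∀ a : Fin 3, ∑ i, (K i b * gv K i a) • y a = if a = b then y a else 0 := fun a => by
    rw [← Finset.sum_smul]
    have := sum_gv_mul_vertex_eq_delta K a b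
    simp only [mul_comm (K _ b)]
    rw [this]; split_ifs <;> simp
  simp [this]

/-- Expansion of a vector in the (redundant) family of the gradients. -/
theorem vec_eq_sum_gv (K : Tetrahedron) {M : Type*} [AddCommGroup M] [Module ℝ M]
    (y : Fin 3 → M) (a : Fin 3) : y a = ∑ i, gv K i a • ∑ b, K i b • y b := by
  simp only [Finset.smul_sum, smul_smul]
  rw [Finset.sum_comm]
  have : ∀ b : Fin 3, ∑ i, (gv K i a * K i b) • y b = if a = b then y b else 0 := fun b => by
    rw [← Finset.sum_smul, sum_gv_mul_vertex_eq_delta K a b]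
    split_ifs <;> simp
  simp [this]

/-- Expand n = ∑ (x_l · n) ∇λ_l. The three vertices of the face have the same product with n, so ∑
∇λ_l = 0 collapses the sum to its i-th term; the factor is nonzero because n is a unit vector. -/
theorem unitFaceNormal_eq (K : Tetrahedron) {i : Fin 4} {n : E3} (h : IsUnitFaceNormal K i n) :
    ∃ c : ℝ, c ≠ 0 ∧ ∀ a, n a = c * gv K i a := by
  obtain ⟨h1, h2⟩ := h
  obtain ⟨j, hj⟩ : ∃ j : Fin 4, j ≠ i := exists_ne i
  have hin : ∀ l, l ≠ i → ∑ b, K l b * n b = ∑ b, K j b * n b := fun l hl => by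
    have := h2 j l hj hl
    simp [PiLp.inner_apply, mul_sub] at this
    simp only [mul_comm (n _)] at this
    linarith
  set f : Fin 4 → ℝ := fun l => ∑ b, K l b * n b with hf
  have hn : ∀ a, n a = (f i - f j) * gv K i a := fun a => by
    have hv := vec_eq_sum_gv K (fun a => n a) a
    simp only [smul_eq_mul] at hv
    rw [hv]
    have : ∀ l, gv K l a * f l = gv K l a * f j + if l = i then gv K i a * (f i - f j) else 0 := by
      intro l
      by_cases hl : l = i
      · subst hl; simp; ring
      · simp only [hl, if_false, add_zero]; rw [hf]; simp only; rw [hin l hl]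
    rw [Finset.sum_congr rfl fun l _ => this l, Finset.sum_add_distrib, ← Finset.sum_mul, sum_gv]
    simp; ring
  refine ⟨f i - f j, fun h0 => ?_, hn⟩
  have : n = 0 := by ext a; rw [hn a, h0]; simp
  rw [this] at h1; simp at h1

theorem unitEdgeTangent_eq (K : Tetrahedron) {j l : Fin 4} {t : E3}
    (h : IsUnitEdgeTangent K j l t) : ∃ c : ℝ, c ≠ 0 ∧ ∀ a, t a = c * (K l a - K j a) := by
  obtain ⟨h1, c, rfl⟩ := h
  refine ⟨c, ?_, fun a => by simp⟩
  rintro rfl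
  simp at h1

/-! ### Cross products of gradients -/

/-- The gradients of a reference tetrahedron. -/
def refGrad (i : Fin 4) (r : Fin 3) : ℤ := if i = 0 then -1 else if i = r.succ then 1 else 0

/-- The determinant of three of the reference gradients. -/
def eps (i c j : Fin 4) : ℤ :=
  refGrad i 0 * (refGrad c 1 * refGrad j 2 - refGrad c 2 * refGrad j 1)
  + refGrad i 1 * (refGrad c 2 * refGrad j 0 - refGrad c 0 * refGrad j 2)
  + refGrad i 2 * (refGrad c 0 * refGrad j 1 - refGrad c 1 * refGrad j 0)

theorem eps_swap_left (i c j : Fin 4) : eps c i j = -eps i c j := by simp only [eps]; ring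

theorem eps_swap_right (i c j : Fin 4) : eps i j c = -eps i c j := by simp only [eps]; ring

theorem eps_swap_outer (i c j : Fin 4) : eps j c i = -eps i c j := by simp only [eps]; ring

theorem sum_eps (c j : Fin 4) : ∑ l, eps l c j = 0 := by revert c j; decide

/-- The determinant of the gradients of `λ_1, λ_2, λ_3`. -/
def gdet (K : Tetrahedron) : ℝ :=
  gv K 1 0 * (gv K 2 1 * gv K 3 2 - gv K 2 2 * gv K 3 1)
  + gv K 1 1 * (gv K 2 2 * gv K 3 0 - gv K 2 0 * gv K 3 2)
  + gv K 1 2 * (gv K 2 0 * gv K 3 1 - gv K 2 1 * gv K 3 0)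

/-- The matrix of the gradients of λ_1, λ_2, λ_3 is inverse to that of the edge vectors from x_0. -/
theorem gdet_ne_zero (K : Tetrahedron) : gdet K ≠ 0 := by
  have h0 : ∀ a, gv K 0 a = -(gv K 1 a + gv K 2 a + gv K 3 a) := fun a => by
    have := sum_gv K a
    rw [Fin.sum_univ_four] at this
    linarith
  let G : Matrix (Fin 3) (Fin 3) ℝ := Matrix.of fun a r => gv K r.succ a
  let T : Matrix (Fin 3) (Fin 3) ℝ := Matrix.of fun r b => K r.succ b - K 0 b
  have hGT : G * T = 1 := by
    ext a b
    have := sum_gv_mul_vertex_eq_delta K a b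
    rw [Fin.sum_univ_four, h0] at this
    rw [Matrix.mul_apply, Fin.sum_univ_three, Matrix.one_apply, ← this]
    simp only [G, T, Matrix.of_apply, show (0 : Fin 3).succ = (1 : Fin 4) from rfl,
      show (1 : Fin 3).succ = (2 : Fin 4) from rfl, show (2 : Fin 3).succ = (3 : Fin 4) from rfl]
    ring
  have hdet : G.det = gdet K := by
    rw [Matrix.det_fin_three, gdet]
    simp only [G, Matrix.of_apply, show (0 : Fin 3).succ = (1 : Fin 4) from rfl,
      show (1 : Fin 3).succ = (2 : Fin 4) from rfl, show (2 : Fin 3).succ = (3 : Fin 4) from rfl]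
    ring
  intro h
  have := congrArg Matrix.det hGT
  rw [Matrix.det_mul, hdet, h] at this
  simp at this

theorem gv_eq_refGrad (K : Tetrahedron) (i : Fin 4) (a : Fin 3) :
    gv K i a = refGrad i 0 * gv K 1 a + refGrad i 1 * gv K 2 a + refGrad i 2 * gv K 3 a := by
  have := sum_gv K a
  rw [Fin.sum_univ_four] at this
  fin_cases i <;> (simp [refGrad, Fin.ext_iff]; try linarith)

/-- Any vector y equals ∑ (∇λ_l · y) x_l. For y a cross product of two gradients the coefficients
are determinants of three gradients, hence `gdet` times the integers `eps`. This brings the rows of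
a curl into the vertex frame. -/
theorem cross_gv (K : Tetrahedron) (c j : Fin 4) (b : Fin 3) :
    gv K c (b + 1) * gv K j (b + 2) - gv K c (b + 2) * gv K j (b + 1)
      = gdet K * ∑ l, (eps l c j : ℝ) * K l b := by
  have h := vec_eq_sum_vertex K
    (fun b => gv K c (b + 1) * gv K j (b + 2) - gv K c (b + 2) * gv K j (b + 1)) b
  simp only [smul_eq_mul] at h
  rw [h, Finset.mul_sum]
  refine Finset.sum_congr rfl fun l _ => ?_
  rw [← mul_assoc, mul_comm]
  congr 1
  simp only [Fin.sum_univ_three, show (0 + 1 : Fin 3) = 1 from rfl, show (0 + 2 : Fin 3) = 2 from rfl,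
    show (1 + 1 : Fin 3) = 2 from rfl, show (1 + 2 : Fin 3) = 0 from rfl,
    show (2 + 1 : Fin 3) = 0 from rfl, show (2 + 2 : Fin 3) = 1 from rfl]
  rw [gv_eq_refGrad K l, gv_eq_refGrad K c, gv_eq_refGrad K j, gv_eq_refGrad K l,
    gv_eq_refGrad K c, gv_eq_refGrad K j, gv_eq_refGrad K l, gv_eq_refGrad K c, gv_eq_refGrad K j]
  simp only [eps, gdet]
  push_cast
  ring

/-! ### The barycentric coordinates as polynomials -/

theorem pderiv_lam (K : Tetrahedron) (i : Fin 4) (b : Fin 3) :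
    pderiv b (lam K i) = C (gv K i b) := by
  simp [lam, gv, pderiv_X, Pi.single_apply]

theorem lam_eq (K : Tetrahedron) (i : Fin 4) :
    lam K i = C (K.coord i 0) + ∑ b, C (gv K i b) * X b := rfl

theorem sum_lam (K : Tetrahedron) : ∑ i, lam K i = 1 := by
  simp only [lam_eq, Finset.sum_add_distrib]
  rw [Finset.sum_comm, ← map_sum, AffineBasis.sum_coord_apply_eq_one]
  simp only [← Finset.sum_mul, ← map_sum, sum_gv]
  simp

theorem sum_vertex_lam (K : Tetrahedron) (a : Fin 3) : ∑ i, C (K i a) * lam K i = X a := by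
  simp only [lam_eq, mul_add, Finset.sum_add_distrib, Finset.mul_sum]
  rw [Finset.sum_comm]
  have h0 := sum_coord_mul_vertex K 0 a
  have : ∀ b, ∑ i, C (K i a) * (C (gv K i b) * X b) = if b = a then (X b : Poly) else 0 := by
    intro b
    have := sum_gv_mul_vertex_eq_delta K b a
    simp only [← mul_assoc, ← Finset.sum_mul, ← map_mul, ← map_sum, mul_comm (K _ a), this]
    split_ifs <;> simp
  simp only [this, ← map_mul, ← map_sum, mul_comm (K _ a), h0]
  simp

theorem lam_mem_polyDeg (K : Tetrahedron) (i : Fin 4) : lam K i ∈ polyDeg 1 := by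
  refine Submodule.add_mem _ ?_ (Submodule.sum_mem _ fun b _ => ?_)
  · rw [polyDeg, mem_restrictTotalDegree]; simp
  · rw [polyDeg, mem_restrictTotalDegree]
    refine (totalDegree_mul _ _).trans ?_
    rw [totalDegree_C, totalDegree_X]

theorem mul_mem_polyDeg {p q : Poly} {m n : ℕ} (hp : p ∈ polyDeg m) (hq : q ∈ polyDeg n) :
    p * q ∈ polyDeg (m + n) := by
  rw [polyDeg, mem_restrictTotalDegree] at *
  exact (totalDegree_mul _ _).trans (by omega)

theorem evalAt_lam_vertex (K : Tetrahedron) (i j : Fin 4) :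
    evalAt (K j) (lam K i) = if i = j then 1 else 0 := by
  rw [evalAt_lam, AffineBasis.coord_apply]

/-! ### Multi-indices -/

/-- The unit multi-index. -/
abbrev e (a : Fin 4) : Fin 4 → ℕ := Pi.single a 1

theorem e_apply (a b : Fin 4) : e a b = if b = a then 1 else 0 := by
  simp [e, Pi.single_apply]

theorem add_e_apply (γ : Fin 4 → ℕ) (a b : Fin 4) :
    (γ + e a) b = γ b + if b = a then 1 else 0 := by
  rw [Pi.add_apply, e_apply]

theorem add_e_self (γ : Fin 4 → ℕ) (a : Fin 4) : (γ + e a) a = γ a + 1 := by simp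

theorem add_e_of_ne (γ : Fin 4 → ℕ) {a b : Fin 4} (h : b ≠ a) : (γ + e a) b = γ b := by
  simp [h]

theorem sub_e_add_e {γ : Fin 4 → ℕ} {a : Fin 4} (h : γ a ≠ 0) : γ - e a + e a = γ := by
  ext b
  by_cases hb : b = a
  · subst hb; simp; omega
  · simp [hb]

theorem add_e_sub_e (γ : Fin 4 → ℕ) (a : Fin 4) : γ + e a - e a = γ := by
  ext b; simp

theorem sum_add_e (γ : Fin 4 → ℕ) (a : Fin 4) : ∑ b, (γ + e a) b = ∑ b, γ b + 1 := by
  simp [Finset.sum_add_distrib]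

theorem exists_sub_e {γ : Fin 4 → ℕ} {a : Fin 4} (h : γ a ≠ 0) : ∃ β, γ = β + e a :=
  ⟨γ - e a, (sub_e_add_e h).symm⟩

/-- The multi-indices of order `m`. -/
def level (m : ℕ) : Finset (Fin 4 → ℕ) := Finset.piAntidiag Finset.univ m

theorem mem_level {m : ℕ} {γ : Fin 4 → ℕ} : γ ∈ level m ↔ ∑ a, γ a = m := by
  simp [level]

theorem add_e_mem_level {m : ℕ} {γ : Fin 4 → ℕ} {a : Fin 4} :
    γ + e a ∈ level (m + 1) ↔ γ ∈ level m := by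
  rw [mem_level, mem_level, sum_add_e]; omega

/-- Reindexing by the injective shift β ↦ β + e_a, whose image misses only the indices with a-th
entry zero. -/
theorem sum_level_succ {M : Type*} [AddCommMonoid M] (m : ℕ) (a : Fin 4)
    (H : (Fin 4 → ℕ) → M) (h : ∀ γ ∈ level (m + 1), γ a = 0 → H γ = 0) :
    ∑ γ ∈ level (m + 1), H γ = ∑ β ∈ level m, H (β + e a) := by
  symm
  refine Finset.sum_of_injOn (fun β => β + e a) ?_ ?_ ?_ ?_
  · exact fun x _ y _ hxy => add_right_cancel hxy
  · exact fun β hβ => add_e_mem_level.2 hβ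
  · intro γ hγ hn
    refine h γ hγ ?_
    by_contra hne
    obtain ⟨β, rfl⟩ := exists_sub_e hne
    exact hn ⟨β, add_e_mem_level.1 hγ, rfl⟩
  · exact fun _ _ => rfl

/-- The multi-index `m e_a` of a vertex. -/
theorem single_mem_level (m : ℕ) (a : Fin 4) : (Pi.single a m : Fin 4 → ℕ) ∈ level m := by
  simp [mem_level]

theorem eq_single_of_le {m : ℕ} {γ : Fin 4 → ℕ} (h : γ ∈ level m) {a : Fin 4} (ha : m ≤ γ a) :
    γ = Pi.single a m := by
  rw [mem_level, ← Finset.add_sum_erase _ _ (Finset.mem_univ a)] at h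
  have h0 : ∑ b ∈ Finset.univ.erase a, γ b = 0 := by omega
  rw [Finset.sum_eq_zero_iff] at h0
  ext b
  by_cases hb : b = a
  · subst hb; simp; omega
  · simp [hb, h0 b (by simp [hb])]

/-! ### Divided powers of barycentric coordinates -/

/-- The divided power monomial `∏ λ_a ^ γ_a / γ_a!`. -/
def dp (K : Tetrahedron) (γ : Fin 4 → ℕ) : Poly :=
  ∏ a, C ((Nat.factorial (γ a) : ℝ)⁻¹) * lam K a ^ γ a

theorem lam_mul_dp (K : Tetrahedron) (γ : Fin 4 → ℕ) (a : Fin 4) :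
    lam K a * dp K γ = ((γ a : ℝ) + 1) • dp K (γ + e a) := by
  rw [dp, dp, ← Finset.mul_prod_erase _ _ (Finset.mem_univ a),
    ← Finset.mul_prod_erase _ _ (Finset.mem_univ a), add_e_self]
  have : ∀ b ∈ Finset.univ.erase a, C ((Nat.factorial ((γ + e a) b) : ℝ)⁻¹) * lam K b ^ (γ + e a) b
      = C ((Nat.factorial (γ b) : ℝ)⁻¹) * lam K b ^ γ b := fun b hb => by
    rw [add_e_of_ne _ (Finset.ne_of_mem_erase hb)]
  rw [Finset.prod_congr rfl this, MvPolynomial.smul_eq_C_mul, Nat.factorial_succ, pow_succ]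
  have h1 : C ((Nat.factorial (γ a) : ℝ)⁻¹)
      = (C ((γ a : ℝ) + 1) * C ((((γ a + 1) * Nat.factorial (γ a) : ℕ) : ℝ)⁻¹) : Poly) := by
    rw [← map_mul]
    congr 1
    have : (Nat.factorial (γ a) : ℝ) ≠ 0 := by positivity
    push_cast
    field_simp
  rw [h1]
  ring

theorem pderiv_divPow (K : Tetrahedron) (b : Fin 3) (a : Fin 4) (n : ℕ) :
    pderiv b (C ((Nat.factorial (n + 1) : ℝ)⁻¹) * lam K a ^ (n + 1))
      = C (gv K a b) * (C ((Nat.factorial n : ℝ)⁻¹) * lam K a ^ n) := by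
  rw [Derivation.leibniz, Derivation.leibniz_pow, pderiv_lam, pderiv_C]
  have h1 : C ((Nat.factorial n : ℝ)⁻¹)
      = ((((n + 1 : ℕ)) : Poly) * C ((Nat.factorial (n + 1) : ℝ)⁻¹) : Poly) := by
    have : (((n + 1 : ℕ)) : Poly) = C (((n + 1 : ℕ)) : ℝ) := by simp
    rw [this, ← map_mul]
    congr 1
    have : (Nat.factorial n : ℝ) ≠ 0 := by positivity
    rw [Nat.factorial_succ]
    push_cast
    field_simp
  rw [h1]
  simp only [smul_eq_mul, nsmul_eq_mul, Nat.add_sub_cancel]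
  ring

theorem derivation_prod {R A ι : Type*} [CommRing R] [CommRing A] [Algebra R A] [DecidableEq ι]
    (D : Derivation R A A) (s : Finset ι) (f : ι → A) :
    D (∏ i ∈ s, f i) = ∑ i ∈ s, D (f i) * ∏ j ∈ s.erase i, f j := by
  induction s using Finset.induction_on with
  | empty => simp
  | insert a s ha ih =>
    rw [Finset.prod_insert ha, Derivation.leibniz, ih, Finset.sum_insert ha,
      Finset.erase_insert ha, smul_eq_mul, smul_eq_mul, Finset.mul_sum, add_comm, mul_comm]
    congr 1
    refine Finset.sum_congr rfl fun i hi => ?_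
    have hne : a ≠ i := fun h => ha (h ▸ hi)
    rw [Finset.erase_insert_of_ne hne, Finset.prod_insert (fun h => ha (Finset.mem_of_mem_erase h))]
    ring

theorem pderiv_dp (K : Tetrahedron) (b : Fin 3) (γ : Fin 4 → ℕ) :
    pderiv b (dp K γ) = ∑ a, if γ a = 0 then 0 else gv K a b • dp K (γ - e a) := by
  have key : ∀ a, pderiv b (C ((Nat.factorial (γ a) : ℝ)⁻¹) * lam K a ^ γ a) *
      ∏ c ∈ Finset.univ.erase a, (C ((Nat.factorial (γ c) : ℝ)⁻¹) * lam K c ^ γ c)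
      = if γ a = 0 then 0 else gv K a b • dp K (γ - e a) := by
    intro a
    split_ifs with h
    · simp [h]
    · obtain ⟨β, rfl⟩ := exists_sub_e h
      rw [add_e_sub_e, add_e_self, pderiv_divPow, dp,
        ← Finset.mul_prod_erase _ _ (Finset.mem_univ a), MvPolynomial.smul_eq_C_mul]
      rw [mul_assoc]
      congr 2
      exact Finset.prod_congr rfl fun c hc => by rw [add_e_of_ne _ (Finset.ne_of_mem_erase hc)]
  simp only [← key]
  exact derivation_prod _ _ _

theorem evalAt_dp_vertex (K : Tetrahedron) (γ : Fin 4 → ℕ) (a : Fin 4)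
    (h : ∃ b, b ≠ a ∧ γ b ≠ 0) : evalAt (K a) (dp K γ) = 0 := by
  obtain ⟨b, hb, hγ⟩ := h
  have := evalAt_lam_vertex K b a
  rw [evalAt] at this
  rw [evalAt, dp, map_prod]
  refine Finset.prod_eq_zero (Finset.mem_univ b) ?_
  rw [map_mul, map_pow, this]
  simp [hb, hγ]

theorem evalAt_dp_single (K : Tetrahedron) (m : ℕ) (a : Fin 4) :
    evalAt (K a) (dp K (Pi.single a m)) = (Nat.factorial m : ℝ)⁻¹ := by
  have := evalAt_lam_vertex K a a
  rw [evalAt] at this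
  rw [evalAt, dp, map_prod, Finset.prod_eq_single a]
  · rw [map_mul, map_pow, this]; simp
  · intro b _ hb; simp [hb]
  · simp

theorem dp_mem_polyDeg (K : Tetrahedron) {m : ℕ} {γ : Fin 4 → ℕ} (h : γ ∈ level m) :
    dp K γ ∈ polyDeg m := by
  rw [mem_level] at h
  rw [polyDeg, mem_restrictTotalDegree, dp]
  refine (totalDegree_finsetProd _ _).trans ?_
  rw [← h]
  refine Finset.sum_le_sum fun a _ => ?_
  refine (totalDegree_mul _ _).trans ?_
  rw [totalDegree_C, zero_add]
  refine (totalDegree_pow _ _).trans ?_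
  have := lam_mem_polyDeg K a
  rw [polyDeg, mem_restrictTotalDegree] at this
  nlinarith

/-! ### The Bernstein representation -/

/-- Real-valued functions of multi-indices. -/
abbrev Coef : Type := (Fin 4 → ℕ) → ℝ

/-- The polynomial of degree `m` with divided-power Bernstein coefficients `c`. -/
def bern (K : Tetrahedron) (m : ℕ) : Coef →ₗ[ℝ] Poly where
  toFun c := ∑ γ ∈ level m, c γ • dp K γ
  map_add' c d := by simp [add_smul, Finset.sum_add_distrib]
  map_smul' r c := by simp [Finset.smul_sum, smul_smul]

theorem bern_apply (K : Tetrahedron) (m : ℕ) (c : Coef) :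
    bern K m c = ∑ γ ∈ level m, c γ • dp K γ := rfl

theorem bern_congr (K : Tetrahedron) {m : ℕ} {c d : Coef} (h : ∀ γ ∈ level m, c γ = d γ) :
    bern K m c = bern K m d := by
  rw [bern_apply, bern_apply]
  exact Finset.sum_congr rfl fun γ hγ => by rw [h γ hγ]

theorem bern_mem_polyDeg (K : Tetrahedron) (m : ℕ) (c : Coef) : bern K m c ∈ polyDeg m :=
  Submodule.sum_mem _ fun _ h => Submodule.smul_mem _ _ (dp_mem_polyDeg K h)

/-- The shift `c ↦ c (· + e_a)` of Bernstein coefficients. -/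
def sh (a : Fin 4) : Coef →ₗ[ℝ] Coef where
  toFun c := fun β => c (β + e a)
  map_add' _ _ := rfl
  map_smul' _ _ := rfl

theorem sh_apply (a : Fin 4) (c : Coef) (β : Fin 4 → ℕ) : sh a c β = c (β + e a) := rfl

/-- The factorials in `dp` absorb the exponents produced by differentiation, so no index-dependent
weight remains. -/
theorem pderiv_bern (K : Tetrahedron) (m : ℕ) (b : Fin 3) (c : Coef) :
    pderiv b (bern K (m + 1) c) = ∑ a, gv K a b • bern K m (sh a c) := by
  simp only [bern_apply, map_sum, Derivation.map_smul, pderiv_dp, Finset.smul_sum]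
  rw [Finset.sum_comm]
  refine Finset.sum_congr rfl fun a _ => ?_
  rw [sum_level_succ m a]
  · refine Finset.sum_congr rfl fun β _ => ?_
    rw [if_neg (by simp), add_e_sub_e, smul_comm, sh_apply]
  · intro γ _ h
    simp [h]

/-- Multiplication by `λ_a` in terms of Bernstein coefficients. -/
def up (a : Fin 4) (c : Coef) : Coef := fun γ => γ a * c (γ - e a)

theorem up_add_e (a : Fin 4) (c : Coef) (β : Fin 4 → ℕ) :
    up a c (β + e a) = (β a + 1) * c β := by
  rw [up, add_e_sub_e, add_e_self]; push_cast; rfl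

theorem up_of_eq_zero (a : Fin 4) (c : Coef) {γ : Fin 4 → ℕ} (h : γ a = 0) : up a c γ = 0 := by
  simp [up, h]

theorem lam_mul_bern (K : Tetrahedron) (m : ℕ) (a : Fin 4) (c : Coef) :
    lam K a * bern K m c = bern K (m + 1) (up a c) := by
  rw [bern_apply K (m + 1), sum_level_succ m a]
  · simp only [bern_apply, Finset.mul_sum, up_add_e, mul_smul_comm, lam_mul_dp, smul_smul]
    exact Finset.sum_congr rfl fun β _ => by rw [mul_comm]
  · intro γ _ h
    rw [up_of_eq_zero a c h, zero_smul]

/-- A Bernstein polynomial whose coefficients vanish where `γ a = 0` is divisible by `λ_a`. -/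
theorem bern_succ_eq_lam_mul (K : Tetrahedron) (m : ℕ) (a : Fin 4) (c : Coef)
    (h : ∀ γ, γ a = 0 → c γ = 0) :
    bern K (m + 1) c = lam K a * bern K m (fun β => ((β a : ℝ) + 1)⁻¹ * c (β + e a)) := by
  rw [lam_mul_bern]
  refine bern_congr K fun γ _ => ?_
  by_cases h0 : γ a = 0
  · rw [h γ h0, up_of_eq_zero _ _ h0]
  · obtain ⟨β, rfl⟩ := exists_sub_e h0
    rw [up_add_e]
    have : (β a : ℝ) + 1 ≠ 0 := by positivity
    field_simp

theorem evalAt_bern_vertex (K : Tetrahedron) (m : ℕ) (c : Coef) (a : Fin 4) :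
    evalAt (K a) (bern K m c) = c (Pi.single a m) * (Nat.factorial m : ℝ)⁻¹ := by
  rw [bern_apply, evalAt, map_sum, Finset.sum_eq_single (Pi.single a m)]
  · rw [MvPolynomial.smul_eval]
    have := evalAt_dp_single K m a
    rw [evalAt] at this
    rw [this]
  · intro γ hγ hne
    rw [MvPolynomial.smul_eval]
    have := evalAt_dp_vertex K γ a ?_
    · rw [evalAt] at this; rw [this, mul_zero]
    · by_contra! hall
      refine hne (eq_single_of_le hγ ?_)
      rw [mem_level, Finset.sum_eq_single a (fun b _ hb => hall b hb) (by simp)] at hγ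
      exact hγ.ge
  · exact fun h => absurd (single_mem_level m a) h

theorem one_eq_bern (K : Tetrahedron) : bern K 0 (fun _ => 1) = 1 := by
  have : level 0 = {0} := by
    ext γ
    simp [mem_level, funext_iff]
  simp [bern_apply, this, dp]

theorem exists_bern_mul_lam (K : Tetrahedron) {m : ℕ} {p : Poly}
    (hp : p ∈ LinearMap.range (bern K m)) (a : Fin 4) :
    lam K a * p ∈ LinearMap.range (bern K (m + 1)) := by
  obtain ⟨c, rfl⟩ := hp
  exact ⟨_, (lam_mul_bern K m a c).symm⟩

theorem exists_bern_X_mul (K : Tetrahedron) {m : ℕ} {p : Poly}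
    (hp : p ∈ LinearMap.range (bern K m)) (b : Fin 3) :
    X b * p ∈ LinearMap.range (bern K (m + 1)) := by
  rw [← sum_vertex_lam K b, Finset.sum_mul]
  refine Submodule.sum_mem _ fun a _ => ?_
  rw [mul_assoc, ← MvPolynomial.smul_eq_C_mul]
  exact Submodule.smul_mem _ _ (exists_bern_mul_lam K hp a)

/-- Degree elevation: multiply by 1 = ∑ λ_a. -/
theorem range_bern_mono (K : Tetrahedron) {m n : ℕ} (h : m ≤ n) :
    LinearMap.range (bern K m) ≤ LinearMap.range (bern K n) := by
  induction n, h using Nat.le_induction with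
  | base => exact le_rfl
  | succ n _ ih =>
    refine ih.trans fun p hp => ?_
    rw [← one_mul p, ← sum_lam K, Finset.sum_mul]
    exact Submodule.sum_mem _ fun a _ => exists_bern_mul_lam K hp a

theorem monomial_mem_range_bern (K : Tetrahedron) (r : ℝ) (n : ℕ) (s : Fin 3 →₀ ℕ)
    (hs : s.degree = n) : monomial s r ∈ LinearMap.range (bern K n) := by
  induction n generalizing s with
  | zero =>
    rw [Finsupp.degree_eq_zero_iff] at hs
    subst hs
    have := congrArg (fun p => r • p) (one_eq_bern K)
    rw [← C_apply, ← mul_one (C r), ← MvPolynomial.smul_eq_C_mul, ← this]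
    exact Submodule.smul_mem _ _ ⟨_, rfl⟩
  | succ n ih =>
    obtain ⟨i, hi⟩ : ∃ i, s i ≠ 0 := by
      by_contra! h
      have : s = 0 := Finsupp.ext h
      simp [this] at hs
    have h1 : s = (s - Finsupp.single i 1) + Finsupp.single i 1 := by
      ext j
      by_cases hj : j = i
      · subst hj; simp; omega
      · simp [Ne.symm hj]
    rw [h1, monomial_add_single, pow_one, mul_comm]
    refine exists_bern_X_mul K (ih _ ?_) i
    rw [h1, map_add, Finsupp.degree_single] at hs
    omega

/-- Monomials are built by multiplying with X_b = ∑ x_{a,b} λ_a, and lower degrees are raised by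
elevation. The normalization of the coefficients off the level is what makes the support conditions
usable. -/
theorem exists_bern (K : Tetrahedron) {m : ℕ} {p : Poly} (hp : p ∈ polyDeg m) :
    ∃ c : Coef, (∀ γ, γ ∉ level m → c γ = 0) ∧ bern K m c = p := by
  have h : p ∈ LinearMap.range (bern K m) := by
    rw [polyDeg, mem_restrictTotalDegree] at hp
    rw [as_sum p]
    refine Submodule.sum_mem _ fun s hs => range_bern_mono K (m := s.degree) ?_
      (monomial_mem_range_bern K _ _ s rfl)
    exact (le_totalDegree hs).trans hp
  obtain ⟨c, rfl⟩ := h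
  classical
  refine ⟨fun γ => if γ ∈ level m then c γ else 0, fun γ h => if_neg h, ?_⟩
  exact bern_congr K fun γ h => if_pos h

/-! ### Uniqueness of Bernstein coefficients -/

/-- A function invariant under all moves between neighbours is constant. -/
theorem level_const {V : Type*} {n : ℕ} (f : (Fin 4 → ℕ) → V)
    (hmove : ∀ j l, ∀ ε ∈ level n, f (ε + e j) = f (ε + e l)) (a : Fin 4) {γ : Fin 4 → ℕ}
    (hγ : γ ∈ level (n + 1)) : f γ = f (Pi.single a (n + 1)) := by
  have key : ∀ t, ∀ γ ∈ level (n + 1), n + 1 - γ a = t → f γ = f (Pi.single a (n + 1)) := by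
    intro t
    induction t with
    | zero =>
      intro γ hγ h0
      rw [eq_single_of_le hγ (a := a) (by omega)]
    | succ t ih =>
      intro γ hγ h0
      obtain ⟨j, hja, hj⟩ : ∃ j, j ≠ a ∧ γ j ≠ 0 := by
        by_contra! hall
        rw [mem_level, Finset.sum_eq_single a (fun b _ hb => hall b hb) (by simp)] at hγ
        omega
      obtain ⟨β, rfl⟩ := exists_sub_e hj
      have hβ := add_e_mem_level.1 hγ
      rw [hmove j a β hβ]
      refine ih _ (add_e_mem_level.2 hβ) ?_
      rw [add_e_of_ne _ hja.symm] at h0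
      rw [add_e_self]
      omega
  exact key _ γ hγ rfl

/-- Derivatives along edges have degree one less; by induction their coefficients vanish, so c is
constant on the level. Its value is then read off at a vertex. -/
theorem bern_eq_zero (K : Tetrahedron) (m : ℕ) (c : Coef) (h : bern K m c = 0) :
    ∀ γ ∈ level m, c γ = 0 := by
  induction m generalizing c with
  | zero =>
    intro γ hγ
    have := evalAt_bern_vertex K 0 c 0
    rw [h] at this
    have h0 : γ = Pi.single 0 0 := eq_single_of_le hγ (Nat.zero_le _)
    rw [h0]
    simpa [evalAt] using this.symm
  | succ m ih =>
    have hv : ∀ a, c (Pi.single a (m + 1)) = 0 := fun a => by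
      have := evalAt_bern_vertex K (m + 1) c a
      rw [h] at this
      have hf : (Nat.factorial (m + 1) : ℝ)⁻¹ ≠ 0 := by positivity
      simpa [evalAt, hf, eq_comm, Nat.factorial_ne_zero] using this
    have hmove : ∀ j l, ∀ β ∈ level m, c (β + e j) = c (β + e l) := by
      intro j l β hβ
      have hd : bern K m (sh j c - sh l c) = 0 := by
        have hp : ∀ b, ∑ a, gv K a b • bern K m (sh a c) = 0 := fun b => by
          rw [← pderiv_bern, h, map_zero]
        -- Contracting the gradient with x_j - x_l leaves only the shifts by j and l.
        have h2 : ∑ b, (K j b - K l b) • ∑ a, gv K a b • bern K m (sh a c) = 0 := by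
          simp [hp]
        simp only [Finset.smul_sum, smul_smul] at h2
        rw [Finset.sum_comm] at h2
        simp only [← Finset.sum_smul, mul_comm (K j _ - K l _), gv_dot_edge] at h2
        simpa [sub_smul, Finset.sum_sub_distrib] using h2
      have := ih _ hd β hβ
      simp only [Pi.sub_apply, sh_apply] at this
      linarith
    exact fun γ hγ => (level_const c hmove 0 hγ).trans (hv 0)

/-! ### Combinatorics of the lattice of multi-indices -/

/-- `i, x, y, z` are the four indices in some order. -/
structure Four (i x y z : Fin 4) : Prop where
  ix : i ≠ x
  iy : i ≠ y
  iz : i ≠ z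
  xy : x ≠ y
  xz : x ≠ z
  yz : y ≠ z

theorem Four.univ_eq {i x y z : Fin 4} (h : Four i x y z) :
    (Finset.univ : Finset (Fin 4)) = {i, x, y, z} := by
  obtain ⟨h1, h2, h3, h4, h5, h6⟩ := h
  revert i x y z; decide

theorem Four.sum_eq {i x y z : Fin 4} (h : Four i x y z) {M : Type*} [AddCommMonoid M]
    (f : Fin 4 → M) : ∑ a, f a = f i + (f x + (f y + f z)) := by
  rw [h.univ_eq, Finset.sum_insert, Finset.sum_insert, Finset.sum_pair h.yz]
  · simp [h.xy, h.xz]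
  · simp [h.ix, h.iy, h.iz]

theorem Four.forall_iff {i x y z : Fin 4} (h : Four i x y z) {P : Fin 4 → Prop} :
    (∀ a, P a) ↔ P i ∧ P x ∧ P y ∧ P z := by
  refine ⟨fun hP => ⟨hP _, hP _, hP _, hP _⟩, fun ⟨h1, h2, h3, h4⟩ a => ?_⟩
  have := Finset.mem_univ a
  rw [h.univ_eq] at this
  simp only [Finset.mem_insert, Finset.mem_singleton] at this
  rcases this with rfl | rfl | rfl | rfl <;> assumption

theorem exists_four (i : Fin 4) : ∃ x y z, Four i x y z := by
  have : ∃ x y z, i ≠ x ∧ i ≠ y ∧ i ≠ z ∧ x ≠ y ∧ x ≠ z ∧ y ≠ z := by revert i; decide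
  obtain ⟨x, y, z, h1, h2, h3, h4, h5, h6⟩ := this
  exact ⟨x, y, z, h1, h2, h3, h4, h5, h6⟩

theorem exists_four_of_ne {i x : Fin 4} (hix : i ≠ x) : ∃ y z, Four i x y z := by
  have : ∃ y z, i ≠ x ∧ i ≠ y ∧ i ≠ z ∧ x ≠ y ∧ x ≠ z ∧ y ≠ z := by revert i x; decide
  obtain ⟨y, z, h1, h2, h3, h4, h5, h6⟩ := this
  exact ⟨y, z, h1, h2, h3, h4, h5, h6⟩

theorem exists_four_of_ne₃ {i x y : Fin 4} (hix : i ≠ x) (hiy : i ≠ y) (hxy : x ≠ y) :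
    ∃ z, Four i x y z := by
  have : ∃ z, i ≠ x ∧ i ≠ y ∧ i ≠ z ∧ x ≠ y ∧ x ≠ z ∧ y ≠ z := by revert i x y; decide
  obtain ⟨z, h1, h2, h3, h4, h5, h6⟩ := this
  exact ⟨z, h1, h2, h3, h4, h5, h6⟩

/-- The multi-index with entries `h, a, b, c` at the positions `i, x, y, z`. -/
def mk4 (i x y z : Fin 4) (h a b c : ℕ) : Fin 4 → ℕ :=
  Pi.single i h + Pi.single x a + Pi.single y b + Pi.single z c

theorem mk4_i {i x y z : Fin 4} (hf : Four i x y z) (h a b c : ℕ) :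
    mk4 i x y z h a b c i = h := by
  simp [mk4, hf.ix, hf.iy, hf.iz]

theorem mk4_x {i x y z : Fin 4} (hf : Four i x y z) (h a b c : ℕ) :
    mk4 i x y z h a b c x = a := by
  simp [mk4, hf.ix.symm, hf.xy, hf.xz]

theorem mk4_y {i x y z : Fin 4} (hf : Four i x y z) (h a b c : ℕ) :
    mk4 i x y z h a b c y = b := by
  simp [mk4, hf.iy.symm, hf.xy.symm, hf.yz]

theorem mk4_z {i x y z : Fin 4} (hf : Four i x y z) (h a b c : ℕ) :
    mk4 i x y z h a b c z = c := by
  simp [mk4, hf.iz.symm, hf.xz.symm, hf.yz.symm]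

theorem mk4_add_x (i x y z : Fin 4) (h a b c : ℕ) :
    mk4 i x y z h a b c + e x = mk4 i x y z h (a + 1) b c := by
  simp only [mk4, e, Pi.single_add]; abel

theorem mk4_add_y (i x y z : Fin 4) (h a b c : ℕ) :
    mk4 i x y z h a b c + e y = mk4 i x y z h a (b + 1) c := by
  simp only [mk4, e, Pi.single_add]; abel

theorem mk4_add_z (i x y z : Fin 4) (h a b c : ℕ) :
    mk4 i x y z h a b c + e z = mk4 i x y z h a b (c + 1) := by
  simp only [mk4, e, Pi.single_add]; abel

theorem eq_mk4 {i x y z : Fin 4} (hf : Four i x y z) (γ : Fin 4 → ℕ) :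
    γ = mk4 i x y z (γ i) (γ x) (γ y) (γ z) := by
  rw [funext_iff, hf.forall_iff, mk4_i hf, mk4_x hf, mk4_y hf, mk4_z hf]
  exact ⟨rfl, rfl, rfl, rfl⟩

theorem mem_level_four {i x y z : Fin 4} (hf : Four i x y z) {m : ℕ} {γ : Fin 4 → ℕ} :
    γ ∈ level m ↔ γ i + (γ x + (γ y + γ z)) = m := by
  rw [mem_level, hf.sum_eq]

theorem mk4_mem_level {i x y z : Fin 4} (hf : Four i x y z) {m h a b c : ℕ} :
    mk4 i x y z h a b c ∈ level m ↔ h + (a + (b + c)) = m := by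
  rw [mem_level_four hf, mk4_i hf, mk4_x hf, mk4_y hf, mk4_z hf]

theorem le_of_mem_level {m : ℕ} {γ : Fin 4 → ℕ} (h : γ ∈ level m) (a : Fin 4) : γ a ≤ m := by
  rw [mem_level] at h
  rw [← h]
  exact Finset.single_le_sum (fun _ _ => Nat.zero_le _) (Finset.mem_univ a)

/-- `γ` is not `m e_a`, for `γ` of order `m`. -/
def NonVertex (m : ℕ) (γ : Fin 4 → ℕ) : Prop := ∀ a, γ a < m

theorem nonVertex_add_e {n : ℕ} {ε : Fin 4 → ℕ} (hε : ε ∈ level n) (j : Fin 4) :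
    NonVertex (n + 1) (ε + e j) ↔ ε j < n := by
  refine ⟨fun h => ?_, fun h a => ?_⟩
  · have := h j
    rw [add_e_self] at this
    omega
  · have := le_of_mem_level hε a
    rw [add_e_apply]
    split_ifs with hj
    · subst hj; omega
    · omega

/-- Connectedness of the layers `{γ i = const}` of the lattice without its vertices. -/
theorem layer_const {V : Type*} {n : ℕ} (hn : 2 ≤ n) (i : Fin 4) (f : (Fin 4 → ℕ) → V)
    (hmove : ∀ ε ∈ level n, ∀ j l, j ≠ i → l ≠ i → ε j < n → ε l < n → f (ε + e j) = f (ε + e l))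
    {β β' : Fin 4 → ℕ} (hβ : β ∈ level (n + 1)) (hβ' : β' ∈ level (n + 1))
    (hv : NonVertex (n + 1) β) (hv' : NonVertex (n + 1) β') (h : β i = β' i) : f β = f β' := by
  obtain ⟨x, y, z, hf⟩ := exists_four i
  -- All mass in the layer is pushed to position x. For h = 0 this target would be the excluded
  -- corner, so its neighbour (0, n, 1, 0) is used instead.
  have key : ∀ t h a b c, b + c = t → h + (a + (b + c)) = n + 1 → a ≤ n → b ≤ n → c ≤ n →
      f (mk4 i x y z h a b c)
        = if h = 0 then f (mk4 i x y z 0 n 1 0) else f (mk4 i x y z h (n + 1 - h) 0 0) := by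
    have hxy : ∀ h a b c, h + (a + (b + c)) = n → a < n → b < n →
        f (mk4 i x y z h (a + 1) b c) = f (mk4 i x y z h a (b + 1) c) := by
      intro h a b c hs ha hb
      have := hmove (mk4 i x y z h a b c) ((mk4_mem_level hf).2 hs) x y hf.ix.symm hf.iy.symm
        (by rwa [mk4_x hf]) (by rwa [mk4_y hf])
      rwa [mk4_add_x, mk4_add_y] at this
    have hxz : ∀ h a b c, h + (a + (b + c)) = n → a < n → c < n →
        f (mk4 i x y z h (a + 1) b c) = f (mk4 i x y z h a b (c + 1)) := by
      intro h a b c hs ha hb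
      have := hmove (mk4 i x y z h a b c) ((mk4_mem_level hf).2 hs) x z hf.ix.symm hf.iz.symm
        (by rwa [mk4_x hf]) (by rwa [mk4_z hf])
      rwa [mk4_add_x, mk4_add_z] at this
    intro t
    induction t with
    | zero =>
      intro h a b c ht hs ha _ _
      obtain rfl : b = 0 := by omega
      obtain rfl : c = 0 := by omega
      rw [if_neg (by omega)]
      congr 2
      omega
    | succ t ih =>
      intro h a b c ht hs ha hb hc
      by_cases hsp : h = 0 ∧ t = 0
      · obtain ⟨rfl, rfl⟩ := hsp
        rw [if_pos rfl]
        obtain rfl : a = n := by omega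
        rcases Nat.eq_zero_or_pos c with rfl | hc0
        · obtain rfl : b = 1 := by omega
          rfl
        · obtain rfl : c = 1 := by omega
          obtain rfl : b = 0 := by omega
          -- The direct move from (0, n, 0, 1) to (0, n, 1, 0) is forbidden, because it pivots at n
          -- e_x. The path goes through (0, n - 1, 1, 1).
          obtain ⟨a, rfl⟩ : ∃ a', a = a' + 1 := ⟨a - 1, by omega⟩
          rw [hxy 0 a 0 1 (by omega) (by omega) (by omega),
            ← hxz 0 a 1 0 (by omega) (by omega) (by omega)]
      · rcases Nat.eq_zero_or_pos c with rfl | hc0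
        · obtain ⟨b, rfl⟩ : ∃ b', b = b' + 1 := ⟨b - 1, by omega⟩
          rw [← hxy h a b 0 (by omega) (by omega) (by omega)]
          exact ih h (a + 1) b 0 (by omega) (by omega) (by omega) (by omega) (by omega)
        · obtain ⟨c, rfl⟩ : ∃ c', c = c' + 1 := ⟨c - 1, by omega⟩
          rw [← hxz h a b c (by omega) (by omega) (by omega)]
          exact ih h (a + 1) b c (by omega) (by omega) (by omega) (by omega) (by omega)
  have key' : ∀ γ ∈ level (n + 1), NonVertex (n + 1) γ → f γ = if γ i = 0 then
      f (mk4 i x y z 0 n 1 0) else f (mk4 i x y z (γ i) (n + 1 - γ i) 0 0) := fun γ hγ hv => by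
    conv_lhs => rw [eq_mk4 hf γ]
    exact key _ _ _ _ _ rfl ((mem_level_four hf).1 hγ) (Nat.lt_succ_iff.1 (hv x))
      (Nat.lt_succ_iff.1 (hv y)) (Nat.lt_succ_iff.1 (hv z))
  rw [key' β hβ hv, key' β' hβ' hv', h]

theorem exists_mem_level {n : ℕ} {i j l : Fin 4} (hij : i ≠ j) (hil : i ≠ l) (hjl : j ≠ l)
    {a b c : ℕ} (h : a + b + c ≤ n) : ∃ ε ∈ level n, ε i = a ∧ ε j = b ∧ ε l = c := by
  obtain ⟨z, hf⟩ := exists_four_of_ne₃ hij hil hjl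
  exact ⟨mk4 i j l z a b c (n - (a + b + c)), (mk4_mem_level hf).2 (by omega), mk4_i hf _ _ _ _,
    mk4_x hf _ _ _ _, mk4_y hf _ _ _ _⟩

theorem exists_nonVertex {n : ℕ} (hn : 1 ≤ n) (i : Fin 4) {a : ℕ} (h : a ≤ n) :
    ∃ β ∈ level (n + 1), NonVertex (n + 1) β ∧ β i = a := by
  obtain ⟨x, y, z, hf⟩ := exists_four i
  refine ⟨mk4 i x y z a (n - a) 1 0, (mk4_mem_level hf).2 (by omega), ?_, mk4_i hf _ _ _ _⟩
  rw [NonVertex, hf.forall_iff, mk4_i hf, mk4_x hf, mk4_y hf, mk4_z hf]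
  omega

/-- Families `φ_i` of functions of the multi-indices, each depending only on the `i`-th entry and
with sum zero, are affine. -/
theorem affine_of_layer {V : Type*} [AddCommGroup V] [Module ℝ V] {n : ℕ} (hn : 2 ≤ n)
    (φ : Fin 4 → (Fin 4 → ℕ) → V)
    (hmove : ∀ i, ∀ ε ∈ level n, ∀ j l, j ≠ i → l ≠ i → ε j < n → ε l < n →
      φ i (ε + e j) = φ i (ε + e l))
    (hsum : ∀ β ∈ level (n + 1), NonVertex (n + 1) β → ∑ i, φ i β = 0) :
    ∃ (d : Fin 4 → V) (c : V), (∀ i, ∀ β ∈ level (n + 1), NonVertex (n + 1) β →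
      φ i β = d i + (β i : ℝ) • c) ∧ ∑ i, d i + ((n : ℝ) + 1) • c = 0 := by
  have hlayer := fun i (β β' : Fin 4 → ℕ) => layer_const (β := β) (β' := β') hn i (φ i) (hmove i)
  have hΦ : ∀ i, ∃ Φ : ℕ → V, ∀ β ∈ level (n + 1), NonVertex (n + 1) β → φ i β = Φ (β i) := by
    intro i
    choose pt hpt using fun a (h : a ≤ n) => exists_nonVertex (by omega : 1 ≤ n) i h
    refine ⟨fun a => if h : a ≤ n then φ i (pt a h) else 0, fun β hβ hv => ?_⟩
    have h := Nat.lt_succ_iff.1 (hv i)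
    obtain ⟨h1, h2, h3⟩ := hpt _ h
    simp only [h, dif_pos]
    exact hlayer i _ _ hβ h1 hv h2 h3.symm
  choose Φ hΦ using hΦ
  -- Comparing the zero sums at ε + e_i and ε + e_j cancels the other two functions and equates an
  -- increment of Φ i with one of Φ j.
  have hD : ∀ i j, i ≠ j → ∀ a b, a < n → b < n → a + b ≤ n →
      Φ i (a + 1) - Φ i a = Φ j (b + 1) - Φ j b := by
    intro i j hij a b ha hb hab
    obtain ⟨l, z, hf⟩ := exists_four_of_ne hij
    obtain ⟨ε, hε, hi, hj, -⟩ := exists_mem_level (n := n) hij hf.iy hf.xy (a := a) (b := b) (c := 0)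
      (by omega)
    have h1 := (nonVertex_add_e hε i).2 (by omega)
    have h2 := (nonVertex_add_e hε j).2 (by omega)
    have e1 := hsum _ (add_e_mem_level.2 hε) h1
    have e2 := hsum _ (add_e_mem_level.2 hε) h2
    rw [← e2] at e1
    simp only [hΦ _ _ (add_e_mem_level.2 hε) h1, hΦ _ _ (add_e_mem_level.2 hε) h2] at e1
    rw [hf.sum_eq, hf.sum_eq] at e1
    rw [add_e_self, add_e_self, add_e_of_ne _ hij, add_e_of_ne _ hij.symm,
      add_e_of_ne _ hf.iy.symm, add_e_of_ne _ hf.iz.symm, add_e_of_ne _ hf.xy.symm,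
      add_e_of_ne _ hf.xz.symm, hi, hj, ← add_assoc, ← add_assoc (Φ i a)] at e1
    have := add_right_cancel e1
    rw [sub_eq_sub_iff_add_eq_add, this, add_comm]
  have hD0 : ∀ i a, a < n → Φ i (a + 1) - Φ i a = Φ 0 1 - Φ 0 0 := by
    intro i a ha
    by_cases hi : i = 0
    -- For i = 0 the increments at a and at 0 are both compared with the first increment of Φ 1.
    · subst hi
      rw [hD 0 1 (by decide) a 0 ha (by omega) (by omega),
        hD 1 0 (by decide) 0 0 (by omega) (by omega) (by omega)]
    · exact hD i 0 hi a 0 ha (by omega) (by omega)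
  have hlin : ∀ i a, a ≤ n → Φ i a = Φ i 0 + (a : ℝ) • (Φ 0 1 - Φ 0 0) := by
    intro i a
    induction a with
    | zero => simp
    | succ a ih =>
      intro ha
      have h1 := hD0 i a (by omega)
      rw [sub_eq_iff_eq_add] at h1
      rw [h1, ih (by omega)]
      push_cast
      module
  refine ⟨fun i => Φ i 0, Φ 0 1 - Φ 0 0, fun i β hβ hv => ?_, ?_⟩
  · rw [hΦ i β hβ hv, hlin i _ (Nat.lt_succ_iff.1 (hv i))]
  · obtain ⟨β, hβ, hv, -⟩ := exists_nonVertex (by omega : 1 ≤ n) 0 (Nat.zero_le n)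
    have h := hsum β hβ hv
    have : ∀ i, φ i β = Φ i 0 + (β i : ℝ) • (Φ 0 1 - Φ 0 0) := fun i => by
      rw [hΦ i β hβ hv, hlin i _ (Nat.lt_succ_iff.1 (hv i))]
    simp only [this, Finset.sum_add_distrib, ← Finset.sum_smul] at h
    rw [mem_level] at hβ
    rw [← h]
    congr 2
    exact_mod_cast hβ.symm

/-- Points with the same j-th and l-th entries lie on one line of the lattice, along which mass is
transferred between p and q. -/
theorem line_const {V : Type*} {n : ℕ} {j l p q : Fin 4} (hf : Four j l p q)
    (f : (Fin 4 → ℕ) → V) (hmove : ∀ δ, δ + e p ∈ level n → f (δ + e p) = f (δ + e q))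
    {ε ε' : Fin 4 → ℕ} (hε : ε ∈ level n) (hε' : ε' ∈ level n) (hj : ε j = ε' j)
    (hl : ε l = ε' l) : f ε = f ε' := by
  have key : ∀ t, ∀ ε ∈ level n, ∀ ε' ∈ level n, ε j = ε' j → ε l = ε' l → ε q = ε' q + t →
      f ε = f ε' := by
    intro t
    induction t with
    | zero =>
      intro ε hε ε' hε' hj hl hq
      rw [mem_level_four hf] at hε hε'
      congr 1
      rw [funext_iff, hf.forall_iff]
      exact ⟨hj, hl, by omega, by omega⟩
    | succ t ih =>
      intro ε hε ε' hε' hj hl hq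
      obtain ⟨δ, rfl⟩ := exists_sub_e (γ := ε) (a := q) (by omega)
      have hp : δ + e p ∈ level n := by
        rw [mem_level, sum_add_e] at *
        exact hε
      rw [add_e_self] at hq
      rw [add_e_of_ne _ hf.iz] at hj
      rw [add_e_of_ne _ hf.xz] at hl
      rw [← hmove δ hp]
      refine ih _ hp _ hε' ?_ ?_ ?_
      · rw [add_e_of_ne _ hf.iy, hj]
      · rw [add_e_of_ne _ hf.xy, hl]
      · rw [add_e_of_ne _ hf.yz.symm]; omega
  rcases le_total (ε' q) (ε q) with h | h
  · exact key (ε q - ε' q) _ hε _ hε' hj hl (by omega)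
  · exact (key (ε' q - ε q) _ hε' _ hε hj.symm hl.symm (by omega)).symm

/-- A function on the non-vertices annihilated by all rectangles is a sum of functions of one
entry. -/
theorem sum_of_rectangles {V : Type*} [AddCommGroup V] {n : ℕ} (hn : 2 ≤ n)
    (G : (Fin 4 → ℕ) → V)
    (hrect : ∀ δ i j l p, Four i j l p → δ + e l + e p ∈ level (n + 1) →
      G (δ + e i + e l) - G (δ + e j + e l) = G (δ + e i + e p) - G (δ + e j + e p)) :
    ∃ φ : Fin 4 → ℕ → V, ∀ β ∈ level (n + 1), NonVertex (n + 1) β → G β = ∑ i, φ i (β i) := by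
  -- The rectangle relations say that a difference in the direction e_j - e_l does not change along
  -- the complementary line, so it depends only on the two entries ε j and ε l.
  have hα : ∀ j l, j ≠ l → ∃ α : ℕ → ℕ → V, ∀ ε ∈ level n, ε j < n → ε l < n →
      G (ε + e j) - G (ε + e l) = α (ε j) (ε l) := by
    intro j l hjl
    obtain ⟨p, q, hf⟩ := exists_four_of_ne hjl
    classical
    refine ⟨fun a b => if h : ∃ ε ∈ level n, ε j = a ∧ ε l = b then
      G (h.choose + e j) - G (h.choose + e l) else 0, fun ε hε _ _ => ?_⟩
    have h : ∃ ε' ∈ level n, ε' j = ε j ∧ ε' l = ε l := ⟨ε, hε, rfl, rfl⟩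
    obtain ⟨h1, h2, h3⟩ := h.choose_spec
    simp only [h, dif_pos]
    refine line_const hf (fun ε => G (ε + e j) - G (ε + e l)) ?_ hε h1 h2.symm h3.symm
    intro δ hδ
    have hr := hrect δ j l p q hf (add_e_mem_level.2 hδ)
    simp only [add_right_comm δ] at hr ⊢
    exact hr
  choose! α hα using hα
  -- The cocycle identity for differences at a common ε; with the antisymmetry below it separates
  -- the variables of α, in the form α j l a b = D j a - D l b.
  have hcyc : ∀ i j l, i ≠ j → i ≠ l → j ≠ l → ∀ a b c, a < n → b < n → c < n → a + b + c ≤ n →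
      α i j a b + α j l b c = α i l a c := by
    intro i j l hij hil hjl a b c ha hb hc hs
    obtain ⟨ε, hε, rfl, rfl, rfl⟩ := exists_mem_level (n := n) hij hil hjl hs
    rw [← hα i j hij ε hε ha hb, ← hα j l hjl ε hε hb hc, ← hα i l hil ε hε ha hc]
    abel
  have hanti : ∀ i j, i ≠ j → ∀ a b, a < n → b < n → a + b ≤ n → α j i b a = -α i j a b := by
    intro i j hij a b ha hb hs
    obtain ⟨l, z, hf⟩ := exists_four_of_ne hij
    obtain ⟨ε, hε, rfl, rfl, -⟩ := exists_mem_level (n := n) hij hf.iy hf.xy (a := a) (b := b)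
      (c := 0) (by omega)
    rw [← hα i j hij ε hε ha hb, ← hα j i hij.symm ε hε hb ha]
    abel
  have hsplit : ∀ j l, j ≠ 0 → l ≠ 0 → j ≠ l → ∀ a b, a < n → b < n → a + b ≤ n →
      α 0 j a b = α 0 l a 0 - α 0 l 0 0 + α 0 j 0 b := by
    intro j l hj hl hjl a b ha hb hs
    have h1 := hcyc 0 j l hj.symm hl.symm hjl a b 0 ha hb (by omega) (by omega)
    have h2 := hcyc 0 j l hj.symm hl.symm hjl 0 b 0 (by omega) hb (by omega) (by omega)
    rw [← h1, ← h2]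
    abel
  have hsplit1 : ∀ j, j ≠ 0 → ∀ a b, a < n → b < n → a + b ≤ n →
      α 0 j a b = α 0 1 a 0 - α 0 1 0 0 + α 0 j 0 b := by
    intro j hj a b ha hb hs
    -- `hsplit` needs two distinct auxiliary indices, so for j = 1 it is applied through the index 2
    -- and back.
    by_cases hj1 : j = 1
    · subst hj1
      rw [hsplit 1 2 hj (by decide) (by decide) a b ha hb hs,
        hsplit 2 1 (by decide) hj (by decide) a 0 ha (by omega) (by omega)]
      have := hsplit 1 2 hj (by decide) (by decide) a 0 ha (by omega) (by omega)
      abel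
    · exact hsplit j 1 hj (by decide) hj1 a b ha hb hs
  let D : Fin 4 → ℕ → V := fun i a =>
    if i = 0 then α 0 1 a 0 - α 0 1 0 0 else -α 0 i 0 a
  have hD0 : ∀ j, j ≠ 0 → ∀ a b, a < n → b < n → a + b ≤ n → α 0 j a b = D 0 a - D j b := by
    intro j hj a b ha hb hs
    simp only [D, if_pos, if_neg hj]
    rw [hsplit1 j hj a b ha hb hs]
    abel
  have hD : ∀ j l, j ≠ l → ∀ a b, a < n → b < n → a + b ≤ n → α j l a b = D j a - D l b := by
    intro j l hjl a b ha hb hs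
    by_cases hj : j = 0
    · subst hj; exact hD0 l hjl.symm a b ha hb hs
    · by_cases hl : l = 0
      · subst hl
        rw [hanti 0 j hjl.symm b a hb ha (by omega), hD0 j hj b a hb ha (by omega)]
        abel
      · have h := hcyc 0 j l (Ne.symm hj) (Ne.symm hl) hjl 0 a b (by omega) ha hb (by omega)
        rw [hD0 j hj 0 a (by omega) ha (by omega), hD0 l hl 0 b (by omega) hb (by omega)] at h
        rw [eq_sub_of_add_eq' h]
        abel
  -- Discrete antiderivatives of D, so that G minus their sum is invariant under every admissible
  -- move.
  let φ : Fin 4 → ℕ → V := fun i h => ∑ t ∈ Finset.range h, D i t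
  let H : (Fin 4 → ℕ) → V := fun β => G β - ∑ i, φ i (β i)
  have hH : ∀ ε ∈ level n, ∀ j l, ε j < n → ε l < n → H (ε + e j) = H (ε + e l) := by
    intro ε hε j l hj hl
    by_cases hjl : j = l
    · rw [hjl]
    obtain ⟨p, q, hf⟩ := exists_four_of_ne hjl
    have hs : ε j + ε l ≤ n := by
      rw [mem_level_four hf] at hε; omega
    have h1 := hα j l hjl ε hε hj hl
    rw [hD j l hjl _ _ hj hl hs] at h1
    simp only [H]
    rw [hf.sum_eq, hf.sum_eq, add_e_self, add_e_self, add_e_of_ne _ hjl,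
      add_e_of_ne _ (Ne.symm hjl), add_e_of_ne _ hf.iy.symm, add_e_of_ne _ hf.iz.symm,
      add_e_of_ne _ hf.xy.symm, add_e_of_ne _ hf.xz.symm]
    have e1 : φ j (ε j + 1) = φ j (ε j) + D j (ε j) := Finset.sum_range_succ _ _
    have e2 : φ l (ε l + 1) = φ l (ε l) + D l (ε l) := Finset.sum_range_succ _ _
    rw [sub_eq_iff_eq_add] at h1
    rw [e1, e2, h1]
    abel
  have hlayer := fun i (β β' : Fin 4 → ℕ) => layer_const (β := β) (β' := β') hn i H
    (fun ε hε j l _ _ => hH ε hε j l)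
  obtain ⟨β₀, hβ₀, hv₀, h₀⟩ := exists_nonVertex (by omega : 1 ≤ n) 1 (Nat.zero_le n)
  refine ⟨fun i h => φ i h + if i = 0 then H β₀ else 0, fun β hβ hv => ?_⟩
  have hconst : H β = H β₀ := by
    have hf : Four 0 1 2 3 := ⟨by decide, by decide, by decide, by decide, by decide, by decide⟩
    have hb := Nat.lt_succ_iff.1 (hv 0)
    -- A 0-layer and the 1-layer at height zero meet in this non-vertex, so constancy on layers
    -- yields global constancy.
    have hm : mk4 0 1 2 3 (β 0) 0 (n - β 0) 1 ∈ level (n + 1) := (mk4_mem_level hf).2 (by omega)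
    have hm' : NonVertex (n + 1) (mk4 0 1 2 3 (β 0) 0 (n - β 0) 1) := by
      rw [NonVertex, hf.forall_iff, mk4_i hf, mk4_x hf, mk4_y hf, mk4_z hf]
      omega
    rw [hlayer 0 _ _ hβ hm hv hm' (by rw [mk4_i hf])]
    exact hlayer 1 _ _ hm hβ₀ hm' hv₀ (by rw [mk4_x hf, h₀])
  rw [Finset.sum_add_distrib]
  simp only [Finset.sum_ite_eq', Finset.mem_univ, if_true]
  rw [← hconst]
  simp only [H]
  abel

/-- A discrete stream function on triangles. -/
theorem exists_stream (c₁ c₂ c₃ : ℕ → ℕ → ℕ → ℝ) (hsum : ∀ a b c, c₁ a b c + c₂ a b c + c₃ a b c = 0)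
    (h₁ : ∀ b c, c₁ 0 b c = 0) (h₂ : ∀ a c, c₂ a 0 c = 0) (h₃ : ∀ a b, c₃ a b 0 = 0)
    (hdiv : ∀ a b c, c₁ (a + 1) b c + c₂ a (b + 1) c + c₃ a b (c + 1) = 0) :
    ∃ ψ : ℕ → ℕ → ℕ → ℝ, (∀ b c, ψ 0 b c = 0) ∧ (∀ a c, ψ a 0 c = 0) ∧ (∀ a b, ψ a b 0 = 0) ∧
      (∀ a b c, c₁ a b c = ψ a (b + 1) c - ψ a b (c + 1)) ∧
      (∀ a b c, c₂ a b c = ψ a b (c + 1) - ψ (a + 1) b c) ∧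
      (∀ a b c, c₃ a b c = ψ (a + 1) b c - ψ a (b + 1) c) := by
  -- The first required identity serves as the recursion in b, started from zero on the edge b = 0.
  -- The divergence and sum relations propagate the second identity; the third then follows from the
  -- zero sum.
  let ψ : ℕ → ℕ → ℕ → ℝ := fun a b => Nat.rec (motive := fun _ => ℕ → ℝ) (fun _ => 0)
    (fun b r c => r (c + 1) + c₁ a b c) b
  have ψ0 : ∀ a c, ψ a 0 c = 0 := fun _ _ => rfl
  have ψs : ∀ a b c, ψ a (b + 1) c = ψ a b (c + 1) + c₁ a b c := fun _ _ _ => rfl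
  have hx : ∀ b c, ψ 0 b c = 0 := by
    intro b
    induction b with
    | zero => exact ψ0 0
    | succ b ih => intro c; rw [ψs, ih, h₁, add_zero]
  have hy : ∀ b a c, ψ (a + 1) b c = ψ a b (c + 1) - c₂ a b c := by
    intro b
    induction b with
    | zero => intro a c; rw [ψ0, ψ0, h₂, sub_zero]
    | succ b ih =>
      intro a c
      have := hsum a b (c + 1)
      have := hdiv a b c
      rw [ψs, ψs, ih]
      linarith
  have hz : ∀ a b c, c₃ a b c = ψ (a + 1) b c - ψ a (b + 1) c := by
    intro a b c
    have := hsum a b c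
    rw [hy, ψs]
    linarith
  refine ⟨ψ, hx, ψ0, ?_, fun a b c => by rw [ψs]; ring, fun a b c => by rw [hy]; ring, hz⟩
  intro a
  induction a with
  | zero => exact fun b => hx b 0
  | succ a ih =>
    intro b
    have := hz a b 0
    rw [h₃, ih (b + 1), sub_zero] at this
    exact this.symm

/-! ### The complex of Bernstein coefficients -/

/-- Square arrays of Bernstein coefficients. -/
abbrev Coef4 : Type := Fin 4 → Fin 4 → Coef

/-- The Bernstein coefficients of the divergence. -/
def divc : Coef4 →ₗ[ℝ] (Fin 4 → Coef) where
  toFun c := fun i => ∑ j, sh j (c i j)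
  map_add' c d := by ext i; simp [Finset.sum_add_distrib]
  map_smul' r c := by ext i; simp [Finset.mul_sum]

theorem divc_apply (c : Coef4) (i : Fin 4) (β : Fin 4 → ℕ) :
    divc c i β = ∑ j, c i j (β + e j) := by
  simp [divc, sh_apply]

/-- The Bernstein coefficients of the curl. -/
def curlc : Coef4 →ₗ[ℝ] Coef4 where
  toFun S := fun i l => ∑ c, ∑ j, (eps l c j : ℝ) • (sh c (S i j) - sh c (S l j))
  map_add' S T := by
    ext i l : 2
    simp only [Pi.add_apply, map_add, add_sub_add_comm, smul_add, Finset.sum_add_distrib]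
  map_smul' r S := by
    ext i l : 2
    simp only [Pi.smul_apply, map_smul, ← smul_sub, Finset.smul_sum, RingHom.id_apply]
    congr! 2
    rw [smul_comm]

theorem curlc_apply (S : Coef4) (i l : Fin 4) (γ : Fin 4 → ℕ) :
    curlc S i l γ = ∑ c, ∑ j, (eps l c j : ℝ) * (S i j (γ + e c) - S l j (γ + e c)) := by
  simp [curlc, sh_apply, Finset.sum_apply]

/-- The coefficients of the bubble space of the divergence. -/
def divCoef (m : ℕ) : Submodule ℝ Coef4 where
  carrier := {c | (∀ i j γ, c i j γ ≠ 0 → γ ∈ level (m + 1) ∧ NonVertex m γ ∧ γ j ≠ 0 ∧ i ≠ j) ∧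
    ∀ i γ, ∑ j, c i j γ = 0}
  zero_mem' := ⟨fun i j γ h => absurd rfl h, fun i γ => by simp⟩
  add_mem' := by
    rintro c d ⟨h1, h2⟩ ⟨h3, h4⟩
    refine ⟨fun i j γ h => ?_, fun i γ => ?_⟩
    · by_cases hc : c i j γ = 0
      · exact h3 i j γ fun hd => h (by simp [hc, hd])
      · exact h1 i j γ hc
    · simp [Finset.sum_add_distrib, h2, h4]
  smul_mem' := by
    rintro r c ⟨h1, h2⟩
    refine ⟨fun i j γ h => h1 i j γ fun hc => h (by simp [hc]), fun i γ => ?_⟩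
    simp [← Finset.mul_sum, h2]

/-- The coefficients of the bubble space of the curl. -/
def curlCoef (m : ℕ) : Submodule ℝ Coef4 where
  carrier := {S | (∀ i j, S i j = S j i) ∧ ∀ i j γ, S i j γ ≠ 0 →
    γ ∈ level (m + 2) ∧ NonVertex m γ ∧ ∀ a, γ a = 0 → i = a ∧ j = a}
  zero_mem' := ⟨fun i j => rfl, fun i j γ h => absurd rfl h⟩
  add_mem' := by
    rintro c d ⟨h1, h2⟩ ⟨h3, h4⟩
    refine ⟨fun i j => by simp only [Pi.add_apply, h1 i j, h3 i j], fun i j γ h => ?_⟩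
    by_cases hc : c i j γ = 0
    · exact h4 i j γ fun hd => h (by simp [hc, hd])
    · exact h2 i j γ hc
  smul_mem' := by
    rintro r c ⟨h1, h2⟩
    exact ⟨fun i j => by simp only [Pi.smul_apply, h1 i j],
      fun i j γ h => h2 i j γ fun hc => h (by simp [hc])⟩

/-- The term with S_lj in `curlc` makes the diagonal vanish. A nonzero `eps l c j` has l different
from c and j; if γ_l = 0 then also (γ + e_c)_l = 0, and the support of S would force j = l. In the
row sums the S_ij part is killed by ∑_l eps = 0, and the S_lj part pairs a symmetric array with an
antisymmetric symbol. -/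
theorem curlc_mem_divCoef {m : ℕ} {S : Coef4} (hS : S ∈ curlCoef m) : curlc S ∈ divCoef m := by
  obtain ⟨hsym, hsupp⟩ := hS
  refine ⟨fun i l γ h => ?_, fun i γ => ?_⟩
  · have hil : i ≠ l := by
      rintro rfl
      exact h (by simp [curlc_apply])
    rw [curlc_apply] at h
    obtain ⟨c, -, h⟩ := Finset.exists_ne_zero_of_sum_ne_zero h
    obtain ⟨j, -, h⟩ := Finset.exists_ne_zero_of_sum_ne_zero h
    have heps : eps l c j ≠ 0 := fun h0 => h (by simp [h0])
    have hlc : l ≠ c := by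
      rintro rfl
      have := eps_swap_left l l j
      omega
    have hlj : l ≠ j := by
      rintro rfl
      have := eps_swap_outer l c l
      omega
    have : ∃ i', S i' j (γ + e c) ≠ 0 := by
      by_contra! h0
      exact h (by simp [h0])
    obtain ⟨i', hi'⟩ := this
    obtain ⟨h1, h2, h3⟩ := hsupp _ _ _ hi'
    refine ⟨add_e_mem_level.1 h1, fun a => ?_, fun h0 => ?_, hil⟩
    · have := h2 a
      rw [add_e_apply] at this
      omega
    · have := (h3 l (by rw [add_e_of_ne _ hlc, h0])).2
      exact hlj this.symm
  · simp only [curlc_apply, mul_sub, Finset.sum_sub_distrib]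
    have h1 : ∑ l, ∑ c, ∑ j, (eps l c j : ℝ) * S i j (γ + e c) = 0 := by
      rw [Finset.sum_comm]
      refine Finset.sum_eq_zero fun c _ => ?_
      rw [Finset.sum_comm]
      refine Finset.sum_eq_zero fun j _ => ?_
      rw [← Finset.sum_mul, ← Int.cast_sum, sum_eps]
      simp
    have h2 : ∑ l, ∑ c, ∑ j, (eps l c j : ℝ) * S l j (γ + e c)
        = -∑ l, ∑ c, ∑ j, (eps l c j : ℝ) * S l j (γ + e c) := by
      conv_lhs => rw [Finset.sum_comm]
      conv_rhs => rw [Finset.sum_comm]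
      rw [← Finset.sum_neg_distrib]
      refine Finset.sum_congr rfl fun c _ => ?_
      rw [← Finset.sum_neg_distrib]
      refine Finset.sum_comm.trans (Finset.sum_congr rfl fun j _ => ?_)
      rw [← Finset.sum_neg_distrib]
      refine Finset.sum_congr rfl fun l _ => ?_
      rw [hsym l j, eps_swap_outer j c l]
      push_cast
      ring
    rw [h1]
    linarith

/-- The S_ij part is symmetric under exchanging the two shifts and `eps` is antisymmetric. What
remains does not depend on the row: it need not vanish as a coefficient array, but ∑ ∇λ_i = 0
annihilates it as a field. -/
theorem divc_curlc (S : Coef4) (i : Fin 4) (β : Fin 4 → ℕ) : divc (curlc S) i β =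
    -∑ l, ∑ c, ∑ j, (eps l c j : ℝ) * S l j (β + e l + e c) := by
  simp only [divc_apply, curlc_apply, mul_sub, Finset.sum_sub_distrib]
  have h1 : ∑ l, ∑ c, ∑ j, (eps l c j : ℝ) * S i j (β + e l + e c)
      = -∑ l, ∑ c, ∑ j, (eps l c j : ℝ) * S i j (β + e l + e c) := by
    conv_lhs => rw [Finset.sum_comm]
    rw [← Finset.sum_neg_distrib]
    refine Finset.sum_congr rfl fun c _ => ?_
    rw [← Finset.sum_neg_distrib]
    refine Finset.sum_congr rfl fun l _ => ?_
    rw [← Finset.sum_neg_distrib]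
    refine Finset.sum_congr rfl fun j _ => ?_
    rw [eps_swap_left c l j, add_right_comm]
    push_cast
    ring
  linarith

/-! ### Exactness of the coefficient complex -/

/-- Discrete integration by parts: entries c_ij live at j ≠ i, so the shift by e_j leaves the weight
φ(β_i) unchanged, and the row sums are zero. The values may lie in any module, since quotients by
the range will serve as targets. -/
theorem sum_divc_smul {V : Type*} [AddCommGroup V] [Module ℝ V] {m : ℕ} {c : Coef4}
    (hc : c ∈ divCoef m) (i : Fin 4) (φ : ℕ → V) :
    ∑ β ∈ level m, divc c i β • φ (β i) = 0 := by
  simp only [divc_apply, Finset.sum_smul]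
  rw [Finset.sum_comm]
  have : ∀ j, ∑ β ∈ level m, c i j (β + e j) • φ (β i)
      = ∑ γ ∈ level (m + 1), c i j γ • φ (γ i) := by
    intro j
    rw [sum_level_succ m j]
    · refine Finset.sum_congr rfl fun β _ => ?_
      by_cases h : c i j (β + e j) = 0
      · rw [h, zero_smul, zero_smul]
      · rw [add_e_of_ne _ (hc.1 i j _ h).2.2.2]
    · intro γ _ h
      by_contra h0
      exact (hc.1 i j γ fun h1 => h0 (by rw [h1, zero_smul])).2.2.1 h
  simp only [this]
  rw [Finset.sum_comm]
  refine Finset.sum_eq_zero fun γ _ => ?_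
  rw [← Finset.sum_smul, hc.2, zero_smul]

theorem divc_support {m : ℕ} {c : Coef4} (hc : c ∈ divCoef m) (i : Fin 4) {β : Fin 4 → ℕ}
    (h : divc c i β ≠ 0) : β ∈ level m ∧ NonVertex m β := by
  rw [divc_apply] at h
  obtain ⟨j, -, h⟩ := Finset.exists_ne_zero_of_sum_ne_zero h
  obtain ⟨h1, h2, -, -⟩ := hc.1 _ _ _ h
  refine ⟨add_e_mem_level.1 h1, fun a => ?_⟩
  have := h2 a
  rw [add_e_apply] at this
  omega

theorem sh_single (j : Fin 4) (β : Fin 4 → ℕ) (r : ℝ) :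
    sh j (Pi.single (β + e j) r) = Pi.single β r := by
  ext γ
  simp [sh_apply, Pi.single_apply]

theorem coef_eq_sum_single {m : ℕ} {s : Coef} (hs : ∀ β, s β ≠ 0 → β ∈ level m) :
    s = ∑ β ∈ level m, s β • (Pi.single β 1 : Coef) := by
  ext γ
  rw [Finset.sum_apply]
  simp only [Pi.smul_apply, Pi.single_apply, smul_eq_mul, mul_ite, mul_one, mul_zero,
    Finset.sum_ite_eq]
  split_ifs with h
  · rfl
  · by_contra h0; exact h (hs γ h0)

/-- Surjectivity of the divergence for the coefficients. -/
theorem exists_divc_eq {n : ℕ} (hn : 2 ≤ n) (q : Fin 4 → Coef) (A : ℝ)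
    (hsupp : ∀ i β, q i β ≠ 0 → β ∈ level (n + 1) ∧ NonVertex (n + 1) β)
    (hQ : ∀ i, ∑ β ∈ level (n + 1), q i β = A)
    (hM : ∑ i, ∑ β ∈ level (n + 1), q i β * β i = (n + 1) * A) :
    ∃ c ∈ divCoef (n + 1), ∃ s : Coef, ∀ i, q i = divc c i + s := by
  -- All attainable right-hand sides: divergences plus arrays with equal rows. The classes of unit
  -- masses modulo R satisfy the hypotheses of `affine_of_layer`.
  let R : Submodule ℝ (Fin 4 → Coef) :=
    (divCoef (n + 1)).map divc ⊔ LinearMap.range (LinearMap.pi fun _ => LinearMap.id)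
  let φ : Fin 4 → (Fin 4 → ℕ) → ((Fin 4 → Coef) ⧸ R) := fun i β =>
    R.mkQ (Pi.single i (Pi.single β 1))
  have hmove : ∀ i, ∀ ε ∈ level n, ∀ j l, j ≠ i → l ≠ i → ε j < n → ε l < n →
      φ i (ε + e j) = φ i (ε + e l) := by
    intro i ε hε j l hji hli hj hl
    by_cases hjl : j = l
    · rw [hjl]
    simp only [φ]
    rw [← sub_eq_zero, ← map_sub, Submodule.mkQ_apply, Submodule.Quotient.mk_eq_zero]
    refine Submodule.mem_sup_left ?_
    let γ := ε + e j + e l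
    -- Opposite unit entries at γ = ε + e_j + e_l in columns l and j have zero row sum; their shifts
    -- are unit masses at ε + e_j and ε + e_l.
    refine ⟨Pi.single i (Pi.single l (Pi.single γ 1) - Pi.single j (Pi.single γ 1)),
      ⟨fun i' j' γ' h => ?_, fun i' γ' => ?_⟩, ?_⟩
    · have hi : i' = i := by
        by_contra hi; exact h (by simp [hi])
      subst hi
      have hγ : γ' = γ := by
        by_contra hγ
        refine h ?_
        simp only [Pi.single_eq_same, Pi.sub_apply, Pi.single_apply]
        split_ifs <;> simp [hγ]
      subst hγ
      have hj' : j' = j ∨ j' = l := by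
        by_contra! hj'
        exact h (by simp [hj'.1, hj'.2])
      refine ⟨add_e_mem_level.2 (add_e_mem_level.2 hε), fun a => ?_, ?_, ?_⟩
      · have := le_of_mem_level hε a
        simp only [γ, add_e_apply]
        split_ifs with h1 h2 h2 <;> subst_vars <;> omega
      · rcases hj' with rfl | rfl <;> simp [γ]
      · rcases hj' with rfl | rfl <;> exact Ne.symm ‹_›
    · by_cases hi : i' = i
      · subst hi
        simp only [Pi.single_eq_same, Pi.sub_apply, Finset.sum_sub_distrib]
        have : ∀ l : Fin 4, ∑ x, (Pi.single l (Pi.single γ 1) : Fin 4 → Coef) x γ'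
            = (Pi.single γ 1 : Coef) γ' := fun l => by
          rw [Finset.sum_eq_single l]
          · simp
          · intro b _ hb; simp [hb]
          · simp
        rw [this, this, sub_self]
      · simp [hi]
    · funext i'
      by_cases hi : i' = i
      · subst hi
        have : ∀ l : Fin 4, ∑ x, sh x ((Pi.single l (Pi.single γ 1) : Fin 4 → Coef) x)
            = sh l (Pi.single γ 1) := fun l => by
          rw [Finset.sum_eq_single l]
          · simp
          · intro b _ hb; simp [hb]
          · simp
        simp only [divc, LinearMap.coe_mk, AddHom.coe_mk, Pi.single_eq_same, Pi.sub_apply, map_sub,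
          Finset.sum_sub_distrib, this]
        rw [sh_single]
        simp only [γ, add_right_comm ε (e j) (e l)]
        rw [sh_single]
      · simp [divc, hi]
  have hsum : ∀ β ∈ level (n + 1), NonVertex (n + 1) β → ∑ i, φ i β = 0 := by
    intro β _ _
    simp only [φ, ← map_sum]
    rw [Submodule.mkQ_apply, Submodule.Quotient.mk_eq_zero]
    refine Submodule.mem_sup_right ⟨Pi.single β 1, ?_⟩
    exact (Finset.univ_sum_single fun _ => (Pi.single β 1 : Coef)).symm
  obtain ⟨d, c, h1, h2⟩ := affine_of_layer hn φ hmove hsum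
  have hq : q = ∑ i, ∑ β ∈ level (n + 1), q i β • (Pi.single i (Pi.single β 1) : Fin 4 → Coef) := by
    have : ∀ i, ∑ β ∈ level (n + 1), q i β • (Pi.single i (Pi.single β 1) : Fin 4 → Coef)
        = Pi.single i (q i) := by
      intro i
      conv_rhs => rw [coef_eq_sum_single fun β h => (hsupp i β h).1]
      rw [← LinearMap.single_apply ℝ, map_sum]
      simp only [map_smul, LinearMap.single_apply]
    simp only [this, Finset.univ_sum_single]
  have hz : R.mkQ q = 0 := by
    rw [hq]
    simp only [map_sum, map_smul]
    have : ∀ i, ∀ β ∈ level (n + 1), q i β • R.mkQ (Pi.single i (Pi.single β 1))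
        = q i β • d i + (q i β * β i) • c := by
      intro i β hβ
      by_cases h0 : q i β = 0
      · simp [h0]
      · change q i β • φ i β = _
        rw [h1 i β hβ (hsupp i β h0).2, smul_add, smul_smul]
    rw [Finset.sum_congr rfl fun i _ => Finset.sum_congr rfl (this i)]
    simp only [Finset.sum_add_distrib, ← Finset.sum_smul, hQ, hM, ← Finset.smul_sum]
    -- The class of q is A (∑ d_i + (n + 1) c), which is zero by the second relation from
    -- `affine_of_layer`.
    rw [mul_comm, ← smul_smul, ← smul_add, h2, smul_zero]
  rw [Submodule.mkQ_apply, Submodule.Quotient.mk_eq_zero, Submodule.mem_sup] at hz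
  obtain ⟨_, ⟨c, hc, rfl⟩, _, ⟨s, rfl⟩, hqs⟩ := hz
  refine ⟨c, hc, s, fun i => ?_⟩
  rw [← hqs]
  rfl

theorem eps_ne_zero {i a b d : Fin 4} (h : Four i a b d) : eps b d i ≠ 0 := by
  obtain ⟨h1, h2, h3, h4, h5, h6⟩ := h
  revert i a b d; decide

/-- The coefficients with vanishing slice sums are generated by rectangles. -/
theorem exists_divc_curlc_eq {n : ℕ} (hn : 2 ≤ n) (s : Coef)
    (hsupp : ∀ β, s β ≠ 0 → β ∈ level (n + 1) ∧ NonVertex (n + 1) β)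
    (hs : ∀ (V : Type) [AddCommGroup V] [Module ℝ V] (i : Fin 4) (φ : ℕ → V),
      ∑ β ∈ level (n + 1), s β • φ (β i) = 0) :
    ∃ S ∈ curlCoef (n + 1), ∀ i, divc (curlc S) i = s := by
  -- Row 0 stands for all rows, since the divergence of a curl does not depend on the row.
  let R : Submodule ℝ Coef :=
    (curlCoef (n + 1)).map (LinearMap.proj 0 ∘ₗ divc ∘ₗ curlc)
  let G : (Fin 4 → ℕ) → (Coef ⧸ R) := fun β => R.mkQ (Pi.single β 1)
  have hrect : ∀ δ i j l p, Four i j l p → δ + e l + e p ∈ level (n + 1) →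
      G (δ + e i + e l) - G (δ + e j + e l) = G (δ + e i + e p) - G (δ + e j + e p) := by
    intro δ i j l p hf hδ
    simp only [G]
    rw [← sub_eq_zero, ← map_sub, ← map_sub, ← map_sub, Submodule.mkQ_apply,
      Submodule.Quotient.mk_eq_zero]
    let γ := δ + e i + e j + e l + e p
    have hγl : γ ∈ level (n + 1 + 2) := by
      rw [mem_level] at *
      simp only [γ, sum_add_e] at *
      omega
    have hγp : ∀ a, γ a ≠ 0 := by
      rw [hf.forall_iff]
      refine ⟨?_, ?_, ?_, ?_⟩ <;> simp [γ]
    -- A symmetric off-diagonal unit entry at the interior index γ. Interiority makes the face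
    -- condition of `curlCoef` void, so off-diagonal entries are allowed.
    let S : Coef4 := fun a b => if (a = i ∧ b = j) ∨ (a = j ∧ b = i) then Pi.single γ 1 else 0
    have hS : S ∈ curlCoef (n + 1) := by
      refine ⟨fun a b => ?_, fun a b γ' h => ?_⟩
      · simp only [S]
        congr 1
        rw [eq_iff_iff]
        tauto
      · have hγ : γ' = γ := by
          by_contra hγ
          refine h ?_
          simp only [S]
          split_ifs <;> simp [hγ]
        subst hγ
        refine ⟨hγl, fun a => ?_, fun a h0 => absurd h0 (hγp a)⟩
        have h1 := hγp i
        have h2 := hγp j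
        have h3 := hγp l
        have h4 := hγp p
        rw [mem_level_four hf] at hγl
        revert a
        rw [hf.forall_iff]
        omega
    have key : divc (curlc S) 0 = -(eps i l j : ℝ) •
        ((Pi.single (δ + e i + e l) 1 - Pi.single (δ + e j + e l) 1 -
          (Pi.single (δ + e i + e p) 1 - Pi.single (δ + e j + e p) 1) : Coef)) := by
      have hij : i ≠ j := hf.ix
      ext β
      rw [divc_curlc]
      have hpair : ∀ T : Fin 4 → Fin 4 → ℝ, (∀ a b, ¬((a = i ∧ b = j) ∨ (a = j ∧ b = i)) →
          T a b = 0) → ∑ a, ∑ b, T a b = T i j + T j i := by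
        intro T hT
        rw [Fintype.sum_eq_add i j hij fun a ha => Finset.sum_eq_zero fun b _ => hT a b (by tauto),
          Fintype.sum_eq_single j fun b hb => hT i b (by tauto),
          Fintype.sum_eq_single i fun b hb => hT j b (by tauto)]
      have hcomm : ∀ a, ∑ c, ∑ b, (eps a c b : ℝ) * S a b (β + e a + e c)
          = ∑ b, ∑ c, (eps a c b : ℝ) * S a b (β + e a + e c) := fun a => Finset.sum_comm
      simp only [hcomm]
      rw [hpair _ fun a b hab => Finset.sum_eq_zero fun c _ => by simp [S, hab]]
      have hsh : ∀ β' v : Fin 4 → ℕ, γ = β' + v →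
          (Pi.single γ (1 : ℝ) : Coef) (β + v) = (Pi.single β' 1 : Coef) β := by
        rintro β' v h
        rw [h]
        simp [Pi.single_apply]
      have e1 : S i j = Pi.single γ 1 := by simp [S]
      have e2 : S j i = Pi.single γ 1 := by simp [S]
      have z1 : eps i i j = 0 := by have := eps_swap_left i i j; omega
      have z2 : eps i j j = 0 := by have := eps_swap_right i j j; omega
      -- In ∑ eps over the first slot only the indices l and p contribute, so these two are
      -- opposite; this supplies the alternating signs of the rectangle.
      have z3 : eps i p j = -eps i l j := by
        have := sum_eps i j
        rw [hf.sum_eq] at this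
        have h3 := eps_swap_left i l j
        have h4 := eps_swap_left i p j
        have h5 := eps_swap_left i j j
        omega
      have z4 : ∀ c, eps j c i = -eps i c j := fun c => eps_swap_outer i c j
      simp only [e1, e2, z4, add_assoc β]
      rw [hf.sum_eq, hf.sum_eq, z1, z2, z3, hsh (δ + e j + e p) (e i + e l) (by simp only [γ]; abel),
        hsh (δ + e j + e l) (e i + e p) (by simp only [γ]; abel),
        hsh (δ + e i + e p) (e j + e l) (by simp only [γ]; abel),
        hsh (δ + e i + e l) (e j + e p) (by simp only [γ]; abel)]
      simp only [Pi.smul_apply, Pi.sub_apply, smul_eq_mul]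
      push_cast
      ring
    have heps : (eps i l j : ℝ) ≠ 0 := by
      have := eps_ne_zero (i := j) (a := p) (b := i) (d := l)
        ⟨hf.xz, hf.ix.symm, hf.xy, hf.iz.symm, hf.yz.symm, hf.iy⟩
      exact_mod_cast this
    refine ⟨-(eps i l j : ℝ)⁻¹ • S, Submodule.smul_mem _ _ hS, ?_⟩
    rw [map_smul]
    simp only [LinearMap.comp_apply, LinearMap.proj_apply]
    rw [key, smul_smul]
    simp [heps]
  obtain ⟨φ, hφ⟩ := sum_of_rectangles hn G hrect
  have hz : R.mkQ s = 0 := by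
    rw [coef_eq_sum_single fun β h => (hsupp β h).1]
    simp only [map_sum, map_smul]
    have : ∀ β ∈ level (n + 1), s β • R.mkQ (Pi.single β 1) = ∑ i, s β • φ i (β i) := by
      intro β hβ
      by_cases h0 : s β = 0
      · simp [h0]
      · change s β • G β = _
        rw [hφ β hβ (hsupp β h0).2, Finset.smul_sum]
    rw [Finset.sum_congr rfl this, Finset.sum_comm]
    exact Finset.sum_eq_zero fun i _ => hs _ i (φ i)
  rw [Submodule.mkQ_apply, Submodule.Quotient.mk_eq_zero] at hz
  obtain ⟨S, hS, rfl⟩ := hz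
  refine ⟨S, hS, fun i => ?_⟩
  ext β
  simp only [LinearMap.comp_apply, LinearMap.proj_apply, divc_curlc]

theorem exists_orientation (i : Fin 4) :
    ∃ x y z, Four i x y z ∧ eps x y i = 1 ∧ eps y z i = 1 ∧ eps z x i = 1 := by
  have : ∃ x y z, (i ≠ x ∧ i ≠ y ∧ i ≠ z ∧ x ≠ y ∧ x ≠ z ∧ y ≠ z) ∧
      eps x y i = 1 ∧ eps y z i = 1 ∧ eps z x i = 1 := by revert i; decide
  obtain ⟨x, y, z, ⟨h1, h2, h3, h4, h5, h6⟩, h⟩ := this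
  exact ⟨x, y, z, ⟨h1, h2, h3, h4, h5, h6⟩, h⟩

/-- A row without divergence has a stream function. -/
theorem exists_row_stream {m : ℕ} {c : Coef4} (hc : c ∈ divCoef m) {i : Fin 4}
    (hdiv : ∀ β, divc c i β = 0) :
    ∃ ψ : Coef, (∀ γ, ψ γ ≠ 0 → γ ∈ level (m + 2) ∧ ∀ a, a ≠ i → γ a ≠ 0) ∧
      ∀ l γ, c i l γ = ∑ a, (eps l a i : ℝ) * ψ (γ + e a) := by
  obtain ⟨hsupp, hrow⟩ := hc
  obtain ⟨x, y, z, hf, exy, eyz, ezx⟩ := exists_orientation i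
  have hci : ∀ γ, c i i γ = 0 := fun γ => by
    by_contra h; exact (hsupp _ _ _ h).2.2.2 rfl
  have hc0 : ∀ j γ, γ j = 0 → c i j γ = 0 := fun j γ h0 => by
    by_contra h; exact (hsupp _ _ _ h).2.2.1 h0
  -- For fixed h = γ_i the row lives on a triangle. Zero row sum, vanishing on the edges and zero
  -- divergence are the hypotheses of the stream lemma.
  have hstream := fun h => exists_stream
    (fun a b d => c i x (mk4 i x y z h a b d)) (fun a b d => c i y (mk4 i x y z h a b d))
    (fun a b d => c i z (mk4 i x y z h a b d))
    (fun a b d => by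
      have := hrow i (mk4 i x y z h a b d)
      rw [hf.sum_eq, hci] at this
      linarith)
    (fun b d => hc0 _ _ (mk4_x hf _ _ _ _)) (fun b d => hc0 _ _ (mk4_y hf _ _ _ _))
    (fun b d => hc0 _ _ (mk4_z hf _ _ _ _))
    (fun a b d => by
      have := hdiv (mk4 i x y z h a b d)
      rw [divc_apply, hf.sum_eq, hci, mk4_add_x, mk4_add_y, mk4_add_z] at this
      linarith)
  choose ψ hx hy hz h1 h2 h3 using hstream
  classical
  -- The stream functions of all layers are assembled and cut off to the level required by
  -- `curlCoef`.
  let Ψ : Coef := fun γ => if γ ∈ level (m + 2) then ψ (γ i) (γ x) (γ y) (γ z) else 0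
  have eyx : eps y x i = -1 := by rw [eps_swap_left, exy]
  have ezy : eps z y i = -1 := by rw [eps_swap_left, eyz]
  have exz : eps x z i = -1 := by rw [eps_swap_left, ezx]
  have e0 : ∀ a, eps a a i = 0 := fun a => by have := eps_swap_left a a i; omega
  have e1 : ∀ a, eps a i i = 0 := fun a => by have := eps_swap_right a i i; omega
  have e2 : ∀ a, eps i a i = 0 := fun a => by have := eps_swap_outer i a i; omega
  refine ⟨Ψ, fun γ h => ?_, fun l γ => ?_⟩
  · have hl : γ ∈ level (m + 2) := by
      by_contra hl; exact h (if_neg hl)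
    refine ⟨hl, ?_⟩
    simp only [Ψ, if_pos hl] at h
    rw [hf.forall_iff]
    refine ⟨fun h => absurd rfl h, fun _ h0 => ?_, fun _ h0 => ?_, fun _ h0 => ?_⟩
    · rw [h0] at h; exact h (hx _ _ _)
    · rw [h0] at h; exact h (hy _ _ _)
    · rw [h0] at h; exact h (hz _ _ _)
  · by_cases hl : γ ∈ level (m + 1)
    · have hΨ : ∀ a, Ψ (γ + e a) = ψ ((γ + e a) i) ((γ + e a) x) ((γ + e a) y) ((γ + e a) z) :=
        fun a => if_pos (add_e_mem_level.2 hl)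
      simp only [hΨ]
      rw [hf.sum_eq]
      simp only [add_e_self, add_e_of_ne _ hf.ix, add_e_of_ne _ hf.iy, add_e_of_ne _ hf.iz,
        add_e_of_ne _ hf.xy, add_e_of_ne _ hf.xz, add_e_of_ne _ hf.yz,
        add_e_of_ne _ hf.ix.symm, add_e_of_ne _ hf.iy.symm, add_e_of_ne _ hf.iz.symm,
        add_e_of_ne _ hf.xy.symm, add_e_of_ne _ hf.xz.symm, add_e_of_ne _ hf.yz.symm]
      have g1 := h1 (γ i) (γ x) (γ y) (γ z)
      have g2 := h2 (γ i) (γ x) (γ y) (γ z)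
      have g3 := h3 (γ i) (γ x) (γ y) (γ z)
      simp only [← eq_mk4 hf] at g1 g2 g3
      revert l
      rw [hf.forall_iff, hci, g1, g2, g3, exy, exz, eyx, eyz, ezx, ezy]
      simp only [e0, e1, e2]
      push_cast
      refine ⟨by ring, by ring, by ring, by ring⟩
    · have hΨ : ∀ a, Ψ (γ + e a) = 0 := fun a => if_neg fun h => hl (add_e_mem_level.1 h)
      simp only [hΨ, mul_zero, Finset.sum_const_zero]
      by_contra h
      exact hl (hsupp _ _ _ h).1

/-- The row streams ψ_i form a diagonal array: the off-diagonal part of `curlc` disappears and the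
subtracted ψ_l carries the factor eps l a l = 0. What needs an argument is that ψ_i inherits the
removal of the corners. -/
theorem exists_curlc_eq_of_divc_eq_zero {m : ℕ} {c : Coef4} (hc : c ∈ divCoef m)
    (hdiv : ∀ i β, divc c i β = 0) : ∃ S ∈ curlCoef m, curlc S = c := by
  choose ψ hψ hcψ using fun i => exists_row_stream hc (hdiv i)
  have hnv : ∀ i γ, ψ i γ ≠ 0 → NonVertex m γ := by
    intro i γ h
    obtain ⟨hl, h0⟩ := hψ i γ h
    intro a
    by_contra! ha
    have hai : a ≠ i := by
      rintro rfl
      obtain ⟨x, y, z, hf⟩ := exists_four a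
      have h1 := h0 x hf.ix.symm
      have h2 := h0 y hf.iy.symm
      have h3 := h0 z hf.iz.symm
      rw [mem_level_four hf] at hl
      omega
    obtain ⟨b, d, hf⟩ := exists_four_of_ne hai.symm
    have h2 := h0 b hf.iy.symm
    have h3 := h0 d hf.iz.symm
    -- The only dangerous index is m e_a + e_b + e_d. At m e_a + e_b, where c_ib vanishes, the
    -- stream formula reduces to a nonzero multiple of ψ_i at the dangerous index, since the other
    -- candidate has d-th entry zero.
    have hb : γ d = 1 := by rw [mem_level_four hf] at hl; omega
    obtain ⟨γ, rfl⟩ := exists_sub_e h3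
    rw [add_e_self] at hb
    rw [add_e_of_ne _ hf.xz] at ha
    have hz : c i b γ = 0 := by
      by_contra hne
      have := (hc.1 _ _ _ hne).2.1 a
      omega
    have hz2 : ψ i (γ + e a) = 0 := by
      by_contra hne
      refine (hψ i _ hne).2 d hf.iz.symm ?_
      rw [add_e_of_ne _ hf.xz.symm]
      omega
    rw [hcψ, hf.sum_eq, hz2] at hz
    have e0 : eps b b i = 0 := by have := eps_swap_left b b i; omega
    have e1 : eps b i i = 0 := by have := eps_swap_right b i i; omega
    have e2 : (eps b d i : ℝ) ≠ 0 := by exact_mod_cast eps_ne_zero hf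
    rw [e0, e1] at hz
    simp only [Int.cast_zero, zero_mul, mul_zero, zero_add] at hz
    exact (mul_ne_zero e2 h) hz
  refine ⟨fun i j => if i = j then ψ i else 0, ⟨fun i j => ?_, fun i j γ h => ?_⟩, ?_⟩
  · by_cases hij : i = j
    · subst hij; rfl
    · simp [hij, Ne.symm hij]
  · by_cases hij : i = j
    · subst hij
      simp only [if_true] at h
      obtain ⟨h1, h2⟩ := hψ i γ h
      refine ⟨h1, hnv i γ h, fun a ha => ?_⟩
      by_contra hne
      exact h2 a (fun h => hne ⟨h.symm, h.symm⟩) ha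
    · simp [hij] at h
  · funext i l γ
    rw [curlc_apply, hcψ]
    refine Finset.sum_congr rfl fun a _ => ?_
    simp only [mul_sub, Finset.sum_sub_distrib]
    have e1 : eps l a l = 0 := by have := eps_swap_outer l a l; omega
    rw [Finset.sum_eq_single i, Finset.sum_eq_single l]
    · simp [e1]
    · intro b _ hb; simp [Ne.symm hb]
    · simp
    · intro b _ hb; simp [Ne.symm hb]
    · simp

/-- Exactness at the bubble space of the divergence for the coefficients. -/
theorem exists_curlc_eq {n : ℕ} (hn : 2 ≤ n) {c : Coef4} (hc : c ∈ divCoef (n + 1))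
    (hdiv : ∀ i, divc c i = divc c 0) : ∃ S ∈ curlCoef (n + 1), curlc S = c := by
  -- The common value is the divergence of every row, so it annihilates functions of each of the
  -- four entries.
  obtain ⟨S, hS, hSc⟩ := exists_divc_curlc_eq hn (divc c 0) (fun β => divc_support hc 0)
    (fun V _ _ i φ => by rw [← hdiv i]; exact sum_divc_smul hc i φ)
  obtain ⟨T, hT, hTc⟩ := exists_curlc_eq_of_divc_eq_zero
    (Submodule.sub_mem _ hc (curlc_mem_divCoef hS)) (fun i β => by
      rw [map_sub, Pi.sub_apply, hSc, hdiv i, sub_self]; rfl)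
  exact ⟨S + T, Submodule.add_mem _ hS hT, by rw [map_add, hTc]; abel⟩

/-! ### Matrix fields in barycentric frames -/

/-- The matrix field `∑ p_{ij} ∇λ_i x_jᵀ`, where `p_{ij}` has Bernstein coefficients `c_{ij}`. -/
def theta (K : Tetrahedron) (m : ℕ) : Coef4 →ₗ[ℝ] MatPoly where
  toFun c := Matrix.of fun a b => ∑ i, ∑ j, (gv K i a * K j b) • bern K m (c i j)
  map_add' c d := by
    ext1 a b
    simp only [Pi.add_apply, map_add, smul_add, Finset.sum_add_distrib, Matrix.of_apply,
      Matrix.add_apply]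
  map_smul' r c := by
    ext1 a b
    simp only [Pi.smul_apply, map_smul, smul_comm _ r, ← Finset.smul_sum, Matrix.of_apply,
      Matrix.smul_apply, RingHom.id_apply]

theorem theta_apply (K : Tetrahedron) (m : ℕ) (c : Coef4) (a b : Fin 3) :
    theta K m c a b = ∑ i, ∑ j, (gv K i a * K j b) • bern K m (c i j) := rfl

/-- The matrix field `∑ p_{ij} ∇λ_i ∇λ_jᵀ`, where `p_{ij}` has Bernstein coefficients `S_{ij}`. -/
def xi (K : Tetrahedron) (m : ℕ) : Coef4 →ₗ[ℝ] MatPoly where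
  toFun S := Matrix.of fun a b => ∑ i, ∑ j, (gv K i a * gv K j b) • bern K m (S i j)
  map_add' c d := by
    ext1 a b
    simp only [Pi.add_apply, map_add, smul_add, Finset.sum_add_distrib, Matrix.of_apply,
      Matrix.add_apply]
  map_smul' r c := by
    ext1 a b
    simp only [Pi.smul_apply, map_smul, smul_comm _ r, ← Finset.smul_sum, Matrix.of_apply,
      Matrix.smul_apply, RingHom.id_apply]

theorem xi_apply (K : Tetrahedron) (m : ℕ) (S : Coef4) (a b : Fin 3) :
    xi K m S a b = ∑ i, ∑ j, (gv K i a * gv K j b) • bern K m (S i j) := rfl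

theorem hess_bern (K : Tetrahedron) (m : ℕ) (u : Coef) :
    hess (bern K (m + 2) u) = xi K m fun i j => sh i (sh j u) := by
  ext1 a b
  rw [xi_apply]
  change pderiv a (pderiv b (bern K (m + 1 + 1) u)) = _
  rw [pderiv_bern, map_sum, Finset.sum_comm]
  refine Finset.sum_congr rfl fun j _ => ?_
  rw [Derivation.map_smul, pderiv_bern, Finset.smul_sum]
  refine Finset.sum_congr rfl fun i _ => ?_
  rw [smul_smul, mul_comm]

/-- Row by row, the curl yields the cross products ∇λ_c × ∇λ_j, expanded by `cross_gv`. The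
subtracted term in `curlc` does not depend on i and is invisible because ∑ ∇λ_i = 0. -/
theorem curl_xi (K : Tetrahedron) (m : ℕ) (S : Coef4) :
    curl (xi K (m + 1) S) = gdet K • theta K m (curlc S) := by
  ext1 a b
  rw [Matrix.smul_apply, theta_apply]
  change pderiv (b + 1) (xi K (m + 1) S a (b + 2)) - pderiv (b + 2) (xi K (m + 1) S a (b + 1)) = _
  simp only [xi_apply, map_sum, Derivation.map_smul, pderiv_bern, ← Finset.sum_sub_distrib]
  have hL : ∀ i j, (gv K i a * gv K j (b + 2)) • ∑ c, gv K c (b + 1) • bern K m (sh c (S i j)) -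
      (gv K i a * gv K j (b + 1)) • ∑ c, gv K c (b + 2) • bern K m (sh c (S i j))
      = ∑ l, ∑ c, (gdet K * (gv K i a * K l b) * eps l c j) • bern K m (sh c (S i j)) := by
    intro i j
    rw [Finset.sum_comm, Finset.smul_sum, Finset.smul_sum, ← Finset.sum_sub_distrib]
    refine Finset.sum_congr rfl fun c _ => ?_
    rw [smul_smul, smul_smul, ← sub_smul, ← Finset.sum_smul]
    congr 1
    have := cross_gv K c j b
    rw [show ∑ l, gdet K * (gv K i a * K l b) * (eps l c j : ℝ)
      = gv K i a * (gdet K * ∑ l, (eps l c j : ℝ) * K l b) by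
        simp only [Finset.mul_sum]; exact Finset.sum_congr rfl fun l _ => by ring, ← this]
    ring
  have hR : ∀ i l, (gv K i a * K l b) • bern K m (curlc S i l)
      = (∑ j, ∑ c, ((gv K i a * K l b) * eps l c j) • bern K m (sh c (S i j)))
        - gv K i a • (K l b • ∑ c, ∑ j, (eps l c j : ℝ) • bern K m (sh c (S l j))) := by
    intro i l
    have : curlc S i l = ∑ c, ∑ j, (eps l c j : ℝ) • (sh c (S i j) - sh c (S l j)) := rfl
    rw [this, smul_smul]
    simp only [map_sum, map_smul, map_sub, smul_sub, Finset.sum_sub_distrib, Finset.smul_sum,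
      smul_smul]
    congr 1
    rw [Finset.sum_comm]
  simp only [hL, hR]
  simp only [Finset.sum_sub_distrib, ← Finset.sum_smul, ← Finset.smul_sum, sum_gv, zero_smul,
    sub_zero]
  simp only [Finset.smul_sum, smul_smul]
  refine Finset.sum_congr rfl fun i _ => ?_
  rw [Finset.sum_comm]
  simp only [mul_assoc]

/-- By ∇λ_l · x_j = δ_lj - λ_l(0) the derivative acts on column j as the shift by e_j, up to a term
without j that the zero row sums remove. -/
theorem div_theta (K : Tetrahedron) (m : ℕ) (c : Coef4) (h : ∀ i γ, ∑ j, c i j γ = 0) (a : Fin 3) :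
    div (theta K (m + 1) c) a = ∑ i, gv K i a • bern K m (divc c i) := by
  change ∑ b : Fin 3, pderiv b (theta K (m + 1) c a b) = _
  simp only [theta_apply, map_sum, Derivation.map_smul, pderiv_bern, Finset.smul_sum, smul_smul]
  rw [Finset.sum_comm]
  refine Finset.sum_congr rfl fun i _ => ?_
  rw [Finset.sum_comm]
  have h1 : ∀ j, ∑ b : Fin 3, ∑ l, (gv K i a * K j b * gv K l b) • bern K m (sh l (c i j))
      = gv K i a • bern K m (sh j (c i j))
        - ∑ l, (gv K i a * K.coord l 0) • bern K m (sh l (c i j)) := by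
    intro j
    rw [Finset.sum_comm]
    have h2 : ∀ l, ∑ b : Fin 3, (gv K i a * K j b * gv K l b) • bern K m (sh l (c i j))
        = (gv K i a * ((if l = j then 1 else 0) - K.coord l 0)) • bern K m (sh l (c i j)) := by
      intro l
      rw [← Finset.sum_smul, ← sum_gv_mul_vertex, Finset.mul_sum]
      congr 1
      exact Finset.sum_congr rfl fun b _ => by ring
    simp only [h2, mul_sub, sub_smul, Finset.sum_sub_distrib]
    congr 1
    simp
  simp only [h1, Finset.sum_sub_distrib]
  have h3 : ∑ j, ∑ l, (gv K i a * K.coord l 0) • bern K m (sh l (c i j)) = 0 := by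
    rw [Finset.sum_comm]
    refine Finset.sum_eq_zero fun l _ => ?_
    rw [← Finset.smul_sum, ← map_sum, ← map_sum]
    have : ∑ j, c i j = 0 := by ext γ; simp [h]
    rw [this]; simp
  rw [h3, sub_zero, ← Finset.smul_sum, ← map_sum]
  rfl

/-! ### Multiplication and division by bubbles -/

theorem up_ne_zero {a : Fin 4} {c : Coef} {γ : Fin 4 → ℕ} (h : up a c γ ≠ 0) :
    ∃ β, γ = β + e a ∧ c β ≠ 0 := by
  have h0 : γ a ≠ 0 := fun h0 => h (up_of_eq_zero a c h0)
  obtain ⟨β, rfl⟩ := exists_sub_e h0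
  refine ⟨β, rfl, fun hc => h ?_⟩
  rw [up_add_e, hc, mul_zero]

/-- Division by `λ_a` in terms of Bernstein coefficients. -/
def down (a : Fin 4) (c : Coef) : Coef := fun β => ((β a : ℝ) + 1)⁻¹ * c (β + e a)

theorem down_ne_zero {a : Fin 4} {c : Coef} {β : Fin 4 → ℕ} (h : down a c β ≠ 0) :
    c (β + e a) ≠ 0 := fun hc => h (by rw [down, hc, mul_zero])

theorem bern_succ_eq (K : Tetrahedron) (m : ℕ) (a : Fin 4) (c : Coef)
    (h : ∀ γ, c γ ≠ 0 → γ a ≠ 0) :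
    bern K (m + 1) c = lam K a * bern K m (down a c) :=
  bern_succ_eq_lam_mul K m a c fun γ h0 => by by_contra hc; exact h γ hc h0

/-- Multiplication by `λ_x λ_y λ_z`. -/
theorem lam₃_mul_bern (K : Tetrahedron) (m : ℕ) (x y z : Fin 4) (c : Coef) :
    lam K x * lam K y * lam K z * bern K m c = bern K (m + 3) (up x (up y (up z c))) := by
  rw [mul_assoc, lam_mul_bern, mul_assoc, lam_mul_bern, lam_mul_bern]

theorem faceBubble_eq (K : Tetrahedron) {i x y z : Fin 4} (hf : Four i x y z) :
    faceBubble K i = lam K x * lam K y * lam K z := by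
  have : Finset.univ.erase i = {x, y, z} := by
    rw [hf.univ_eq, Finset.erase_insert]
    simp [hf.ix, hf.iy, hf.iz]
  rw [faceBubble, this, Finset.prod_insert, Finset.prod_pair hf.yz, mul_assoc]
  simp [hf.xy, hf.xz]

/-- Multiplication by the element bubble in terms of Bernstein coefficients. -/
def up4 (c : Coef) : Coef := up 0 (up 1 (up 2 (up 3 c)))

theorem eleBubble_mul_bern (K : Tetrahedron) (m : ℕ) (c : Coef) :
    eleBubble K * bern K m c = bern K (m + 4) (up4 c) := by
  rw [eleBubble, Fin.prod_univ_four, mul_assoc, lam_mul_bern, mul_assoc, lam_mul_bern, mul_assoc,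
    lam_mul_bern, lam_mul_bern, up4]

theorem up4_ne_zero {c : Coef} {γ : Fin 4 → ℕ} (h : up4 c γ ≠ 0) :
    ∃ β, γ = β + (fun _ => 1) ∧ c β ≠ 0 := by
  obtain ⟨γ, rfl, h1⟩ := up_ne_zero h
  obtain ⟨γ, rfl, h2⟩ := up_ne_zero h1
  obtain ⟨γ, rfl, h3⟩ := up_ne_zero h2
  obtain ⟨γ, rfl, h4⟩ := up_ne_zero h3
  refine ⟨γ, ?_, h4⟩
  ext a
  fin_cases a <;> simp

/-- Division by the element bubble in terms of Bernstein coefficients. -/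
def down4 (c : Coef) : Coef := down 3 (down 2 (down 1 (down 0 c)))

theorem down4_ne_zero {c : Coef} {β : Fin 4 → ℕ} (h : down4 c β ≠ 0) :
    c (β + (fun _ => 1)) ≠ 0 := by
  have := down_ne_zero (down_ne_zero (down_ne_zero (down_ne_zero h)))
  convert this using 2
  ext a
  fin_cases a <;> simp

theorem bern_eq_eleBubble_mul (K : Tetrahedron) (m : ℕ) (c : Coef)
    (h : ∀ γ, c γ ≠ 0 → ∀ a, γ a ≠ 0) :
    bern K (m + 4) c = eleBubble K * bern K m (down4 c) := by
  rw [bern_succ_eq K (m + 3) 0 c fun γ hγ => h γ hγ 0,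
    bern_succ_eq K (m + 2) 1, bern_succ_eq K (m + 1) 2, bern_succ_eq K m 3, eleBubble,
    Fin.prod_univ_four, down4]
  · ring
  · intro γ hγ
    have := h _ (down_ne_zero (down_ne_zero (down_ne_zero hγ))) 3
    simpa using this
  · intro γ hγ
    have := h _ (down_ne_zero (down_ne_zero hγ)) 2
    simpa using this
  · intro γ hγ
    have := h _ (down_ne_zero hγ) 1
    simpa using this

/-! ### The bubble spaces in terms of Bernstein coefficients -/

theorem mem_bubbleH2_iff (K : Tetrahedron) (q : ℕ) (u : Poly) :
    u ∈ bubbleH2 K (q + 6) ↔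
      ∃ c : Coef, (∀ γ, c γ ≠ 0 → ∀ a, 2 ≤ γ a) ∧ u = bern K (q + 8) c := by
  constructor
  · rintro ⟨p, hp, rfl⟩
    obtain ⟨d, -, rfl⟩ := exists_bern K hp
    refine ⟨up4 (up4 d), fun γ h a => ?_, ?_⟩
    · obtain ⟨γ, rfl, h1⟩ := up4_ne_zero h
      obtain ⟨γ, rfl, -⟩ := up4_ne_zero h1
      simp
    · rw [LinearMap.mulLeft_apply, pow_two, mul_assoc]
      exact (congrArg _ (eleBubble_mul_bern K q d)).trans (eleBubble_mul_bern K (q + 4) _)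
  · rintro ⟨c, hc, rfl⟩
    refine ⟨bern K q (down4 (down4 c)), bern_mem_polyDeg K q _, ?_⟩
    rw [LinearMap.mulLeft_apply, pow_two, mul_assoc, ← bern_eq_eleBubble_mul,
      ← bern_eq_eleBubble_mul K (q + 4)]
    · intro γ h a
      have := hc γ h a
      omega
    · intro γ h a
      have := hc _ (down4_ne_zero h) a
      simp only [Pi.add_apply] at this
      omega

/-- Coefficients of a polynomial vanishing at a vertex. -/
theorem bern_vertex_coef {K : Tetrahedron} {m : ℕ} {c : Coef} {a : Fin 4}
    (h : evalAt (K a) (bern K m c) = 0) : c (Pi.single a m) = 0 := by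
  rw [evalAt_bern_vertex] at h
  have hf : (Nat.factorial m : ℝ)⁻¹ ≠ 0 := by positivity
  exact (mul_eq_zero.1 h).resolve_right hf

theorem sum_ite_pair {M : Type*} [AddCommGroup M] [Module ℝ M] (f : Fin 4 → Fin 4 → ℝ) (g : Coef →ₗ[ℝ] M)
    (i j : Fin 4) (F : Coef) :
    ∑ i', ∑ j', f i' j' • g ((Pi.single i (Pi.single j F) : Coef4) i' j') = f i j • g F := by
  rw [Fintype.sum_eq_single i, Fintype.sum_eq_single j]
  · simp
  · intro b hb; simp [hb]
  · intro b hb; simp [hb]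

theorem theta_single (K : Tetrahedron) (m : ℕ) (i j : Fin 4) (F : Coef) (a b : Fin 3) :
    theta K m (Pi.single i (Pi.single j F)) a b = (gv K i a * K j b) • bern K m F := by
  rw [theta_apply]
  exact sum_ite_pair (fun i j => gv K i a * K j b) (bern K m) i j F

theorem xi_single (K : Tetrahedron) (m : ℕ) (i j : Fin 4) (F : Coef) (a b : Fin 3) :
    xi K m (Pi.single i (Pi.single j F)) a b = (gv K i a * gv K j b) • bern K m F := by
  rw [xi_apply]
  exact sum_ite_pair (fun i j => gv K i a * gv K j b) (bern K m) i j F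

/-- A generator becomes two opposite entries, in columns l and j. Vanishing of p at x_j and x_l
keeps every entry of its indices below q + 4; at the other positions the factor λ_j λ_l already does
so. -/
theorem bubbleDivT_le (K : Tetrahedron) (n : Fin 4 → E3) (hn : ∀ i, IsUnitFaceNormal K i (n i))
    (t : Fin 4 → Fin 4 → E3) (ht : ∀ j l, j < l → IsUnitEdgeTangent K j l (t j l)) (q : ℕ) :
    bubbleDivT K n t (q + 5) ≤ (divCoef (q + 4)).map (theta K (q + 5)) := by
  refine Submodule.span_le.2 ?_
  rintro v ⟨i, j, l, hjl, hji, hli, p, ⟨hp, hv⟩, rfl⟩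
  obtain ⟨ν, -, hν⟩ := unitFaceNormal_eq K (hn i)
  obtain ⟨τ, -, hτ⟩ := unitEdgeTangent_eq K (ht j l hjl)
  obtain ⟨d, hd, rfl⟩ := exists_bern K hp
  have hvj := bern_vertex_coef (hv j (by simp))
  have hvl := bern_vertex_coef (hv l (by simp))
  change d (Pi.single j (q + 3)) = 0 at hvj
  change d (Pi.single l (q + 3)) = 0 at hvl
  have hne : j ≠ l := hjl.ne
  set F : Coef := up j (up l d) with hF
  have hFs : ∀ γ, F γ ≠ 0 → γ ∈ level (q + 5) ∧ NonVertex (q + 4) γ ∧ γ j ≠ 0 ∧ γ l ≠ 0 := by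
    intro γ hγ
    obtain ⟨γ, rfl, hγ1⟩ := up_ne_zero hγ
    obtain ⟨γ, rfl, h⟩ := up_ne_zero hγ1
    have hl : γ ∈ level (q + 3) := by
      by_contra hl; exact h (hd γ hl)
    refine ⟨add_e_mem_level.2 (add_e_mem_level.2 hl), fun a => ?_, by simp, by simp⟩
    have h1 := le_of_mem_level hl a
    have h2 : a = j ∨ a = l → γ a < q + 3 := by
      intro ha
      by_contra! h3
      rw [eq_single_of_le hl h3] at h
      rcases ha with rfl | rfl
      · exact h hvj
      · exact h hvl
    simp only [add_e_apply]
    split_ifs with h3 h4 h4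
    · exact absurd (h4.symm.trans h3) hne
    · have := h2 (Or.inr h3); omega
    · have := h2 (Or.inl h4); omega
    · omega
  refine ⟨(ν * τ) • (Pi.single i (Pi.single l F) - Pi.single i (Pi.single j F)),
    Submodule.smul_mem _ _ ⟨fun i' j' γ h => ?_, fun i' γ => ?_⟩, ?_⟩
  · have hi : i' = i := by
      by_contra hi; exact h (by simp [hi])
    subst hi
    have hFγ : F γ ≠ 0 := by
      intro h0
      refine h ?_
      simp only [Pi.sub_apply, Pi.single_eq_same, Pi.single_apply]
      split_ifs <;> simp [h0]
    obtain ⟨h1, h2, h3, h4⟩ := hFs γ hFγ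
    have hj' : j' = j ∨ j' = l := by
      by_contra! hj'
      exact h (by simp [hj'.1, hj'.2])
    refine ⟨h1, h2, ?_, ?_⟩
    · rcases hj' with rfl | rfl <;> assumption
    · rcases hj' with rfl | rfl <;> exact Ne.symm ‹_›
  · have : ∀ l : Fin 4, ∑ x, (Pi.single i (Pi.single l F) : Coef4) i' x γ
        = (Pi.single i (F γ) : Fin 4 → ℝ) i' := fun l => by
      rw [Fintype.sum_eq_single l]
      · by_cases hi : i' = i
        · subst hi; simp
        · simp [hi]
      · intro b hb
        by_cases hi : i' = i
        · subst hi; simp [hb]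
        · simp [hi]
    simp only [Pi.sub_apply, Finset.sum_sub_distrib, this, sub_self]
  · rw [map_smul, map_sub]
    ext1 a b
    simp only [Matrix.smul_apply, Matrix.sub_apply, theta_single, outer, Matrix.of_apply]
    have : lam K j * lam K l * bern K (q + 5 - 2) d = bern K (q + 5) F := by
      rw [mul_assoc, lam_mul_bern, lam_mul_bern]; rfl
    rw [this, hν, hτ, smul_eq_mul, mul_comm (bern K _ _), ← MvPolynomial.smul_eq_C_mul, ← sub_smul,
      smul_smul]
    congr 1
    ring

theorem edge_mem_bubbleDivT (K : Tetrahedron) (n : Fin 4 → E3)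
    (hn : ∀ i, IsUnitFaceNormal K i (n i)) (t : Fin 4 → Fin 4 → E3)
    (ht : ∀ j l, j < l → IsUnitEdgeTangent K j l (t j l)) (q : ℕ) {i j l : Fin 4}
    (hij : i ≠ j) (hil : i ≠ l) {γ : Fin 4 → ℕ} (hγ : γ ∈ level (q + 5))
    (hv : NonVertex (q + 4) γ) (hj : γ j ≠ 0) (hl : γ l ≠ 0) :
    (Matrix.of fun a b => (gv K i a * (K l b - K j b)) • dp K γ : MatPoly)
      ∈ bubbleDivT K n t (q + 5) := by
  wlog hjl : j < l generalizing j l with H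
  · rcases (not_lt.1 hjl).eq_or_lt with rfl | hlt
    · convert Submodule.zero_mem (bubbleDivT K n t (q + 5)) using 1
      ext1 a b
      simp
    · convert Submodule.neg_mem _ (H hil hij hl hj hlt) using 1
      ext1 a b
      rw [Matrix.neg_apply, Matrix.of_apply, Matrix.of_apply, ← neg_smul]
      congr 1
      ring
  obtain ⟨ν, hν0, hν⟩ := unitFaceNormal_eq K (hn i)
  obtain ⟨τ, hτ0, hτ⟩ := unitEdgeTangent_eq K (ht j l hjl)
  obtain ⟨γ, rfl⟩ := exists_sub_e hj
  rw [add_e_of_ne _ hjl.ne'] at hl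
  obtain ⟨γ, rfl⟩ := exists_sub_e hl
  have hγ' : γ ∈ level (q + 3) := add_e_mem_level.1 (add_e_mem_level.1 hγ)
  have hmul : lam K j * lam K l * dp K γ
      = (((γ j : ℝ) + 1) * ((γ l : ℝ) + 1)) • dp K (γ + e l + e j) := by
    rw [mul_assoc, lam_mul_dp, mul_smul_comm, lam_mul_dp, smul_smul, add_e_of_ne _ hjl.ne, mul_comm]
  have h0 : ((γ j : ℝ) + 1) * ((γ l : ℝ) + 1) ≠ 0 := by positivity
  have hgen : (lam K j * lam K l * dp K γ) • outer (n i) (t j l) ∈ bubbleDivT K n t (q + 5) := by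
    refine Submodule.subset_span ⟨i, j, l, hjl, hij.symm, hil.symm, dp K γ,
      ⟨dp_mem_polyDeg K hγ', fun a ha => evalAt_dp_vertex K γ a ?_⟩, rfl⟩
    by_contra! h
    have h1 : γ a = q + 3 := by
      rw [mem_level, Finset.sum_eq_single a (fun b _ hb => h b hb) (by simp)] at hγ'
      exact hγ'
    have h2 := hv a
    simp only [add_e_apply] at h2
    rcases ha with rfl | rfl <;> simp at h2 <;> omega
  convert Submodule.smul_mem _ ((ν * τ * (((γ j : ℝ) + 1) * ((γ l : ℝ) + 1)))⁻¹) hgen using 1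
  ext1 a b
  rw [hmul, Matrix.smul_apply, Matrix.smul_apply, outer, Matrix.of_apply, Matrix.of_apply, hν, hτ,
    smul_eq_mul, mul_comm _ (C _), ← MvPolynomial.smul_eq_C_mul, smul_smul, smul_smul]
  congr 1
  field_simp

/-- At a fixed index and row, the zero row sum lets each vertex x_j be replaced by x_j - x_p for one
column p in the support. The field is thus a combination of edge tangents. -/
theorem theta_mem_bubbleDivT (K : Tetrahedron) (n : Fin 4 → E3)
    (hn : ∀ i, IsUnitFaceNormal K i (n i)) (t : Fin 4 → Fin 4 → E3)
    (ht : ∀ j l, j < l → IsUnitEdgeTangent K j l (t j l)) (q : ℕ) {c : Coef4}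
    (hc : c ∈ divCoef (q + 4)) : theta K (q + 5) c ∈ bubbleDivT K n t (q + 5) := by
  have hsum : theta K (q + 5) c = ∑ γ ∈ level (q + 5), ∑ i,
      (Matrix.of fun a b => (gv K i a * ∑ j, c i j γ * K j b) • dp K γ : MatPoly) := by
    ext1 a b
    simp only [theta_apply, Matrix.sum_apply, Matrix.of_apply, bern_apply, Finset.smul_sum,
      Finset.mul_sum, Finset.sum_smul, smul_smul]
    conv_rhs => rw [Finset.sum_comm]
    refine Finset.sum_congr rfl fun i _ => Finset.sum_comm.trans ?_
    refine Finset.sum_congr rfl fun γ _ => Finset.sum_congr rfl fun j _ => ?_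
    congr 1
    ring
  rw [hsum]
  refine Submodule.sum_mem _ fun γ hγ => Submodule.sum_mem _ fun i _ => ?_
  by_cases h : ∃ p, c i p γ ≠ 0
  · obtain ⟨p, hp⟩ := h
    obtain ⟨-, hv, hp0, hip⟩ := hc.1 _ _ _ hp
    have : (Matrix.of fun a b => (gv K i a * ∑ j, c i j γ * K j b) • dp K γ : MatPoly)
        = ∑ j, c i j γ • Matrix.of fun a b => (gv K i a * (K j b - K p b)) • dp K γ := by
      ext1 a b
      simp only [Matrix.sum_apply, Matrix.smul_apply, Matrix.of_apply, smul_smul, ← Finset.sum_smul]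
      congr 1
      have := hc.2 i γ
      have h2 : ∑ j, c i j γ * (gv K i a * (K j b - K p b))
          = gv K i a * ∑ j, c i j γ * K j b - (∑ j, c i j γ) * (gv K i a * K p b) := by
        rw [Finset.mul_sum, Finset.sum_mul, ← Finset.sum_sub_distrib]
        exact Finset.sum_congr rfl fun j _ => by ring
      rw [h2, this, zero_mul, sub_zero]
    rw [this]
    refine Submodule.sum_mem _ fun j _ => ?_
    by_cases hj : c i j γ = 0
    · rw [hj, zero_smul]; exact Submodule.zero_mem _
    · obtain ⟨-, -, hj0, hij⟩ := hc.1 _ _ _ hj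
      exact Submodule.smul_mem _ _ (edge_mem_bubbleDivT K n hn t ht q hip hij hγ hv hp0 hj0)
  · push Not at h
    convert Submodule.zero_mem (bubbleDivT K n t (q + 5)) using 1
    ext1 a b
    simp [h]

theorem outer_normal_apply {K : Tetrahedron} {i : Fin 4} {n : E3} {ν : ℝ}
    (hν : ∀ a, n a = ν * gv K i a) (p : Poly) (a b : Fin 3) :
    (p • outer n n) a b = (ν ^ 2 * (gv K i a * gv K i b)) • p := by
  rw [Matrix.smul_apply, outer, Matrix.of_apply, hν, hν, smul_eq_mul, mul_comm,
    ← MvPolynomial.smul_eq_C_mul]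
  congr 1
  ring

theorem mat_eq_sum_gv (K : Tetrahedron) (τ : MatPoly) (a b : Fin 3) : τ a b =
    ∑ i, ∑ j, (gv K i a * gv K j b) • ∑ a', ∑ b', (K i a' * K j b') • τ a' b' := by
  have h1 := vec_eq_sum_gv K (fun a => τ a b) a
  rw [h1]
  refine Finset.sum_congr rfl fun i _ => ?_
  have h2 : ∀ a', K i a' • τ a' b
      = ∑ j, (K i a' * gv K j b) • ∑ b', K j b' • τ a' b' := fun a' => by
    have h3 := vec_eq_sum_gv K (fun b => τ a' b) b
    simp only at h3
    conv_lhs => rw [h3]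
    simp only [Finset.smul_sum, smul_smul, mul_assoc]
  rw [Finset.sum_congr rfl fun a' _ => h2 a', Finset.sum_comm, Finset.smul_sum]
  refine Finset.sum_congr rfl fun j _ => ?_
  rw [Finset.smul_sum, Finset.smul_sum]
  refine Finset.sum_congr rfl fun a' _ => ?_
  rw [Finset.smul_sum, Finset.smul_sum, Finset.smul_sum]
  refine Finset.sum_congr rfl fun b' _ => ?_
  rw [smul_smul, smul_smul, smul_smul]
  congr 1
  ring

/-- Normal parts go to the diagonal, where p = 0 at the vertices keeps the indices away from the
corners. The interior part is expanded as τ = ∑ (x_iᵀ τ x_j) ∇λ_i ∇λ_jᵀ. -/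
theorem bubbleCurlS_le (K : Tetrahedron) (n : Fin 4 → E3) (hn : ∀ i, IsUnitFaceNormal K i (n i))
    (q : ℕ) : bubbleCurlS K n (q + 6) ≤ (curlCoef (q + 4)).map (xi K (q + 6)) := by
  refine sup_le (Submodule.span_le.2 ?_) (Submodule.span_le.2 ?_)
  · rintro σ ⟨i, p, ⟨hp, hv⟩, rfl⟩
    obtain ⟨ν, -, hν⟩ := unitFaceNormal_eq K (hn i)
    obtain ⟨x, y, z, hf⟩ := exists_four i
    obtain ⟨d, hd, rfl⟩ := exists_bern K hp
    have hv0 : ∀ a, d (Pi.single a (q + 3)) = 0 := fun a =>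
      bern_vertex_coef (hv a (Set.mem_univ a))
    set F : Coef := up x (up y (up z d)) with hF
    refine ⟨ν ^ 2 • Pi.single i (Pi.single i F), Submodule.smul_mem _ _
      ⟨fun i' j' => ?_, fun i' j' γ h => ?_⟩, ?_⟩
    · by_cases hi : i' = i
      · by_cases hj : j' = i
        · rw [hi, hj]
        · subst hi; simp [hj]
      · by_cases hj : j' = i
        · subst hj; simp [hi]
        · simp [hi, hj]
    · have hi : i' = i := by
        by_contra hi; exact h (by simp [hi])
      subst hi
      have hj : j' = i' := by
        by_contra hj; exact h (by simp [hj])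
      subst hj
      simp only [Pi.single_eq_same] at h
      obtain ⟨γ, rfl, h1⟩ := up_ne_zero h
      obtain ⟨γ, rfl, h2⟩ := up_ne_zero h1
      obtain ⟨γ, rfl, h3⟩ := up_ne_zero h2
      have hl : γ ∈ level (q + 3) := by
        by_contra hl; exact h3 (hd γ hl)
      have hnv : ∀ a, γ a < q + 3 := by
        intro a
        by_contra! ha
        rw [eq_single_of_le hl ha] at h3
        exact h3 (hv0 a)
      refine ⟨add_e_mem_level.2 (add_e_mem_level.2 (add_e_mem_level.2 hl)), ?_, ?_⟩
      · intro a
        have := hnv a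
        simp only [add_e_apply]
        have hxy := hf.xy
        have hxz := hf.xz
        have hyz := hf.yz
        split_ifs <;> omega
      · rw [hf.forall_iff]
        refine ⟨fun _ => ⟨rfl, rfl⟩, fun h0 => ?_, fun h0 => ?_, fun h0 => ?_⟩ <;> simp at h0
    · rw [map_smul]
      ext1 a b
      rw [Matrix.smul_apply, xi_single, outer_normal_apply hν, smul_smul]
      congr 1
      rw [faceBubble_eq K hf]
      exact (lam₃_mul_bern K (q + 3) x y z d).symm
  · rintro σ ⟨τ, ⟨hsym, hdeg⟩, rfl⟩
    -- Coefficients are chosen as a function of the polynomial, so equal entries of τ receive equal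
    -- coefficients and the array is symmetric.
    have hE : ∀ p : Poly, ∃ c : Coef, p ∈ polyDeg (q + 2) →
        (∀ γ, γ ∉ level (q + 2) → c γ = 0) ∧ bern K (q + 2) c = p := by
      intro p
      by_cases hp : p ∈ polyDeg (q + 2)
      · obtain ⟨c, hc⟩ := exists_bern K hp
        exact ⟨c, fun _ => hc⟩
      · exact ⟨0, fun h => absurd h hp⟩
    choose E hE using hE
    let T : Fin 4 → Fin 4 → Coef := fun i j => ∑ a, ∑ b, (K i a * K j b) • E (τ a b)
    have hTsym : ∀ i j, T i j = T j i := by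
      intro i j
      simp only [T]
      rw [Finset.sum_comm]
      refine Finset.sum_congr rfl fun b _ => Finset.sum_congr rfl fun a _ => ?_
      rw [hsym.apply b a, mul_comm]
    have hTl : ∀ i j γ, γ ∉ level (q + 2) → T i j γ = 0 := by
      intro i j γ hγ
      simp only [T, Finset.sum_apply, Pi.smul_apply]
      exact Finset.sum_eq_zero fun a _ => Finset.sum_eq_zero fun b _ => by
        rw [(hE _ (hdeg a b)).1 γ hγ, smul_zero]
    refine ⟨fun i j => up4 (T i j), ⟨fun i j => by simp only [hTsym i j], fun i j γ h => ?_⟩, ?_⟩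
    · obtain ⟨γ, rfl, h1⟩ := up4_ne_zero h
      have hl : γ ∈ level (q + 2) := by
        by_contra hl; exact h1 (hTl i j γ hl)
      refine ⟨?_, fun a => ?_, fun a h0 => ?_⟩
      · rw [mem_level] at *
        simp [Finset.sum_add_distrib, hl]
      · have := le_of_mem_level hl a
        simp only [Pi.add_apply]
        omega
      · simp at h0
    · ext1 a b
      rw [xi_apply, Matrix.smul_apply]
      have h0 : ∀ i j, bern K (q + 2) (T i j) = ∑ a, ∑ b, (K i a * K j b) • τ a b := by
        intro i j
        simp only [T, map_sum, map_smul]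
        exact Finset.sum_congr rfl fun a _ => Finset.sum_congr rfl fun b _ => by
          rw [(hE _ (hdeg a b)).2]
      have h1 : ∀ i j, bern K (q + 6) (up4 (T i j))
          = eleBubble K * ∑ a, ∑ b, (K i a * K j b) • τ a b := fun i j =>
        (eleBubble_mul_bern K (q + 2) (T i j)).symm.trans (by rw [h0])
      rw [mat_eq_sum_gv K τ a b, smul_eq_mul, Finset.mul_sum]
      refine Finset.sum_congr rfl fun i _ => ?_
      rw [Finset.mul_sum]
      exact Finset.sum_congr rfl fun j _ => by rw [h1, mul_smul_comm]

/-- An index with a zero entry at i can only carry the (i, i) coefficient, which gives the face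
terms F; all other coefficients are divisible by the element bubble. -/
theorem xi_mem_bubbleCurlS (K : Tetrahedron) (n : Fin 4 → E3)
    (hn : ∀ i, IsUnitFaceNormal K i (n i)) (q : ℕ) {S : Coef4} (hS : S ∈ curlCoef (q + 4)) :
    xi K (q + 6) S ∈ bubbleCurlS K n (q + 6) := by
  classical
  obtain ⟨hsym, hsupp⟩ := hS
  let F : Fin 4 → Coef := fun i γ => if γ i = 0 then S i i γ else 0
  let T : Coef4 := fun i j γ => if ∃ a, γ a = 0 then 0 else S i j γ
  have hST : S = T + ∑ i, Pi.single i (Pi.single i (F i)) := by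
    funext i j γ
    have h1 : (∑ i, Pi.single i (Pi.single i (F i)) : Coef4) i j γ
        = if i = j then F i γ else 0 := by
      rw [Finset.sum_apply, Finset.sum_apply, Finset.sum_apply, Fintype.sum_eq_single i]
      · by_cases hij : i = j
        · subst hij; simp
        · simp [hij, Ne.symm hij]
      · intro b hb; simp [Ne.symm hb]
    rw [Pi.add_apply, Pi.add_apply, Pi.add_apply, h1]
    by_cases h0 : S i j γ = 0
    · by_cases hij : i = j
      · subst hij; simp [T, F, h0]
      · simp [T, h0, hij]
    · obtain ⟨-, -, h3⟩ := hsupp _ _ _ h0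
      by_cases ha : ∃ a, γ a = 0
      · obtain ⟨a, ha⟩ := ha
        obtain ⟨rfl, rfl⟩ := h3 a ha
        have : ∃ a, γ a = 0 := ⟨_, ha⟩
        simp [T, F, this, ha]
      · have hi : γ i ≠ 0 := fun h => ha ⟨i, h⟩
        simp only [T, F, if_neg ha, if_neg hi, ite_self, add_zero]
  rw [hST, map_add, map_sum]
  refine Submodule.add_mem _ (Submodule.mem_sup_right ?_)
    (Submodule.sum_mem _ fun i _ => Submodule.mem_sup_left ?_)
  · refine Submodule.subset_span ⟨xi K (q + 2) fun i j => down4 (T i j), ⟨?_, fun a b => ?_⟩, ?_⟩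
    · refine Matrix.IsSymm.ext fun a b => ?_
      rw [xi_apply, xi_apply, Finset.sum_comm]
      refine Finset.sum_congr rfl fun i _ => Finset.sum_congr rfl fun j _ => ?_
      have : T j i = T i j := by simp only [T, hsym i j]
      rw [this, mul_comm]
    · rw [xi_apply]
      exact Submodule.sum_mem _ fun i _ => Submodule.sum_mem _ fun j _ =>
        Submodule.smul_mem _ _ (bern_mem_polyDeg K _ _)
    · ext1 a b
      rw [Matrix.smul_apply, xi_apply, xi_apply, smul_eq_mul, Finset.mul_sum]
      refine Finset.sum_congr rfl fun i _ => ?_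
      rw [Finset.mul_sum]
      refine Finset.sum_congr rfl fun j _ => ?_
      rw [mul_smul_comm, ← bern_eq_eleBubble_mul K (q + 2)]
      intro γ h a h0
      exact h (if_pos ⟨a, h0⟩)
  · obtain ⟨ν, hν0, hν⟩ := unitFaceNormal_eq K (hn i)
    obtain ⟨x, y, z, hf⟩ := exists_four i
    have hF : ∀ γ, F i γ ≠ 0 → γ i = 0 ∧ NonVertex (q + 4) γ ∧ ∀ a, a ≠ i → γ a ≠ 0 := by
      intro γ h
      have h0 : γ i = 0 := by
        by_contra h0; exact h (if_neg h0)
      simp only [F, if_pos h0] at h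
      obtain ⟨-, h2, h3⟩ := hsupp _ _ _ h
      exact ⟨h0, h2, fun a ha h0 => ha (h3 a h0).1.symm⟩
    have hb : bern K (q + 6) (F i)
        = faceBubble K i * bern K (q + 3) (down z (down y (down x (F i)))) := by
      rw [faceBubble_eq K hf, bern_succ_eq K (q + 5) x, bern_succ_eq K (q + 4) y,
        bern_succ_eq K (q + 3) z]
      · ring
      · intro γ h
        have := (hF _ (down_ne_zero (down_ne_zero h))).2.2 z hf.iz.symm
        rwa [add_e_of_ne _ hf.xz.symm, add_e_of_ne _ hf.yz.symm] at this
      · intro γ h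
        have := (hF _ (down_ne_zero h)).2.2 y hf.iy.symm
        rwa [add_e_of_ne _ hf.xy.symm] at this
      · exact fun γ h => (hF _ h).2.2 x hf.ix.symm
    have hmem : (faceBubble K i * bern K (q + 3) (down z (down y (down x (F i))))) •
        outer (n i) (n i) ∈ Submodule.span ℝ
      {σ | ∃ i : Fin 4, ∃ p ∈ polyZero K (q + 6 - 3),
        σ = (faceBubble K i * p) • outer (n i) (n i)} := by
      refine Submodule.subset_span ⟨i, _, ⟨bern_mem_polyDeg K _ _, fun a _ => ?_⟩, rfl⟩
      rw [evalAt_bern_vertex]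
      by_contra h
      obtain ⟨h1, h2, -⟩ := hF _ (down_ne_zero (down_ne_zero (down_ne_zero
        (left_ne_zero_of_mul h))))
      rw [add_e_of_ne _ hf.ix, add_e_of_ne _ hf.iy, add_e_of_ne _ hf.iz] at h1
      have hai : a ≠ i := by
        rintro rfl; simp at h1
      have h3 := h2 a
      simp only [add_e_apply, Pi.single_eq_same] at h3
      have hcases : ∀ a, a ≠ i → a = x ∨ a = y ∨ a = z := by
        rw [hf.forall_iff]; simp
      rcases hcases a hai with rfl | rfl | rfl <;> simp at h3 <;> omega
    convert Submodule.smul_mem _ ((ν ^ 2)⁻¹) hmem using 1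
    ext1 a b
    rw [Matrix.smul_apply, outer_normal_apply hν, xi_single, ← hb, smul_smul]
    congr 1
    field_simp

/-! ### Integration over the tetrahedron -/

/-- The directional derivative of a polynomial. -/
def dirDeriv (v : Fin 3 → ℝ) (p : Poly) : Poly := ∑ b, v b • pderiv b p

theorem hasDerivAt_evalAt_line (y v : E3) (p : Poly) (s : ℝ) :
    HasDerivAt (fun s : ℝ => evalAt (y + s • v) p) (evalAt (y + s • v) (dirDeriv v p)) s := by
  induction p using MvPolynomial.induction_on with
  | C r => simpa [evalAt, dirDeriv] using hasDerivAt_const s r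
  | add p q hp hq =>
    have := hp.add hq
    simp only [evalAt, dirDeriv, map_add, smul_add, Finset.sum_add_distrib] at this ⊢
    exact this
  | mul_X p i hp =>
    have hX : HasDerivAt (fun s : ℝ => evalAt (y + s • v) (X i)) (v i) s := by
      have := ((hasDerivAt_id s).mul_const (v i)).const_add (y i)
      simpa [evalAt] using this
    have := hp.mul hX
    have h2 : evalAt (y + s • v) (dirDeriv v (p * X i)) =
        evalAt (y + s • v) (dirDeriv v p) * evalAt (y + s • v) (X i) +
          evalAt (y + s • v) p * v i := by
      have : dirDeriv v (p * X i) = dirDeriv v p * X i + v i • p := by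
        simp only [dirDeriv, Derivation.leibniz, smul_add, Finset.sum_add_distrib, pderiv_X,
          smul_eq_mul, Finset.sum_mul]
        rw [add_comm]
        congr 1
        · exact Finset.sum_congr rfl fun b _ => by rw [smul_mul_assoc, mul_comm]
        · rw [Finset.sum_eq_single i]
          · simp
          · intro b _ hb; simp [hb]
          · simp
      rw [this]
      simp only [evalAt, map_add, map_mul, MvPolynomial.smul_eval]
      ring
    have h3 : (fun s : ℝ => evalAt (y + s • v) (p * X i)) =
        (fun s : ℝ => evalAt (y + s • v) p) * fun s : ℝ => evalAt (y + s • v) (X i) := by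
      ext s; simp [evalAt]
    rw [h2, h3]
    exact this

theorem continuous_evalAt (p : Poly) : Continuous fun x : E3 => evalAt x p :=
  (MvPolynomial.continuous_eval p).comp (continuous_pi fun j => by fun_prop)

theorem mem_body_iff (K : Tetrahedron) (x : E3) : x ∈ body K ↔ ∀ i, 0 ≤ K.coord i x := by
  rw [body, AffineBasis.convexHull_eq_nonneg_coord]; rfl

theorem isCompact_body (K : Tetrahedron) : IsCompact (body K) :=
  (Set.finite_range _).isCompact_convexHull ℝ

/-- The integral of a polynomial over the tetrahedron. -/
def integ (K : Tetrahedron) : Poly →ₗ[ℝ] ℝ where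
  toFun p := ∫ x in body K, evalAt x p
  map_add' p q := by
    rw [← integral_add ((continuous_evalAt p).continuousOn.integrableOn_compact (isCompact_body K))
      ((continuous_evalAt q).continuousOn.integrableOn_compact (isCompact_body K))]
    simp [evalAt]
  map_smul' r p := by
    simp only [evalAt, MvPolynomial.smul_eval, integral_const_mul, RingHom.id_apply, smul_eq_mul]

theorem integ_apply (K : Tetrahedron) (p : Poly) : integ K p = ∫ x in body K, evalAt x p := rfl

theorem integ_one_ne_zero (K : Tetrahedron) : integ K 1 ≠ 0 := by
  have h1 : integ K 1 = (volume : Measure E3).real (body K) := by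
    simp [integ_apply, evalAt]
  rw [h1]
  have hint : (interior (body K)).Nonempty := ⟨_, K.centroid_mem_interior_convexHull⟩
  have hpos : 0 < volume (body K) :=
    (isOpen_interior.measure_pos volume hint).trans_le (measure_mono interior_subset)
  exact (ENNReal.toReal_pos hpos.ne' (isCompact_body K).measure_lt_top.ne).ne'

/-- Affine coordinates of space adapted to an edge. -/
def edgeMap (K : Tetrahedron) (j l p q : Fin 4) : ((ℝ × ℝ) × ℝ) →ₗ[ℝ] E3 :=
  ((LinearMap.fst ℝ ℝ ℝ ∘ₗ LinearMap.fst ℝ (ℝ × ℝ) ℝ).smulRight (K p - K j)) +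
  ((LinearMap.snd ℝ ℝ ℝ ∘ₗ LinearMap.fst ℝ (ℝ × ℝ) ℝ).smulRight (K q - K j)) +
  ((LinearMap.snd ℝ (ℝ × ℝ) ℝ).smulRight (K l - K j))

theorem edgeMap_apply (K : Tetrahedron) (j l p q : Fin 4) (w : (ℝ × ℝ) × ℝ) :
    edgeMap K j l p q w = w.1.1 • (K p - K j) + w.1.2 • (K q - K j) + w.2 • (K l - K j) := rfl

theorem coord_edgeMap (K : Tetrahedron) (i j l p q : Fin 4) (w : (ℝ × ℝ) × ℝ) :
    K.coord i (K j + edgeMap K j l p q w) = (if i = j then 1 else 0)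
      + w.1.1 * ((if i = p then 1 else 0) - (if i = j then 1 else 0))
      + w.1.2 * ((if i = q then 1 else 0) - (if i = j then 1 else 0))
      + w.2 * ((if i = l then 1 else 0) - (if i = j then 1 else 0)) := by
  have h := sum_gv_mul_vertex K i j
  rw [coord_eq, ← gv_dot_edge K, ← gv_dot_edge K, ← gv_dot_edge K, edgeMap_apply]
  simp only [PiLp.add_apply, PiLp.smul_apply, PiLp.sub_apply, smul_eq_mul, mul_add, mul_sub,
    Finset.sum_add_distrib, Finset.sum_sub_distrib, Finset.mul_sum, mul_left_comm (gv K i _)]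
  linarith

theorem edgeMap_injective (K : Tetrahedron) {j l p q : Fin 4} (hf : Four j l p q) :
    Function.Injective (edgeMap K j l p q) := by
  rw [← LinearMap.ker_eq_bot, LinearMap.ker_eq_bot']
  intro w hw
  have h : ∀ i, K.coord i (K j + edgeMap K j l p q w) = if i = j then 1 else 0 := fun i => by
    rw [hw, add_zero, AffineBasis.coord_apply]
  have hp := h p
  have hq := h q
  have hl := h l
  rw [coord_edgeMap] at hp hq hl
  simp [hf.ix.symm, hf.iy.symm, hf.iz.symm, hf.xy, hf.xz, hf.yz, hf.xy.symm, hf.xz.symm,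
    hf.yz.symm] at hp hq hl
  ext <;> assumption

/-- Fubini along lines parallel to the edge: each line meets K in a segment whose ends lie where λ_l
= 0 and λ_j = 0, so the boundary terms of the one-dimensional integral vanish. -/
theorem integ_dirDeriv_eq_zero (K : Tetrahedron) {j l : Fin 4} (hjl : j ≠ l) (h : Poly) :
    integ K (dirDeriv (fun b => K l b - K j b) (lam K j * lam K l * h)) = 0 := by
  classical
  obtain ⟨p, q, hf⟩ := exists_four_of_ne hjl
  let L : ((ℝ × ℝ) × ℝ) ≃L[ℝ] E3 := (LinearMap.linearEquivOfInjective (edgeMap K j l p q)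
    (edgeMap_injective K hf) (by simp)).toContinuousLinearEquiv
  have hL : ∀ w, L w = edgeMap K j l p q w := fun w => rfl
  set P : Poly := lam K j * lam K l * h with hP
  set f : E3 → ℝ := (body K).indicator
    fun x => evalAt x (dirDeriv (fun b => K l b - K j b) P) with hfdef
  have hmeas : MeasurableSet (body K) := (isCompact_body K).isClosed.measurableSet
  rw [integ_apply, ← integral_indicator hmeas, ← hfdef]
  rw [← integral_add_left_eq_self f (K j)]
  have hHaar : (volume : Measure ((ℝ × ℝ) × ℝ)).IsAddHaarMeasure := by
    rw [Measure.volume_eq_prod]; infer_instance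
  have hHaar' : (Measure.map L (volume : Measure ((ℝ × ℝ) × ℝ))).IsAddHaarMeasure :=
    L.isAddHaarMeasure_map _
  -- Uniqueness of Haar measure; the scaling factor is irrelevant because the integral is zero.
  have hvol := Measure.isAddLeftInvariant_eq_smul (volume : Measure E3)
    (Measure.map L (volume : Measure ((ℝ × ℝ) × ℝ)))
  rw [hvol, integral_smul_nnreal_measure]
  have hmap : ∫ x, f (K j + x) ∂(Measure.map L volume) = ∫ w, f (K j + L w) :=
    L.toHomeomorph.measurableEmbedding.integral_map _
  rw [hmap]
  suffices hz : ∫ w, f (K j + L w) = 0 by rw [hz, smul_zero]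
  -- Without integrability the integral is zero by convention, so no integrability proof is needed.
  by_cases hint : Integrable (fun w => f (K j + L w)) (volume : Measure ((ℝ × ℝ) × ℝ))
  swap
  · exact integral_undef hint
  rw [Measure.volume_eq_prod] at hint ⊢
  rw [integral_prod _ hint]
  refine integral_eq_zero_of_ae (Filter.Eventually.of_forall fun u => ?_)
  change ∫ s, f (K j + L (u, s)) = 0
  have hline : ∀ s : ℝ, K j + L (u, s) = (K j + L (u, 0)) + s • (K l - K j) := fun s => by
    rw [hL, hL, edgeMap_apply, edgeMap_apply]
    module
  set y : E3 := K j + L (u, 0) with hy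
  have hmem : ∀ s, K j + L (u, s) ∈ body K ↔
      (0 ≤ u.1 ∧ 0 ≤ u.2) ∧ s ∈ Set.Icc 0 (1 - u.1 - u.2) := by
    intro s
    rw [mem_body_iff, hf.forall_iff, hL, coord_edgeMap, coord_edgeMap, coord_edgeMap,
      coord_edgeMap]
    simp only [hf.ix, hf.iy, hf.iz, hf.ix.symm, hf.iy.symm, hf.iz.symm, hf.xy, hf.xz, hf.yz,
      hf.xy.symm, hf.xz.symm, hf.yz.symm, if_true, if_false, Set.mem_Icc]
    constructor
    · rintro ⟨h1, h2, h3, h4⟩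
      exact ⟨⟨by linarith, by linarith⟩, by linarith, by linarith⟩
    · rintro ⟨⟨h1, h2⟩, h3, h4⟩
      exact ⟨by linarith, by linarith, by linarith, by linarith⟩
  have hcl : ∀ s, K.coord l (K j + L (u, s)) = s := fun s => by
    rw [hL, coord_edgeMap]
    simp [hf.ix.symm, hf.xy, hf.xz]
  have hcj : ∀ s, K.coord j (K j + L (u, s)) = 1 - u.1 - u.2 - s := fun s => by
    rw [hL, coord_edgeMap]
    simp [hf.ix, hf.iy, hf.iz]
    ring
  have hind : ∀ s, f (K j + L (u, s)) = {s | (0 ≤ u.1 ∧ 0 ≤ u.2) ∧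
      s ∈ Set.Icc 0 (1 - u.1 - u.2)}.indicator
      (fun s => evalAt (y + s • (K l - K j)) (dirDeriv (K l - K j : E3) P)) s := by
    intro s
    rw [hfdef, Set.indicator_apply, Set.indicator_apply]
    simp only [hmem, Set.mem_ofPred_eq]
    split_ifs
    · rw [hline]; rfl
    · rfl
  simp only [hind]
  by_cases hu : (0 ≤ u.1 ∧ 0 ≤ u.2) ∧ 0 ≤ 1 - u.1 - u.2
  swap
  · have : {s : ℝ | (0 ≤ u.1 ∧ 0 ≤ u.2) ∧ s ∈ Set.Icc 0 (1 - u.1 - u.2)} = ∅ := by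
      ext s
      simp only [Set.mem_ofPred_eq, Set.mem_Icc, Set.mem_empty_iff_false, iff_false]
      rintro ⟨h1, h2, h3⟩
      exact hu ⟨h1, h2.trans h3⟩
    rw [this, Set.indicator_empty]
    simp
  · have hset : {s : ℝ | (0 ≤ u.1 ∧ 0 ≤ u.2) ∧ s ∈ Set.Icc 0 (1 - u.1 - u.2)}
        = Set.Icc 0 (1 - u.1 - u.2) := by
      ext s; simp [hu.1]
    rw [hset, integral_indicator measurableSet_Icc, integral_Icc_eq_integral_Ioc,
      ← intervalIntegral.integral_of_le hu.2]
    rw [intervalIntegral.integral_eq_sub_of_hasDerivAt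
      (f := fun s => evalAt (y + s • (K l - K j)) P)
      (fun s _ => hasDerivAt_evalAt_line y (K l - K j) P s)]
    · have h0 : ∀ s, evalAt (y + s • (K l - K j)) P
          = (1 - u.1 - u.2 - s) * s * evalAt (y + s • (K l - K j)) h := by
        intro s
        have h1 := evalAt_lam K j (y + s • (K l - K j))
        have h2 := evalAt_lam K l (y + s • (K l - K j))
        rw [← hline, hcj] at h1
        rw [← hline, hcl] at h2
        rw [← hline]
        rw [hP]
        simp only [evalAt, map_mul] at h1 h2 ⊢
        rw [h1, h2]
      rw [h0, h0]
      ring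
    · refine Continuous.intervalIntegrable ?_ _ _
      exact (continuous_evalAt _).comp (by fun_prop)

theorem dirDeriv_dp (K : Tetrahedron) (j l : Fin 4) (β : Fin 4 → ℕ) :
    dirDeriv (fun b => K l b - K j b) (dp K (β + e j + e l))
      = dp K (β + e j) - dp K (β + e l) := by
  simp only [dirDeriv, pderiv_dp, Finset.smul_sum]
  rw [Finset.sum_comm]
  have : ∀ a, ∑ b, (K l b - K j b) • (if (β + e j + e l) a = 0 then 0
      else gv K a b • dp K (β + e j + e l - e a))
      = ((if a = l then 1 else 0) - (if a = j then 1 else 0) : ℝ) •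
        (if (β + e j + e l) a = 0 then 0 else dp K (β + e j + e l - e a)) := by
    intro a
    rw [← gv_dot_edge, Finset.sum_smul]
    refine Finset.sum_congr rfl fun b _ => ?_
    split_ifs
    · simp
    · rw [smul_smul, mul_comm]
  rw [Finset.sum_congr rfl fun a _ => this a]
  simp only [sub_smul, Finset.sum_sub_distrib, ite_smul, one_smul, zero_smul,
    Finset.sum_ite_eq', Finset.mem_univ, if_true]
  rw [if_neg (by simp), if_neg (by simp), add_e_sub_e, add_right_comm, add_e_sub_e]

/-- The difference of the two divided powers is the edge derivative of `dp` at β + e_j + e_l, a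
multiple of λ_j λ_l. -/
theorem integ_dp_move (K : Tetrahedron) (j l : Fin 4) (β : Fin 4 → ℕ) :
    integ K (dp K (β + e j)) = integ K (dp K (β + e l)) := by
  by_cases hjl : j = l
  · rw [hjl]
  have h := integ_dirDeriv_eq_zero K hjl
    ((((β j : ℝ) + 1) * ((β l : ℝ) + 1))⁻¹ • dp K β)
  have hmul : lam K j * lam K l * dp K β
      = (((β j : ℝ) + 1) * ((β l : ℝ) + 1)) • dp K (β + e j + e l) := by
    rw [mul_assoc, lam_mul_dp, mul_smul_comm, lam_mul_dp, smul_smul, add_e_of_ne _ hjl, mul_comm,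
      add_right_comm]
  have h0 : ((β j : ℝ) + 1) * ((β l : ℝ) + 1) ≠ 0 := by positivity
  rw [mul_smul_comm, hmul, smul_smul, inv_mul_cancel₀ h0, one_smul, dirDeriv_dp K j l, map_sub] at h
  linarith

/-- The integral of the divided power monomials of order `m`. -/
def dpInteg (K : Tetrahedron) (m : ℕ) : ℝ := integ K (dp K (Pi.single 0 m))

theorem integ_dp (K : Tetrahedron) {m : ℕ} {γ : Fin 4 → ℕ} (hγ : γ ∈ level m) :
    integ K (dp K γ) = dpInteg K m := by
  cases m with
  | zero => rw [eq_single_of_le hγ (Nat.zero_le (γ 0)), dpInteg]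
  | succ m => exact level_const (fun γ => integ K (dp K γ)) (fun j l ε _ => integ_dp_move K j l ε) 0 hγ

theorem integ_bern (K : Tetrahedron) (m : ℕ) (c : Coef) :
    integ K (bern K m c) = dpInteg K m * ∑ γ ∈ level m, c γ := by
  rw [bern_apply, map_sum, Finset.mul_sum]
  refine Finset.sum_congr rfl fun γ hγ => ?_
  rw [map_smul, integ_dp K hγ, smul_eq_mul, mul_comm]

/-- Otherwise every polynomial of degree at most m, in particular 1, would have integral zero. -/
theorem dpInteg_ne_zero (K : Tetrahedron) (m : ℕ) : dpInteg K m ≠ 0 := by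
  intro h
  have h1 : (1 : Poly) ∈ polyDeg m := by
    rw [polyDeg, mem_restrictTotalDegree]; simp
  obtain ⟨c, -, hc⟩ := exists_bern K h1
  refine integ_one_ne_zero K ?_
  rw [← hc, integ_bern, h, zero_mul]

/-- Insert 1 = ∑ λ_a; the weights γ_a + 1 add up to m + 4. -/
theorem dpInteg_succ (K : Tetrahedron) (m : ℕ) :
    dpInteg K m = (m + 4) * dpInteg K (m + 1) := by
  have hs := single_mem_level m 0
  have h : dp K (Pi.single 0 m) = ∑ a, lam K a * dp K (Pi.single 0 m) := by
    rw [← Finset.sum_mul, sum_lam, one_mul]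
  rw [dpInteg, h, map_sum]
  have h2 : ∀ a, integ K (lam K a * dp K (Pi.single 0 m))
      = (((Pi.single 0 m : Fin 4 → ℕ) a : ℝ) + 1) * dpInteg K (m + 1) := fun a => by
    rw [lam_mul_dp, map_smul, integ_dp K (add_e_mem_level.2 hs), smul_eq_mul]
  simp only [h2]
  rw [← Finset.sum_mul, Finset.sum_add_distrib, ← Nat.cast_sum, mem_level.1 hs]
  simp

theorem integ_lam_mul_bern (K : Tetrahedron) (m : ℕ) (a : Fin 4) (c : Coef) :
    integ K (lam K a * bern K m c)
      = dpInteg K (m + 1) * (∑ β ∈ level m, c β * β a + ∑ β ∈ level m, c β) := by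
  rw [lam_mul_bern, integ_bern, sum_level_succ m a _ fun γ _ h => up_of_eq_zero a c h,
    ← Finset.sum_add_distrib]
  congr 1
  exact Finset.sum_congr rfl fun β _ => by rw [up_add_e]; ring

/-! ### Vector fields and orthogonality to RT -/

/-- The vector field `∑ p_i ∇λ_i`, where `p_i` has Bernstein coefficients `q_i`. -/
def vecBern (K : Tetrahedron) (m : ℕ) (q : Fin 4 → Coef) : VecPoly :=
  fun a => ∑ i, gv K i a • bern K m (q i)

theorem l2Inner_eq_integ (K : Tetrahedron) (q w : VecPoly) :
    l2Inner K q w = integ K (∑ a, q a * w a) := by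
  rw [integ_apply]
  simp only [l2Inner, evalAt, map_sum, map_mul]

/-- Uses ∇λ_i · (a + b x) = ∇λ_i · a + b (λ_i - λ_i(0)). -/
theorem l2Inner_vecBern (K : Tetrahedron) (m : ℕ) (q : Fin 4 → Coef) (a : E3) (b : ℝ) :
    l2Inner K (vecBern K m q) (fun j => C (a j) + C b * X j)
      = ∑ i, ((∑ j, gv K i j * a j - b * K.coord i 0) * (dpInteg K m * ∑ γ ∈ level m, q i γ)
        + b * (dpInteg K (m + 1) * (∑ β ∈ level m, q i β * β i + ∑ β ∈ level m, q i β))) := by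
  have h : ∑ j, vecBern K m q j * (C (a j) + C b * X j)
      = ∑ i, ((∑ j, gv K i j * a j - b * K.coord i 0) • bern K m (q i)
        + b • (lam K i * bern K m (q i))) := by
    simp only [vecBern, Finset.sum_mul]
    rw [Finset.sum_comm]
    refine Finset.sum_congr rfl fun i _ => ?_
    rw [lam_eq]
    simp only [MvPolynomial.smul_eq_C_mul, map_sub, map_sum, map_mul, Finset.sum_mul, add_mul,
      sub_mul, mul_add, Finset.mul_sum, Finset.sum_add_distrib]
    have e1 : ∀ x : Fin 3, C (gv K i x) * bern K m (q i) * (C b * X x)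
        = C b * (C (gv K i x) * X x * bern K m (q i)) := fun x => by ring
    have e2 : ∀ x : Fin 3, C (gv K i x) * bern K m (q i) * C (a x)
        = C (gv K i x) * C (a x) * bern K m (q i) := fun x => by ring
    simp only [e1, e2]
    ring
  rw [l2Inner_eq_integ, h, map_sum]
  refine Finset.sum_congr rfl fun i _ => ?_
  rw [map_add, map_smul, map_smul, integ_bern, integ_lam_mul_bern, smul_eq_mul, smul_eq_mul]

/-- Orthogonality to the lowest order Raviart--Thomas space in terms of Bernstein coefficients. -/
theorem orthogonal_RT_iff (K : Tetrahedron) (m : ℕ) (q : Fin 4 → Coef) :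
    (∀ w ∈ RT, l2Inner K (vecBern K m q) w = 0) ↔
      ∃ A : ℝ, (∀ i, ∑ β ∈ level m, q i β = A) ∧
        ∑ i, ∑ β ∈ level m, q i β * β i = m * A := by
  have hI := dpInteg_ne_zero K (m + 1)
  have hI0 := dpInteg_ne_zero K m
  have hrec := dpInteg_succ K m
  have hκ : ∑ i, K.coord i 0 = 1 := AffineBasis.sum_coord_apply_eq_one K 0
  constructor
  · intro h
    have hA : ∀ i, ∑ β ∈ level m, q i β = ∑ β ∈ level m, q 0 β := by
      intro j
      -- Testing with the constant x_j - x_0 compares the masses of rows j and 0.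
      have := h _ ⟨K j - K 0, 0, rfl⟩
      rw [l2Inner_vecBern] at this
      simp only [PiLp.sub_apply, gv_dot_edge, zero_mul, sub_zero, add_zero, sub_mul, ite_mul,
        one_mul, Finset.sum_sub_distrib, Finset.sum_ite_eq', Finset.mem_univ, if_true] at this
      rw [← mul_sub] at this
      have := (mul_eq_zero.1 this).resolve_left hI0
      linarith
    refine ⟨_, hA, ?_⟩
    -- Testing with x: the moment plus 4A equals (m + 4)A by the recursion for `dpInteg`.
    have := h _ ⟨0, 1, rfl⟩
    rw [l2Inner_vecBern] at this
    simp only [hA, PiLp.zero_apply, mul_zero, Finset.sum_const_zero, zero_sub, one_mul, neg_mul,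
      Finset.sum_add_distrib, Finset.sum_neg_distrib, ← Finset.sum_mul, hκ, ← Finset.mul_sum] at this
    rw [hrec] at this
    simp only [Finset.sum_const, Finset.card_univ, Fintype.card_fin, nsmul_eq_mul] at this
    push_cast at this
    have h2 : dpInteg K (m + 1) * (∑ i, ∑ β ∈ level m, q i β * β i
        - m * ∑ β ∈ level m, q 0 β) = 0 := by linarith
    have := (mul_eq_zero.1 h2).resolve_left hI
    linarith
  · rintro ⟨A, hA, hM⟩ w ⟨a, b, rfl⟩
    rw [l2Inner_vecBern]
    simp only [hA, sub_mul, Finset.sum_add_distrib, Finset.sum_sub_distrib, ← Finset.sum_mul,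
      ← Finset.mul_sum, hM, hκ]
    have h1 : ∑ i, ∑ j, gv K i j * a j = 0 := by
      rw [Finset.sum_comm]
      exact Finset.sum_eq_zero fun j _ => by rw [← Finset.sum_mul, sum_gv, zero_mul]
    rw [h1, hrec]
    simp only [Finset.sum_const, Finset.card_univ, Fintype.card_fin, nsmul_eq_mul]
    push_cast
    ring

theorem vecBern_congr (K : Tetrahedron) (m : ℕ) (q q' : Fin 4 → Coef)
    (h : ∀ i j, ∀ γ ∈ level m, q i γ - q' i γ = q j γ - q' j γ) :
    vecBern K m q = vecBern K m q' := by
  funext a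
  rw [vecBern, vecBern, ← sub_eq_zero, ← Finset.sum_sub_distrib]
  have : ∀ i, gv K i a • bern K m (q i) - gv K i a • bern K m (q' i)
      = gv K i a • bern K m (q 0 - q' 0) := fun i => by
    rw [← smul_sub, ← map_sub]
    congr 1
    exact bern_congr K fun γ hγ => h i 0 γ hγ
  simp only [this, ← Finset.sum_smul, sum_gv, zero_smul]

theorem coef_eq_of_vecBern_eq_zero (K : Tetrahedron) (m : ℕ) (q : Fin 4 → Coef)
    (h : vecBern K m q = 0) (i j : Fin 4) : ∀ γ ∈ level m, q i γ = q j γ := by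
  have h1 : bern K m (q i - q j) = 0 := by
    have h2 : ∑ a, (K i a - K j a) • vecBern K m q a = 0 := by simp [h]
    simp only [vecBern, Finset.smul_sum, smul_smul] at h2
    rw [Finset.sum_comm] at h2
    simp only [← Finset.sum_smul, mul_comm (K i _ - K j _), gv_dot_edge] at h2
    simpa [sub_smul, Finset.sum_sub_distrib] using h2
  intro γ hγ
  have := bern_eq_zero K m _ h1 γ hγ
  simpa [sub_eq_zero] using this

/-- Barycentric representation of the vector fields vanishing at the vertices. -/
theorem exists_vecBern (K : Tetrahedron) (m : ℕ) {v : VecPoly} (hv : ∀ a, v a ∈ polyZero K m) :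
    ∃ q : Fin 4 → Coef, (∀ i β, q i β ≠ 0 → β ∈ level m ∧ NonVertex m β) ∧ v = vecBern K m q := by
  choose d hd hdv using fun a => exists_bern K (hv a).1
  refine ⟨fun i => ∑ a, K i a • d a, fun i β h => ?_, ?_⟩
  · change (∑ a, K i a • d a) β ≠ 0 at h
    rw [Finset.sum_apply] at h
    obtain ⟨a, -, h⟩ := Finset.exists_ne_zero_of_sum_ne_zero h
    have h1 : d a β ≠ 0 := fun h0 => h (by simp [h0])
    have hl : β ∈ level m := by
      by_contra hl; exact h1 (hd a β hl)
    refine ⟨hl, fun b => ?_⟩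
    by_contra! hb
    rw [eq_single_of_le hl hb] at h1
    refine h1 (bern_vertex_coef (K := K) ?_)
    rw [hdv]
    exact (hv a).2 b (Set.mem_univ b)
  · funext a
    rw [vecBern, vec_eq_sum_gv K v a]
    simp only [map_sum, map_smul, hdv]

theorem vecBern_mem_polyZero (K : Tetrahedron) {m : ℕ} {q : Fin 4 → Coef}
    (hq : ∀ i β, q i β ≠ 0 → NonVertex m β) (a : Fin 3) : vecBern K m q a ∈ polyZero K m := by
  refine Submodule.sum_mem _ fun i _ => Submodule.smul_mem _ _ ⟨bern_mem_polyDeg K _ _, fun b _ => ?_⟩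
  rw [evalAt_bern_vertex]
  by_contra h
  have := hq i _ (left_ne_zero_of_mul h) b
  simp at this

/-! ### The kernel of the curl -/

theorem coeff_euler (p : Poly) (s : Fin 3 →₀ ℕ) :
    coeff s (∑ b, X b * pderiv b p) = (s.degree : ℝ) * coeff s p := by
  induction p using MvPolynomial.induction_on' with
  | monomial t r =>
    have : ∀ b, X b * pderiv b (monomial t r) = (t b : ℝ) • monomial t r := fun b => by
      rw [X_mul_pderiv_monomial, Nat.cast_smul_eq_nsmul]
    simp only [this, ← Finset.sum_smul, coeff_smul, smul_eq_mul, coeff_monomial]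
    split_ifs with h
    · subst h
      rw [← Nat.cast_sum, Finsupp.degree_eq_sum]
    · simp
  | add p q hp hq =>
    simp only [map_add, mul_add, Finset.sum_add_distrib, coeff_add] at *
    rw [hp, hq]

/-- The Poincaré lemma for polynomial vector fields. -/
theorem exists_potential {m : ℕ} (w : Fin 3 → Poly) (hw : ∀ a b, pderiv a (w b) = pderiv b (w a))
    (hm : ∀ a, w a ∈ polyDeg m) : ∃ u ∈ polyDeg (m + 1), ∀ a, pderiv a u = w a := by
  set P : Poly := ∑ b, X b * w b with hP
  -- Inverse Euler operator. The constant term, where the degree is zero, gets coefficient 0 by the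
  -- convention for inverses.
  set u : Poly := ∑ s ∈ P.support, monomial s ((s.degree : ℝ)⁻¹ * coeff s P) with hu
  have hcoeff : ∀ s, coeff s u = (s.degree : ℝ)⁻¹ * coeff s P := by
    intro s
    rw [hu, coeff_sum]
    simp only [coeff_monomial, Finset.sum_ite_eq']
    split_ifs with h
    · rfl
    · rw [notMem_support_iff.1 h, mul_zero]
  have hPm : P ∈ polyDeg (m + 1) := by
    refine Submodule.sum_mem _ fun b _ => ?_
    rw [add_comm]
    refine mul_mem_polyDeg ?_ (hm b)
    rw [polyDeg, mem_restrictTotalDegree, totalDegree_X]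
  refine ⟨u, ?_, fun a => ?_⟩
  · rw [polyDeg, mem_restrictTotalDegree] at hPm ⊢
    refine (totalDegree_le_of_support_subset fun s hs => ?_).trans hPm
    rw [mem_support_iff, hcoeff] at hs
    exact mem_support_iff.2 (right_ne_zero_of_mul hs)
  · ext s
    have hd : pderiv a P = w a + ∑ b, X b * pderiv b (w a) := by
      simp only [hP, map_sum, Derivation.leibniz, pderiv_X, smul_eq_mul, hw a,
        Finset.sum_add_distrib]
      rw [add_comm]
      congr 1
      rw [Finset.sum_eq_single a]
      · simp
      · intro b _ hb; simp [hb]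
      · simp
    have h1 := congrArg (coeff s) hd
    rw [coeff_add, coeff_euler, coeff_pderiv] at h1
    rw [coeff_pderiv, hcoeff, map_add, Finsupp.degree_single, mul_assoc, h1]
    have : (s.degree : ℝ) + 1 ≠ 0 := by positivity
    push_cast
    field_simp
    ring

/-- Each row is curl-free and has a potential; symmetry of σ makes the vector of potentials
curl-free in turn. -/
theorem exists_hess_eq {m : ℕ} {σ : MatPoly} (hsym : σ.IsSymm) (hσ : ∀ a b, σ a b ∈ polyDeg m)
    (hc : curl σ = 0) : ∃ u ∈ polyDeg (m + 2), hess u = σ := by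
  have h0 : ∀ a b, pderiv (b + 1) (σ a (b + 2)) = pderiv (b + 2) (σ a (b + 1)) := fun a b =>
    sub_eq_zero.1 (congrFun (congrFun hc a) b)
  have h : ∀ a b c, pderiv b (σ a c) = pderiv c (σ a b) := by
    intro a b c
    have e0 := h0 a 0
    have e1 := h0 a 1
    have e2 := h0 a 2
    simp only [show (0 + 1 : Fin 3) = 1 from rfl, show (0 + 2 : Fin 3) = 2 from rfl,
      show (1 + 1 : Fin 3) = 2 from rfl, show (1 + 2 : Fin 3) = 0 from rfl,
      show (2 + 1 : Fin 3) = 0 from rfl, show (2 + 2 : Fin 3) = 1 from rfl] at e0 e1 e2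
    fin_cases b <;> fin_cases c <;> first | rfl | assumption | (symm; assumption)
  choose w hwm hw using fun a => exists_potential (σ a) (h a) (hσ a)
  obtain ⟨u, hu, huw⟩ := exists_potential w (fun a b => by rw [hw, hw, hsym.apply]) hwm
  refine ⟨u, hu, ?_⟩
  ext1 a b
  change pderiv a (pderiv b u) = _
  rw [huw, hw, hsym.apply]

/-! ### Second differences of Bernstein coefficients -/

/-- Contraction with x_i - x_i' and x_j - x_j' isolates a mixed difference of D. Conversely,
vanishing mixed differences give D_ij = a_i + b_j, and both summands are killed by ∑ ∇λ_i = 0. -/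
theorem xi_eq_zero_iff (K : Tetrahedron) (m : ℕ) (D : Coef4) : xi K m D = 0 ↔
    ∀ i i' j j', ∀ γ ∈ level m, D i j γ - D i' j γ = D i j' γ - D i' j' γ := by
  constructor
  · intro h i i' j j' γ hγ
    have h1 : ∑ a, (K i a - K i' a) • ∑ b, (K j b - K j' b) • xi K m D a b = 0 := by simp [h]
    have h2 : ∀ a, ∑ b, (K j b - K j' b) • xi K m D a b
        = ∑ p, gv K p a • (bern K m (D p j) - bern K m (D p j')) := by
      intro a
      simp only [xi_apply, Finset.smul_sum, smul_smul]
      rw [Finset.sum_comm]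
      refine Finset.sum_congr rfl fun p _ => ?_
      rw [Finset.sum_comm]
      have : ∀ s, ∑ b, ((K j b - K j' b) * (gv K p a * gv K s b)) • bern K m (D p s)
          = (gv K p a * ((if s = j then 1 else 0) - (if s = j' then 1 else 0))) •
            bern K m (D p s) := by
        intro s
        rw [← Finset.sum_smul, ← gv_dot_edge K, Finset.mul_sum]
        congr 1
        exact Finset.sum_congr rfl fun b _ => by ring
      simp only [this]
      simp [mul_sub, sub_smul, Finset.sum_sub_distrib, smul_sub]
    simp only [h2, Finset.smul_sum, smul_smul] at h1
    rw [Finset.sum_comm] at h1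
    have h4 : ∀ p, ∑ a, ((K i a - K i' a) * gv K p a) • (bern K m (D p j) - bern K m (D p j'))
        = ((if p = i then 1 else 0) - (if p = i' then 1 else 0) : ℝ) •
          (bern K m (D p j) - bern K m (D p j')) := by
      intro p
      rw [← Finset.sum_smul, ← gv_dot_edge K]
      congr 1
      exact Finset.sum_congr rfl fun a _ => mul_comm _ _
    simp only [h4] at h1
    have h3 : bern K m (D i j - D i j' - (D i' j - D i' j')) = 0 := by
      simpa [sub_smul, Finset.sum_sub_distrib] using h1
    have := bern_eq_zero K m _ h3 γ hγ
    simp only [Pi.sub_apply] at this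
    linarith
  · intro h
    ext1 a b
    rw [xi_apply]
    have h1 : ∀ i j, bern K m (D i j) = bern K m (D i 0) + bern K m (D 0 j - D 0 0) := by
      intro i j
      rw [← map_add]
      refine bern_congr K fun γ hγ => ?_
      have := h i 0 j 0 γ hγ
      simp only [Pi.add_apply, Pi.sub_apply]
      linarith
    have e0 : ∑ i, ∑ j, (gv K i a * gv K j b) • bern K m (D i j)
        = ∑ i, ∑ j, (gv K i a * gv K j b) • bern K m (D i 0)
          + ∑ i, ∑ j, (gv K i a * gv K j b) • bern K m (D 0 j - D 0 0) := by
      simp only [← Finset.sum_add_distrib, ← smul_add, ← h1]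
    have e1 : ∑ i, ∑ j, (gv K i a * gv K j b) • bern K m (D i 0) = 0 :=
      Finset.sum_eq_zero fun i _ => by
        rw [← Finset.sum_smul, ← Finset.mul_sum, sum_gv, mul_zero, zero_smul]
    have e2 : ∑ i, ∑ j, (gv K i a * gv K j b) • bern K m (D 0 j - D 0 0) = 0 := by
      rw [Finset.sum_comm]
      exact Finset.sum_eq_zero fun j _ => by
        rw [← Finset.sum_smul, ← Finset.sum_mul, sum_gv, zero_mul, zero_smul]
    rw [e0, e1, e2, add_zero]; rfl

/-- The two layers nearest face p are connected by moves whose pivot lies in that face: mass at p is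
moved to a first, then the rest. -/
theorem low_const {V : Type*} {n : ℕ} {p a : Fin 4} (hap : a ≠ p) (g : (Fin 4 → ℕ) → V)
    (hmove : ∀ γ ∈ level n, γ p = 0 → ∀ i i', g (γ + e i) = g (γ + e i'))
    {ε : Fin 4 → ℕ} (hε : ε ∈ level (n + 1)) (hp : ε p ≤ 1) : g ε = g (Pi.single a (n + 1)) := by
  have key : ∀ t, ∀ ε ∈ level (n + 1), ε p ≤ 1 → n + 1 - ε a = t →
      g ε = g (Pi.single a (n + 1)) := by
    intro t
    induction t with
    | zero =>
      intro ε hε _ h0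
      rw [eq_single_of_le hε (a := a) (by omega)]
    | succ t ih =>
      intro ε hε hp h0
      obtain ⟨j, hja, hj, hjp⟩ : ∃ j, j ≠ a ∧ ε j ≠ 0 ∧ (ε p ≠ 0 → j = p) := by
        by_cases h1 : ε p = 0
        · obtain ⟨j, hja, hj⟩ : ∃ j, j ≠ a ∧ ε j ≠ 0 := by
            by_contra! hall
            rw [mem_level, Finset.sum_eq_single a (fun b _ hb => hall b hb) (by simp)] at hε
            omega
          exact ⟨j, hja, hj, fun h => absurd h1 h⟩
        · exact ⟨p, hap.symm, h1, fun _ => rfl⟩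
      obtain ⟨γ, rfl⟩ := exists_sub_e hj
      have hγ := add_e_mem_level.1 hε
      have hγp : γ p = 0 := by
        by_contra h2
        have h3 := hjp (by rw [add_e_apply]; omega)
        subst h3
        rw [add_e_self] at hp
        omega
      rw [hmove γ hγ hγp j a]
      refine ih _ (add_e_mem_level.2 hγ) ?_ ?_
      · rw [add_e_of_ne _ hap.symm]; omega
      · rw [add_e_of_ne _ hja.symm] at h0
        rw [add_e_self]
        omega
  exact key _ ε hε hp rfl

/-- Coefficients with vanishing tangential second differences at a face vanish in the two layers
next to this face. -/
theorem eq_zero_of_second_diff {n : ℕ} {p a : Fin 4} (hap : a ≠ p) (f : Coef)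
    (hdiff : ∀ γ ∈ level n, γ p = 0 → ∀ i i' j j', j ≠ p → j' ≠ p →
      f (γ + e i + e j) - f (γ + e i' + e j) = f (γ + e i + e j') - f (γ + e i' + e j'))
    (hbase : ∀ j, f (Pi.single a (n + 1) + e j) = 0)
    {γ : Fin 4 → ℕ} (hγ : γ ∈ level (n + 2)) (hp : γ p ≤ 1) : f γ = 0 := by
  have hmove : ∀ ε ∈ level (n + 1), ε p ≤ 1 → ∀ j j', j ≠ p → j' ≠ p →
      f (ε + e j) = f (ε + e j') := by
    intro ε hε hp j j' hj hj'
    -- The first difference of f in the direction e_j - e_j' is constant on both layers and vanishes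
    -- at the base point (n + 1) e_a.
    have := low_const hap (fun ε => f (ε + e j) - f (ε + e j')) (fun γ hγ h0 i i' => by
      have := hdiff γ hγ h0 i i' j j' hj hj'
      linarith) hε hp
    simp only [hbase, sub_zero] at this
    linarith
  have key : ∀ t, ∀ γ ∈ level (n + 2), γ p ≤ 1 → n + 2 - γ a = t → f γ = 0 := by
    intro t
    induction t with
    | zero =>
      intro γ hγ _ h0
      have h2 : (Pi.single a (n + 2) : Fin 4 → ℕ) = Pi.single a (n + 1) + e a := by
        rw [← Pi.single_add]
      rw [eq_single_of_le hγ (a := a) (by omega), h2]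
      exact hbase a
    | succ t ih =>
      intro γ hγ hp h0
      by_cases hj : ∃ j, j ≠ a ∧ j ≠ p ∧ γ j ≠ 0
      · obtain ⟨j, hja, hjp, hj⟩ := hj
        obtain ⟨ε, rfl⟩ := exists_sub_e hj
        rw [add_e_of_ne _ hjp.symm] at hp
        have hε := add_e_mem_level.1 hγ
        rw [hmove ε hε hp j a hjp hap]
        refine ih _ (add_e_mem_level.2 hε) ?_ ?_
        · rwa [add_e_of_ne _ hap.symm]
        · rw [add_e_of_ne _ hja.symm] at h0
          rw [add_e_self]
          omega
      · push Not at hj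
        -- With all mass on a and p and at most one unit on p, the index is the base point (n + 1)
        -- e_a + e_p.
        obtain ⟨x, y, hf⟩ := exists_four_of_ne hap
        have hx := hj x hf.iy.symm hf.xy.symm
        have hy := hj y hf.iz.symm hf.xz.symm
        have hs := (mem_level_four hf).1 hγ
        obtain ⟨ε, rfl⟩ := exists_sub_e (γ := γ) (a := p) (by omega)
        rw [add_e_self] at hp hs
        rw [add_e_of_ne _ hf.xy.symm] at hx
        rw [add_e_of_ne _ hf.xz.symm] at hy
        rw [add_e_of_ne _ hap, add_e_of_ne _ hf.xy.symm, add_e_of_ne _ hf.xz.symm] at hs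
        rw [eq_single_of_le (add_e_mem_level.1 hγ) (a := a) (by omega)]
        exact hbase p
  exact key _ γ hγ hp rfl

/-- Vanishing second differences make first differences constant; they vanish near x_0, where the
support condition applies at another entry, so c itself is constant, with value zero. -/
theorem injective_hess (K : Tetrahedron) (q : ℕ) {u : Poly} (hu : u ∈ bubbleH2 K (q + 6))
    (h : hess u = 0) : u = 0 := by
  obtain ⟨c, hc, rfl⟩ := (mem_bubbleH2_iff K q u).1 hu
  rw [hess_bern K (q + 6), xi_eq_zero_iff] at h
  have hz : ∀ ε : Fin 4 → ℕ, ∀ a, ε a < 2 → c ε = 0 := fun ε a ha => by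
    by_contra h0; have := hc ε h0 a; omega
  have hmove : ∀ j j', ∀ ε ∈ level (q + 7), c (ε + e j) = c (ε + e j') := by
    intro j j' ε hε
    have := level_const (fun ε => c (ε + e j) - c (ε + e j')) (fun i i' γ hγ => by
      have := h i i' j j' γ hγ
      simp only [sh_apply, add_right_comm γ (e i) (e _), add_right_comm γ (e i') (e _)] at this ⊢
      linarith) 0 hε
    have h1 : ∀ j, c (Pi.single 0 (q + 6 + 1) + e j) = 0 := fun j =>
      hz _ 1 (by rw [add_e_apply]; split_ifs <;> simp)
    simp only [h1, sub_zero] at this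
    linarith
  rw [bern_apply]
  refine Finset.sum_eq_zero fun γ hγ => ?_
  rw [level_const c hmove 0 hγ, hz _ 1 (by simp), zero_smul]

/-- Coefficients may be corrected by an affine function so that they vanish near the faces. -/
theorem exists_vanishing_second_diff {n : ℕ} (c : Coef) {S : Coef4}
    (hsupp : ∀ i j γ, S i j γ ≠ 0 → ∀ p, γ p = 0 → j = p)
    (hc : ∀ i i' j j', ∀ γ ∈ level n,
      c (γ + e i + e j) - S i j γ - (c (γ + e i' + e j) - S i' j γ)
        = c (γ + e i + e j') - S i j' γ - (c (γ + e i' + e j') - S i' j' γ)) :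
    ∃ f : Coef, (∀ p, ∀ γ ∈ level (n + 2), γ p ≤ 1 → f γ = 0) ∧
      ∀ i i' j j', ∀ γ ∈ level n,
        f (γ + e i + e j) - S i j γ - (f (γ + e i' + e j) - S i' j γ)
          = f (γ + e i + e j') - S i j' γ - (f (γ + e i' + e j') - S i' j' γ) := by
  set c₀ : ℝ := c (Pi.single 0 (n + 1) + e 0) with hc₀
  set r : Fin 4 → ℝ := fun j => c (Pi.single 0 (n + 1) + e j) - c₀ with hr
  have hr0 : r 0 = 0 := sub_self _
  -- The function affine in γ that interpolates c at the four points (n + 1) e_0 + e_j.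
  obtain ⟨l, hl, hl0⟩ : ∃ l : Coef, (∀ γ j, l (γ + e j) = l γ + r j) ∧
      l (Pi.single 0 (n + 1)) = c₀ := by
    refine ⟨fun γ => c₀ + ∑ j, (γ j : ℝ) * r j, fun γ j => ?_, ?_⟩
    · simp only [Pi.add_apply, Nat.cast_add, add_mul, Finset.sum_add_distrib, add_assoc]
      congr 2
      rw [Finset.sum_eq_single j]
      · simp
      · intro b _ hb; simp [hb]
      · simp
    · simp only [add_eq_left]
      rw [Finset.sum_eq_single 0]
      · rw [hr0, mul_zero]
      · intro b _ hb; simp [hb]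
      · simp
  have hdiff : ∀ i i' j j', ∀ γ ∈ level n,
      (c - l) (γ + e i + e j) - S i j γ - ((c - l) (γ + e i' + e j) - S i' j γ)
        = (c - l) (γ + e i + e j') - S i j' γ - ((c - l) (γ + e i' + e j') - S i' j' γ) := by
    intro i i' j j' γ hγ
    have := hc i i' j j' γ hγ
    simp only [Pi.sub_apply, hl]
    linarith
  have hface : ∀ p, ∀ γ ∈ level n, γ p = 0 → ∀ i i' j j', j ≠ p → j' ≠ p →
      (c - l) (γ + e i + e j) - (c - l) (γ + e i' + e j)
        = (c - l) (γ + e i + e j') - (c - l) (γ + e i' + e j') := by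
    intro p γ hγ h0 i i' j j' hj hj'
    have hz : ∀ i j, j ≠ p → S i j γ = 0 := fun i j hj => by
      by_contra hne; exact hj (hsupp i j γ hne p h0)
    have := hdiff i i' j j' γ hγ
    rw [hz i j hj, hz i' j hj, hz i j' hj', hz i' j' hj'] at this
    linarith
  have hbase : ∀ j, (c - l) (Pi.single 0 (n + 1) + e j) = 0 := by
    intro j
    rw [Pi.sub_apply, hl, hl0, hr]
    ring
  have h1 : ∀ p, p ≠ 0 → ∀ γ ∈ level (n + 2), γ p ≤ 1 → (c - l) γ = 0 := fun p hp γ hγ h0 =>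
    eq_zero_of_second_diff hp.symm _ (hface p) hbase hγ h0
  refine ⟨c - l, fun p γ hγ h0 => ?_, hdiff⟩
  by_cases hp : p = 0
  · subst hp
    -- Face 0 is treated from vertex 1; its base values are already zero because they lie in the two
    -- layers next to face 2.
    refine eq_zero_of_second_diff (a := 1) (by decide) _ (hface 0) (fun j => ?_) hγ h0
    refine h1 2 (by decide) _ (add_e_mem_level.2 (single_mem_level _ 1)) ?_
    rw [add_e_apply, Pi.single_eq_of_ne (by decide)]
    split_ifs <;> simp
  · exact h1 p hp γ hγ h0

theorem xi_isSymm (K : Tetrahedron) (m : ℕ) {S : Coef4} (hS : ∀ i j, S i j = S j i) :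
    (xi K m S).IsSymm := Matrix.IsSymm.ext fun a b => by
  rw [xi_apply, xi_apply, Finset.sum_comm]
  exact Finset.sum_congr rfl fun i _ => Finset.sum_congr rfl fun j _ => by
    rw [hS j i, mul_comm]

theorem xi_mem_polyDeg (K : Tetrahedron) (m : ℕ) (S : Coef4) (a b : Fin 3) :
    xi K m S a b ∈ polyDeg m := by
  rw [xi_apply]
  exact Submodule.sum_mem _ fun i _ => Submodule.sum_mem _ fun j _ =>
    Submodule.smul_mem _ _ (bern_mem_polyDeg K _ _)

/-- For γ_p = 0 and j ≠ p the array S vanishes, so the coefficients of any potential have vanishing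
second differences along face p; an affine correction then places the potential in the bubble space.
-/
theorem exists_bubbleH2_hess_eq (K : Tetrahedron) (q : ℕ) {S : Coef4} (hS : S ∈ curlCoef (q + 4))
    (h : curl (xi K (q + 6) S) = 0) : ∃ u ∈ bubbleH2 K (q + 6), hess u = xi K (q + 6) S := by
  obtain ⟨hsym, hsupp⟩ := hS
  obtain ⟨u, hu, huS⟩ := exists_hess_eq (xi_isSymm K (q + 6) hsym) (xi_mem_polyDeg K (q + 6) S) h
  obtain ⟨c, -, rfl⟩ := exists_bern K hu
  rw [hess_bern, ← sub_eq_zero, ← map_sub, xi_eq_zero_iff] at huS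
  obtain ⟨f, hf, hfS⟩ := exists_vanishing_second_diff c
    (fun i j γ hne p h0 => ((hsupp i j γ hne).2.2 p h0).2) huS
  refine ⟨bern K (q + 6 + 2) fun γ => if γ ∈ level (q + 6 + 2) then f γ else 0,
    (mem_bubbleH2_iff K q _).2 ⟨_, fun γ hγ a => ?_, rfl⟩, ?_⟩
  · by_contra! ha
    exact hγ (ite_eq_right_iff.2 fun hl => hf a γ hl (by omega))
  · rw [bern_congr K (d := f) fun γ hγ => if_pos hγ, hess_bern, ← sub_eq_zero, ← map_sub,
      xi_eq_zero_iff]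
    exact hfS

/-! ### The bubble complex -/

theorem pderiv_pderiv_comm (i j : Fin 3) (p : Poly) :
    pderiv i (pderiv j p) = pderiv j (pderiv i p) := by
  ext s
  simp only [coeff_pderiv, add_right_comm s (Finsupp.single i 1), Finsupp.add_apply]
  by_cases h : i = j
  · subst h; rfl
  · simp [h, Ne.symm h]
    ring

theorem curl_hess (u : Poly) : curl (hess u) = 0 := by
  ext1 a b
  change pderiv (b + 1) (pderiv a (pderiv (b + 2) u))
    - pderiv (b + 2) (pderiv a (pderiv (b + 1) u)) = 0
  rw [pderiv_pderiv_comm (b + 1) a, pderiv_pderiv_comm (b + 2) a,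
    pderiv_pderiv_comm (b + 1) (b + 2), sub_self]

theorem div_curl (σ : MatPoly) : div (curl σ) = 0 := by
  funext a
  change ∑ b, pderiv b (pderiv (b + 1) (σ a (b + 2)) - pderiv (b + 2) (σ a (b + 1))) = 0
  simp only [Fin.sum_univ_three, map_sub, show (0 + 1 : Fin 3) = 1 from rfl,
    show (0 + 2 : Fin 3) = 2 from rfl, show (1 + 1 : Fin 3) = 2 from rfl,
    show (1 + 2 : Fin 3) = 0 from rfl, show (2 + 1 : Fin 3) = 0 from rfl,
    show (2 + 2 : Fin 3) = 1 from rfl]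
  rw [pderiv_pderiv_comm 1 0, pderiv_pderiv_comm 2 0, pderiv_pderiv_comm 2 1]
  ring

theorem div_theta_eq_vecBern (K : Tetrahedron) {m : ℕ} {c : Coef4} (hc : c ∈ divCoef m) :
    div (theta K (m + 1) c) = vecBern K m (divc c) :=
  funext fun a => div_theta K m c hc.2 a

theorem hess_mem_bubbleCurlS (K : Tetrahedron) (n : Fin 4 → E3)
    (hn : ∀ i, IsUnitFaceNormal K i (n i)) (q : ℕ) {u : Poly} (hu : u ∈ bubbleH2 K (q + 6)) :
    hess u ∈ bubbleCurlS K n (q + 6) := by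
  obtain ⟨c, hc, rfl⟩ := (mem_bubbleH2_iff K q u).1 hu
  -- Cutting off outside the level leaves the polynomial unchanged but yields the support required
  -- by `curlCoef`.
  have hcd : bern K (q + 8) c
      = bern K (q + 6 + 2) fun γ => if γ ∈ level (q + 6 + 2) then c γ else 0 :=
    bern_congr K fun γ hγ => (if_pos hγ).symm
  rw [hcd, hess_bern]
  refine xi_mem_bubbleCurlS K n hn q ⟨fun i j => ?_, fun i j γ h => ?_⟩
  · funext γ
    simp only [sh_apply, add_right_comm γ (e i) (e j)]
  · simp only [sh_apply] at h
    obtain ⟨hl, h0⟩ := ite_ne_right_iff.1 h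
    have hg := hc _ h0
    have hγ : γ ∈ level (q + 6) := add_e_mem_level.1 (add_e_mem_level.1 hl)
    refine ⟨hγ, fun a => ?_, fun a ha => ?_⟩
    · have h2 : ∑ b ∈ Finset.univ.erase a, 2 ≤ ∑ b ∈ Finset.univ.erase a, (γ + e i + e j) b :=
        Finset.sum_le_sum fun b _ => hg b
      have h3 := Finset.add_sum_erase _ (γ + e i + e j) (Finset.mem_univ a)
      rw [mem_level.1 hl, add_e_apply, add_e_apply] at h3
      simp only [Finset.sum_const, Finset.card_erase_of_mem (Finset.mem_univ a), Finset.card_univ,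
        Fintype.card_fin, smul_eq_mul] at h2
      omega
    · have := hg a
      simp only [add_e_apply, ha] at this
      split_ifs at this with h1 h2 <;> omega

theorem curl_mem_bubbleDivT (K : Tetrahedron) (n : Fin 4 → E3)
    (hn : ∀ i, IsUnitFaceNormal K i (n i)) (t : Fin 4 → Fin 4 → E3)
    (ht : ∀ j l, j < l → IsUnitEdgeTangent K j l (t j l)) (q : ℕ) {σ : MatPoly}
    (hσ : σ ∈ bubbleCurlS K n (q + 6)) : curl σ ∈ bubbleDivT K n t (q + 5) := by
  obtain ⟨S, hS, rfl⟩ := bubbleCurlS_le K n hn q hσ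
  rw [curl_xi K (q + 5)]
  exact Submodule.smul_mem _ _ (theta_mem_bubbleDivT K n hn t ht q (curlc_mem_divCoef hS))

theorem div_mem_polyZeroModRT (K : Tetrahedron) (n : Fin 4 → E3)
    (hn : ∀ i, IsUnitFaceNormal K i (n i)) (t : Fin 4 → Fin 4 → E3)
    (ht : ∀ j l, j < l → IsUnitEdgeTangent K j l (t j l)) (q : ℕ) {v : MatPoly}
    (hv : v ∈ bubbleDivT K n t (q + 5)) : div v ∈ polyZeroModRT K (q + 4) := by
  obtain ⟨c, hc, rfl⟩ := bubbleDivT_le K n hn t ht q hv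
  rw [div_theta_eq_vecBern K hc]
  refine ⟨vecBern_mem_polyZero K fun i β h => (divc_support hc i h).2,
    (orthogonal_RT_iff K _ _).2 ⟨0, fun i => ?_, ?_⟩⟩
  · simpa using sum_divc_smul hc i fun _ => (1 : ℝ)
  · rw [mul_zero]
    exact Finset.sum_eq_zero fun i _ => by simpa using sum_divc_smul hc i fun h => (h : ℝ)

theorem exists_curl_eq (K : Tetrahedron) (n : Fin 4 → E3)
    (hn : ∀ i, IsUnitFaceNormal K i (n i)) (t : Fin 4 → Fin 4 → E3)
    (ht : ∀ j l, j < l → IsUnitEdgeTangent K j l (t j l)) (q : ℕ) {v : MatPoly}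
    (hv : v ∈ bubbleDivT K n t (q + 6)) (h : div v = 0) :
    ∃ σ ∈ bubbleCurlS K n (q + 7), curl σ = v := by
  obtain ⟨c, hc, rfl⟩ := bubbleDivT_le K n hn t ht (q + 1) hv
  rw [div_theta_eq_vecBern K hc] at h
  have hdiv : ∀ i, divc c i = divc c 0 := by
    intro i
    funext γ
    by_cases hγ : γ ∈ level (q + 5)
    · exact coef_eq_of_vecBern_eq_zero K _ _ h i 0 γ hγ
    · have h0 : ∀ i, divc c i γ = 0 := fun i => by
        by_contra hne; exact hγ (divc_support hc i hne).1
      rw [h0, h0]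
  obtain ⟨S, hS, rfl⟩ := exists_curlc_eq (n := q + 4) (by omega) hc hdiv
  refine ⟨xi K (q + 7) ((gdet K)⁻¹ • S),
    xi_mem_bubbleCurlS K n hn (q + 1) (Submodule.smul_mem _ _ hS), ?_⟩
  rw [curl_xi K (q + 6), map_smul, map_smul, smul_smul, mul_inv_cancel₀ (gdet_ne_zero K), one_smul]

theorem exists_div_eq (K : Tetrahedron) (n : Fin 4 → E3)
    (hn : ∀ i, IsUnitFaceNormal K i (n i)) (t : Fin 4 → Fin 4 → E3)
    (ht : ∀ j l, j < l → IsUnitEdgeTangent K j l (t j l)) (q : ℕ) {w : VecPoly}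
    (hw : w ∈ polyZeroModRT K (q + 5)) : ∃ v ∈ bubbleDivT K n t (q + 6), div v = w := by
  obtain ⟨p, hp, rfl⟩ := exists_vecBern K (q + 5) hw.1
  obtain ⟨A, hQ, hM⟩ := (orthogonal_RT_iff K _ _).1 hw.2
  obtain ⟨c, hc, s, hs⟩ := exists_divc_eq (n := q + 4) (by omega) p A hp hQ (by
    rw [hM]; push_cast; ring)
  refine ⟨theta K (q + 6) c, theta_mem_bubbleDivT K n hn t ht (q + 1) hc, ?_⟩
  rw [div_theta_eq_vecBern K hc]
  refine vecBern_congr K _ _ _ fun i j γ _ => ?_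
  simp only [hs, Pi.add_apply]
  ring

end BubbleComplex

end

theorem mainTheorem6 (k : ℕ) (hk : 7 ≤ k) (K : BubbleComplex.Tetrahedron)
    (n : Fin 4 → BubbleComplex.E3)
    (hn : ∀ i, BubbleComplex.IsUnitFaceNormal K i (n i))
    (t : Fin 4 → Fin 4 → BubbleComplex.E3)
    (ht : ∀ j l, j < l → BubbleComplex.IsUnitEdgeTangent K j l (t j l)) :
    ∃ (h₀ : ∀ u ∈ BubbleComplex.bubbleH2 K k,
          BubbleComplex.hess u ∈ BubbleComplex.bubbleCurlS K n k)
      (h₁ : ∀ σ ∈ BubbleComplex.bubbleCurlS K n k,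
          BubbleComplex.curl σ ∈ BubbleComplex.bubbleDivT K n t (k - 1))
      (h₂ : ∀ v ∈ BubbleComplex.bubbleDivT K n t (k - 1),
          BubbleComplex.div v ∈ BubbleComplex.polyZeroModRT K (k - 2)),
      Function.Injective (BubbleComplex.hess.restrict h₀) ∧
      Function.Exact (BubbleComplex.hess.restrict h₀) (BubbleComplex.curl.restrict h₁) ∧
      Function.Exact (BubbleComplex.curl.restrict h₁) (BubbleComplex.div.restrict h₂) ∧
      Function.Surjective (BubbleComplex.div.restrict h₂) := by
  -- With k = q + 7 the truncated subtractions in the degrees compute definitionally.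
  obtain ⟨q, rfl⟩ := Nat.exists_eq_add_of_le' hk
  refine ⟨fun u hu => BubbleComplex.hess_mem_bubbleCurlS K n hn (q + 1) hu,
    fun σ hσ => BubbleComplex.curl_mem_bubbleDivT K n hn t ht (q + 1) hσ,
    fun v hv => BubbleComplex.div_mem_polyZeroModRT K n hn t ht (q + 1) hv, ?_, ?_, ?_, ?_⟩
  · rw [injective_iff_map_eq_zero]
    rintro ⟨u, hu⟩ h
    exact Subtype.ext (BubbleComplex.injective_hess K (q + 1) hu (congrArg Subtype.val h))
  · rintro ⟨σ, hσ⟩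
    constructor
    · intro h
      obtain ⟨S, hS, rfl⟩ := BubbleComplex.bubbleCurlS_le K n hn (q + 1) hσ
      obtain ⟨u, hu, huS⟩ :=
        BubbleComplex.exists_bubbleH2_hess_eq K (q + 1) hS (congrArg Subtype.val h)
      exact ⟨⟨u, hu⟩, Subtype.ext huS⟩
    · rintro ⟨u, hu⟩
      rw [← hu]
      exact Subtype.ext (BubbleComplex.curl_hess u)
  · rintro ⟨v, hv⟩
    constructor
    · intro h
      obtain ⟨σ, hσ, hσv⟩ :=
        BubbleComplex.exists_curl_eq K n hn t ht q hv (congrArg Subtype.val h)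
      exact ⟨⟨σ, hσ⟩, Subtype.ext hσv⟩
    · rintro ⟨σ, hσ⟩
      rw [← hσ]
      exact Subtype.ext (BubbleComplex.div_curl σ)
  · rintro ⟨w, hw⟩
    obtain ⟨v, hv, hvw⟩ := BubbleComplex.exists_div_eq K n hn t ht q hw
    exact ⟨⟨v, hv⟩, Subtype.ext hvw⟩
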